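/- Let $D\subset\mathbb{R}^3$ be a bounded connected open set with $C^1$ boundary. For $\omega\in\mathbb{C}$ let $$\mathcal{K}_D^{\omega}[f](x)=\int_D \frac{e^{i\omega|x-y|}}{4\pi|x-y|}\,f(y)\,dy ,\qquad \mathcal{K}_D:=\mathcal{K}_D^{0},$$ and let $N(u)=u+|u|^2u$ and $\langle f,g\rangle_D=\int_D\overline{f}\,g\,dx$. For $\epsilon\ge 0$, $\hat\omega\in\mathbb{C}$ and complex-valued $u\in H^2(D)$ consider the scaled nonlinear Lippmann--Schwinger equation $$u=\hat\omega^2\,\mathcal{K}_D^{\epsilon\hat\omega}[N(u)]\quad\text{on } D; \tag{1}$$ if $u\neq0$ solves (1), then $\hat\omega$ is called a scaled nonlinear dielectric resonance with resonant state $u$. Let $\lambda_j$ be a simple eigenvalue of the Newtonian potential $\mathcal{K}_D$ on $L^2(D)$, let $\varphi_j$ be an eigenfunction for $\lambda_j$ with $\|\varphi_j\|_{L^2(D)}=1$, and set $\hat\omega_j:=\lambda_j^{-1/2}$. Then there are $\delta>0$, $r>0$ and, with $U:=\{(a,\epsilon)\in\mathbb{R}\times[0,\infty):|a|+\epsilon<\delta\}$,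 $C^1$ functions $\hat\omega:U\to\mathbb{C}$ and $h:U\to H^2(D)$ such that $\hat\omega(a,\epsilon)\to\hat\omega_j$ and $h(a,\epsilon)\to0$ in $H^2(D)$ as $(a,\epsilon)\to(0,0)$ in $U$, and such that the following hold. 1. (Existence) For all $(a,\epsilon)\in U$, $\langle\varphi_j,h(a,\epsilon)\rangle_D=0$, and $u(a,\epsilon):=a\varphi_j+h(a,\epsilon)$ belongs to $H^2(D)$ and solves (1) with $\hat\omega=\hat\omega(a,\epsilon)$; moreover $|\hat\omega(a,\epsilon)-\hat\omega_j|<r$ and $\|u(a,\epsilon)\|_{H^2(D)}<r$. If $a\neq0$, then $u(a,\epsilon)\ne0$, so that $\hat\omega(a,\epsilon)$ is a scaled nonlinear dielectric resonance with resonant state $u(a,\epsilon)$. 2. (Uniqueness up to phase) If $(a,\epsilon)\in U$, and $(\hat\omega',v)\in\mathbb{C}\times H^2(D)$ solves (1) with $|\hat\omega'-\hat\omega_j|<r$, $\|v\|_{H^2(D)}<r$ and $|\langle\varphi_j,v\rangle_D|=|a|$, then $v=e^{i\theta}u(a,\epsilon)$ for some $\theta\in[0,2\pi)$, and, if $a\neq0$,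 $\hat\omega'=\hat\omega(a,\epsilon)$. -/

import Mathlib

open MeasureTheory Filter Topology

noncomputable section

/-- Three-dimensional Euclidean space. -/
abbrev Space3 : Type := EuclideanSpace ℝ (Fin 3)

/-- The complex Hilbert space `L²(D)`; its inner product `inner ℂ f g = ∫_D conj f * g` is
conjugate-linear in the first argument. -/
abbrev L2 (D : Set Space3) : Type := Lp ℂ 2 (volume.restrict D)

/-- `D` has a boundary of class `C¹`: near each of its boundary points, `D` is the sublevel set
`{ρ < 0}` of a `C¹` function `ρ` without critical points. -/
def HasC1Boundary (D : Set Space3) : Prop :=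
  ∀ x ∈ frontier D, ∃ V : Set Space3, ∃ ρ : Space3 → ℝ,
    IsOpen V ∧ x ∈ V ∧ ContDiffOn ℝ 1 ρ V ∧ (∀ y ∈ V, fderiv ℝ ρ y ≠ 0) ∧
      D ∩ V = {y ∈ V | ρ y < 0}

/-- Test functions on `D`: smooth real functions with compact support contained in `D`. -/
def IsTestFun (D : Set Space3) (ψ : Space3 → ℝ) : Prop :=
  ContDiff ℝ (⊤ : ℕ∞) ψ ∧ HasCompactSupport ψ ∧ tsupport ψ ⊆ D

/-- The classical partial derivative `∂ᵢψ`. -/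
def partialDeriv (i : Fin 3) (ψ : Space3 → ℝ) (x : Space3) : ℝ :=
  fderiv ℝ ψ x (EuclideanSpace.single i 1)

/-- `g ∈ L²(D)` is the weak partial derivative `∂ᵢ f` of `f ∈ L²(D)` on `D`. -/
def HasWeakPartial {D : Set Space3} (i : Fin 3) (f g : L2 D) : Prop :=
  ∀ ψ : Space3 → ℝ, IsTestFun D ψ →
    ∫ x in D, f x * (partialDeriv i ψ x : ℂ) = -∫ x in D, g x * (ψ x : ℂ)

theorem IsTestFun.memLp {D : Set Space3} {ψ : Space3 → ℝ} (hψ : IsTestFun D ψ) :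
    MemLp (fun x => (ψ x : ℂ)) 2 (volume.restrict D) := by
  have h := hψ.1.continuous.memLp_of_hasCompactSupport (p := 2) (μ := volume.restrict D) hψ.2.1
  exact h.ofReal

theorem IsTestFun.memLp_partialDeriv {D : Set Space3} {ψ : Space3 → ℝ} (hψ : IsTestFun D ψ)
    (i : Fin 3) : MemLp (fun x => (partialDeriv i ψ x : ℂ)) 2 (volume.restrict D) := by
  have hc : Continuous (partialDeriv i ψ) :=
    (hψ.1.continuous_fderiv (by simp)).clm_apply continuous_const
  have hs : HasCompactSupport (partialDeriv i ψ) :=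
    hψ.2.1.fderiv_apply (𝕜 := ℝ) (EuclideanSpace.single i 1)
  exact (hc.memLp_of_hasCompactSupport (p := 2) (μ := volume.restrict D) hs).ofReal

theorem setIntegral_L2_add_mul {D : Set Space3} (f g : L2 D) {m : Space3 → ℂ}
    (hm : MemLp m 2 (volume.restrict D)) :
    ∫ x in D, (f + g : L2 D) x * m x = (∫ x in D, f x * m x) + ∫ x in D, g x * m x := by
  have hf : Integrable (fun x => f x * m x) (volume.restrict D) := (Lp.memLp f).integrable_mul hm
  have hg : Integrable (fun x => g x * m x) (volume.restrict D) := (Lp.memLp g).integrable_mul hm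
  rw [← integral_add hf hg]
  refine integral_congr_ae ?_
  filter_upwards [Lp.coeFn_add f g] with x hx
  rw [hx, Pi.add_apply, add_mul]

theorem setIntegral_L2_smul_mul {D : Set Space3} (c : ℂ) (f : L2 D) (m : Space3 → ℂ) :
    ∫ x in D, (c • f : L2 D) x * m x = c * ∫ x in D, f x * m x := by
  rw [← integral_const_mul]
  refine integral_congr_ae ?_
  filter_upwards [Lp.coeFn_smul c f] with x hx
  rw [hx, Pi.smul_apply, smul_eq_mul, mul_assoc]

theorem HasWeakPartial.zero {D : Set Space3} (i : Fin 3) :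
    HasWeakPartial i (0 : L2 D) (0 : L2 D) := by
  intro ψ _
  have h (m : Space3 → ℂ) : ∫ x in D, (0 : L2 D) x * m x = 0 := by
    simpa using setIntegral_L2_smul_mul 0 (0 : L2 D) m
  rw [h, h, neg_zero]

theorem HasWeakPartial.add {D : Set Space3} {i : Fin 3} {f₁ g₁ f₂ g₂ : L2 D}
    (h₁ : HasWeakPartial i f₁ g₁) (h₂ : HasWeakPartial i f₂ g₂) :
    HasWeakPartial i (f₁ + f₂) (g₁ + g₂) := by
  intro ψ hψ
  rw [setIntegral_L2_add_mul _ _ (hψ.memLp_partialDeriv i), setIntegral_L2_add_mul _ _ hψ.memLp,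
    h₁ ψ hψ, h₂ ψ hψ]
  ring

theorem HasWeakPartial.smul {D : Set Space3} {i : Fin 3} (c : ℂ) {f g : L2 D}
    (h : HasWeakPartial i f g) : HasWeakPartial i (c • f) (c • g) := by
  intro ψ hψ
  rw [setIntegral_L2_smul_mul, setIntegral_L2_smul_mul, h ψ hψ]
  ring

/-- Labels for a function, its first and its second partial derivatives. -/
abbrev Jet2Index : Type := Unit ⊕ (Fin 3 ⊕ (Fin 3 × Fin 3))

/-- The Sobolev space `H²(D)`: a function in `L²(D)` whose weak derivatives `∂ᵢu` and `∂ⱼ∂ᵢu` lie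
in `L²(D)`, recorded together with these (uniquely determined) derivatives. The norm inherited
from the `ℓ²`-sum is `‖u‖² = ‖u‖²_{L²} + ∑ᵢ ‖∂ᵢu‖²_{L²} + ∑ᵢⱼ ‖∂ⱼ∂ᵢu‖²_{L²}`. -/
def H2 (D : Set Space3) : Submodule ℂ (PiLp 2 (fun _ : Jet2Index => L2 D)) where
  carrier := {F | (∀ i, HasWeakPartial i (F (.inl ())) (F (.inr (.inl i)))) ∧
    ∀ i j, HasWeakPartial j (F (.inr (.inl i))) (F (.inr (.inr (i, j))))}
  zero_mem' := ⟨fun i => HasWeakPartial.zero i, fun _ j => HasWeakPartial.zero j⟩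
  add_mem' h₁ h₂ := ⟨fun i => (h₁.1 i).add (h₂.1 i), fun i j => (h₁.2 i j).add (h₂.2 i j)⟩
  smul_mem' c _ h := ⟨fun i => (h.1 i).smul c, fun i j => (h.2 i j).smul c⟩

/-- The inclusion `H²(D) ⊆ L²(D)`. -/
def toL2 {D : Set Space3} (u : H2 D) : L2 D := u.1 (.inl ())

/-- The outgoing Green function `e^{iω|x|} / (4π|x|)` of `-(Δ + ω²)` in `ℝ³`. -/
def greenFun (ω : ℂ) (x : Space3) : ℂ :=
  Complex.exp (Complex.I * ω * (‖x‖ : ℂ)) / (4 * (Real.pi : ℂ) * (‖x‖ : ℂ))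

/-- The volume potential `𝒦_D^ω[f](x) = ∫_D G^ω(x - y) f(y) dy`. -/
def volumePotential (D : Set Space3) (ω : ℂ) (f : Space3 → ℂ) (x : Space3) : ℂ :=
  ∫ y in D, greenFun ω (x - y) * f y

/-- The Newtonian potential `𝒦_D`, that is, the volume potential at frequency `0`. -/
def newtonPotential (D : Set Space3) (f : Space3 → ℂ) (x : Space3) : ℂ :=
  volumePotential D 0 f x

/-- `f ∈ L²(D)` satisfies `𝒦_D[f] = lam f` in `L²(D)`. -/
def NewtonEigenEq {D : Set Space3} (lam : ℝ) (f : L2 D) : Prop :=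
  ∀ᵐ x ∂(volume.restrict D), newtonPotential D f x = (lam : ℂ) * f x

/-- `lam` is a simple eigenvalue of the (self-adjoint) Newtonian potential `𝒦_D` on `L²(D)`:
its eigenspace has complex dimension one. -/
def IsSimpleNewtonEigenvalue (D : Set Space3) (lam : ℝ) : Prop :=
  ∃ φ : L2 D, φ ≠ 0 ∧ NewtonEigenEq lam φ ∧
    ∀ f : L2 D, NewtonEigenEq lam f → ∃ c : ℂ, f = c • φ

/-- The Kerr nonlinearity `N(z) = z + |z|² z`. -/
def kerr (z : ℂ) : ℂ := z + (‖z‖ : ℂ) ^ 2 * z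

/-- The scaled nonlinear Lippmann–Schwinger equation `u = ω² 𝒦_D^{εω}[N(u)]` on `D`,
for the scaled frequency `ω` and `u ∈ H²(D)`. -/
def SolvesScaledLS {D : Set Space3} (ε : ℝ) (ω : ℂ) (u : H2 D) : Prop :=
  ∀ᵐ x ∂(volume.restrict D),
    toL2 u x = ω ^ 2 * volumePotential D ((ε : ℂ) * ω) (fun y => kerr (toL2 u y)) x

/-- `ω` is a scaled nonlinear dielectric resonance with (nontrivial) resonant state `u`. -/
def IsScaledResonance {D : Set Space3} (ε : ℝ) (ω : ℂ) (u : H2 D) : Prop :=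
  toL2 u ≠ 0 ∧ SolvesScaledLS ε ω u

/-- The parameter set `{(a, ε) : a ∈ ℝ, ε ≥ 0, |a| + ε < δ}`. -/
def paramSet (δ : ℝ) : Set (ℝ × ℝ) := {p | 0 ≤ p.2 ∧ |p.1| + p.2 < δ}

end

/-! The unknown is taken to be the source g = u + |u|²u in L²(D) instead of the state u. Let V(k) be
the volume potential of frequency k, K = V(0), and ω₀ = λ^(-1/2). Then u = ω² V(εω) g, and (1)
becomes g = u + |u|²u. With u = a y and g = a g', division by a leaves g' = y + a²|y|²y, y = ω²
V(εω) g', to which the normalisation ⟨φ, y⟩ = 1 is added. This problem (`branchMap`) is regular at a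
= ε = 0, where (φ, ω₀) solves it.

Its derivative in (g', ω) there is (α, μ) ↦ (α − λ⁻¹Kα − 2ω₀λμ φ, ⟨φ, α⟩ + 2ω₀λμ). Adding φ times
the second component to the first leaves 1 − λ⁻¹K + ⟨φ, ·⟩φ, which is invertible by the Fredholm
alternative, since K is compact and symmetric and λ is simple (`isUnit_shiftedOp`). The implicit
function theorem, over ℝ because |u|²u is not holomorphic, gives the branch
(`SimpleBifurcation.exists_branch`), and h = a (y − y(0,0)).

For uniqueness, a small solution with source g and b = ⟨φ, u⟩ satisfies ‖g − bφ‖ ≤ η‖g‖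
(`SimpleBifurcation.eventually_norm_sub_le`). So either g = 0, or g/b is close to φ and, as |b| =
|a| and the equation is covariant under phases, solves the normalised problem with parameter a; it
is then the branch point (`SimpleBifurcation.eventually_eq_branch`). A competitor is only known to
lie in H²(D), so its source has to be controlled: applying Δ + k² to (1) in the sense of
distributions yields g = −ω⁻²(Δ + k²)v, an L² function bounded by the H² norm of v
(`SolvesScaledLS.exists_source`).

The cubic term is smooth on H²(D) ∩ L^∞(D), so V has to be a C¹ family of operators from L²(D) into
that space (`exists_volumePotential_clm`). The sup bound for K is Cauchy–Schwarz; the H² bound is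
obtained in frequency space, writing the Newtonian energy as a time integral of heat kernels
(`exists_toL2_eq_newtonL2`). The family is then expanded in powers of k. Its coefficients have
kernels |z|ⁿ/(4π|z|), and they arise from n = 0 and n = 1 by double commutators with the coordinate
functions, which multiply a kernel by |z|². -/

noncomputable section

/-! ### The Newtonian potential as a bounded symmetric operator on L²(D) -/

section Kernel

theorem greenFun_zero_freq (x : Space3) :
    greenFun 0 x = ((4 * Real.pi * ‖x‖)⁻¹ : ℝ) := by
  simp [greenFun]

theorem norm_greenFun_zero_freq (x : Space3) : ‖greenFun 0 x‖ = (4 * Real.pi * ‖x‖)⁻¹ := by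
  rw [greenFun_zero_freq, Complex.norm_real, Real.norm_of_nonneg (by positivity)]

theorem norm_greenFun_zero_freq_le (x : Space3) : ‖greenFun 0 x‖ ≤ ‖x‖⁻¹ := by
  rw [norm_greenFun_zero_freq, mul_inv]
  refine mul_le_of_le_one_left (by positivity) (inv_le_one_of_one_le₀ ?_)
  nlinarith [Real.pi_gt_three]

theorem greenFun_neg (ω : ℂ) (x : Space3) : greenFun ω (-x) = greenFun ω x := by
  simp [greenFun]

theorem measurable_greenFun (ω : ℂ) : Measurable (greenFun ω) := by
  unfold greenFun
  fun_prop

/-- In polar coordinates the factor r² of the three-dimensional volume element cancels the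
singularity. -/
theorem integrableOn_norm_sq_inv (r : ℝ) :
    IntegrableOn (fun z : Space3 => (‖z‖ ^ 2)⁻¹) (Metric.ball 0 r) := by
  rw [integrableOn_fun_norm_addHaar volume (f := fun r : ℝ => (r ^ 2)⁻¹)]
  refine (integrableOn_const (C := (1 : ℝ)) (by simp)).congr_fun (fun y hy => ?_) measurableSet_Ioo
  have : y ≠ 0 := hy.1.ne'
  simp [this]

/-- Within unit distance of the pole, translation invariance removes the dependence on x; beyond it
the integrand is at most one and contributes at most the volume of D. -/
theorem exists_lintegral_norm_sq_inv_le {D : Set Space3} (hD : volume D ≠ ⊤) :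
    ∃ C : NNReal, ∀ x : Space3, ∫⁻ y in D, ENNReal.ofReal ((‖x - y‖ ^ 2)⁻¹) ≤ C := by
  set F : Space3 → ENNReal := (Metric.ball 0 1).indicator fun z => ENNReal.ofReal ((‖z‖ ^ 2)⁻¹)
  have hF : ∫⁻ z, F z ≠ ⊤ := by
    rw [lintegral_indicator measurableSet_ball]
    have := (integrableOn_norm_sq_inv 1).hasFiniteIntegral
    rw [hasFiniteIntegral_iff_ofReal (ae_of_all _ fun z => by positivity)] at this
    exact this.ne
  have hm : Measurable F := Measurable.indicator (by fun_prop) measurableSet_ball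
  refine ⟨((∫⁻ z, F z) + volume D).toNNReal, fun x => ?_⟩
  rw [ENNReal.coe_toNNReal (ENNReal.add_ne_top.2 ⟨hF, hD⟩)]
  calc ∫⁻ y in D, ENNReal.ofReal ((‖x - y‖ ^ 2)⁻¹) ≤ ∫⁻ y in D, (F (x - y) + 1) := by
        refine lintegral_mono fun y => ?_
        by_cases h : x - y ∈ Metric.ball (0 : Space3) 1
        · simp [F, Set.indicator_of_mem h]
        · have h1 : 1 ≤ ‖x - y‖ := by simpa using h
          simp only [F, Set.indicator_of_notMem h, zero_add]
          rw [← ENNReal.ofReal_one]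
          exact ENNReal.ofReal_le_ofReal (inv_le_one_of_one_le₀ (one_le_pow₀ h1))
    _ = (∫⁻ y in D, F (x - y)) + volume D := by
        rw [lintegral_add_right _ measurable_const]; simp
    _ ≤ (∫⁻ y, F (x - y)) + volume D := by gcongr; exact Measure.restrict_le_self
    _ = _ := by rw [lintegral_sub_left_eq_self (f := F)]

/-- The Newtonian kernel is square integrable on sets of finite volume, uniformly in the pole. -/
theorem exists_eLpNorm_greenFun_le {D : Set Space3} (hD : volume D ≠ ⊤) :
    ∃ C : NNReal, ∀ x, eLpNorm (fun y => greenFun 0 (x - y)) 2 (volume.restrict D) ≤ C := by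
  obtain ⟨C, hC⟩ := exists_lintegral_norm_sq_inv_le hD
  refine ⟨NNReal.sqrt C, fun x => ?_⟩
  rw [eLpNorm_eq_lintegral_rpow_enorm_toReal (by simp) (by simp)]
  simp only [ENNReal.toReal_ofNat, ENNReal.rpow_ofNat, one_div]
  rw [NNReal.sqrt_eq_rpow, ENNReal.coe_rpow_of_nonneg _ (by norm_num), one_div]
  gcongr
  refine (lintegral_mono fun y => ?_).trans (hC x)
  rw [← ofReal_norm, ← ENNReal.ofReal_pow (norm_nonneg _), ← inv_pow]
  exact ENNReal.ofReal_le_ofReal (pow_le_pow_left₀ (norm_nonneg _) (norm_greenFun_zero_freq_le _) 2)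

theorem memLp_greenFun {D : Set Space3} (hD : volume D ≠ ⊤) (x : Space3) :
    MemLp (fun y => greenFun 0 (x - y)) 2 (volume.restrict D) := by
  obtain ⟨C, hC⟩ := exists_eLpNorm_greenFun_le hD
  exact ⟨((measurable_greenFun 0).comp (by fun_prop)).aestronglyMeasurable,
    (hC x).trans_lt ENNReal.coe_lt_top⟩

theorem stronglyMeasurable_volumePotential {D : Set Space3} (ω : ℂ) (f : L2 D) :
    StronglyMeasurable (volumePotential D ω f) := by
  unfold volumePotential
  apply StronglyMeasurable.integral_prod_right (f := fun x y => greenFun ω (x - y) * f y)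
  have h1 : Measurable fun p : Space3 × Space3 => greenFun ω (p.1 - p.2) :=
    (measurable_greenFun ω).comp (by fun_prop)
  exact h1.stronglyMeasurable.mul ((Lp.stronglyMeasurable f).comp_measurable measurable_snd)

theorem volumePotential_congr {D : Set Space3} (ω : ℂ) {f g : Space3 → ℂ}
    (h : f =ᵐ[volume.restrict D] g) : volumePotential D ω f = volumePotential D ω g := by
  funext x
  refine integral_congr_ae ?_
  filter_upwards [h] with y hy
  rw [hy]

theorem integrable_greenFun_mul {D : Set Space3} (hD : volume D ≠ ⊤) (f : L2 D) (x : Space3) :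
    Integrable (fun y => greenFun 0 (x - y) * f y) (volume.restrict D) :=
  (memLp_greenFun hD x).integrable_mul (Lp.memLp f)

/-- The integral over `D` against a square integrable function is an inner product. -/
theorem integral_mul_eq_inner {D : Set Space3} {k : Space3 → ℂ}
    (hk : MemLp k 2 (volume.restrict D)) (f : L2 D) :
    ∫ y in D, k y * f y = inner ℂ hk.star.toLp f := by
  rw [L2.inner_def]
  refine integral_congr_ae ?_
  filter_upwards [hk.star.coeFn_toLp] with y h1
  rw [h1]
  simp [mul_comm]

theorem norm_toLp_star {D : Set Space3} {k : Space3 → ℂ}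
    (hk : MemLp k 2 (volume.restrict D)) :
    ‖hk.star.toLp‖ = (eLpNorm k 2 (volume.restrict D)).toReal := by
  rw [Lp.norm_toLp]
  congr 1
  exact eLpNorm_congr_norm_ae (ae_of_all _ fun x => by simp)

/-- Cauchy–Schwarz against the uniformly square integrable kernel. This supplies the L^∞ half of the
regularity of potentials. -/
theorem exists_norm_newtonPotential_le {D : Set Space3} (hD : volume D ≠ ⊤) :
    ∃ C : ℝ, 0 ≤ C ∧ ∀ (f : L2 D) (x : Space3), ‖newtonPotential D f x‖ ≤ C * ‖f‖ := by
  obtain ⟨C, hC⟩ := exists_eLpNorm_greenFun_le hD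
  refine ⟨C, C.2, fun f x => ?_⟩
  unfold newtonPotential volumePotential
  rw [integral_mul_eq_inner (memLp_greenFun hD x)]
  refine (norm_inner_le_norm _ _).trans ?_
  gcongr
  rw [norm_toLp_star (memLp_greenFun hD x)]
  exact ENNReal.toReal_le_of_le_ofReal C.2 (by simpa using hC x)

theorem exists_newtonL2 {D : Set Space3} (hD : volume D ≠ ⊤) :
    ∃ K : L2 D →L[ℂ] L2 D, ∀ f, K f =ᵐ[volume.restrict D] newtonPotential D f := by
  have : IsFiniteMeasure (volume.restrict D) := ⟨by simpa using hD.lt_top⟩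
  obtain ⟨C, hC0, hC⟩ := exists_norm_newtonPotential_le hD
  have hmem (f : L2 D) : MemLp (newtonPotential D f) 2 (volume.restrict D) :=
    .of_bound (stronglyMeasurable_volumePotential 0 f).aestronglyMeasurable (C * ‖f‖)
      (ae_of_all _ (hC f))
  let K : L2 D →ₗ[ℂ] L2 D :=
    { toFun := fun f : L2 D => (hmem f).toLp
      map_add' := fun f g => by
        rw [← MemLp.toLp_add]
        refine MemLp.toLp_congr _ _ (ae_of_all _ fun x => ?_)
        rw [Pi.add_apply]
        unfold newtonPotential volumePotential
        rw [← integral_add (integrable_greenFun_mul hD f x) (integrable_greenFun_mul hD g x)]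
        refine integral_congr_ae ?_
        filter_upwards [Lp.coeFn_add f g] with y hy
        rw [hy, Pi.add_apply, mul_add]
      map_smul' := fun c f => by
        rw [RingHom.id_apply, ← MemLp.toLp_const_smul]
        refine MemLp.toLp_congr _ _ (ae_of_all _ fun x => ?_)
        rw [Pi.smul_apply, smul_eq_mul]
        unfold newtonPotential volumePotential
        rw [← integral_const_mul]
        refine integral_congr_ae ?_
        filter_upwards [Lp.coeFn_smul c f] with y hy
        rw [hy, Pi.smul_apply, smul_eq_mul, mul_left_comm] }
  refine ⟨K.mkContinuous ((volume.restrict D Set.univ).toReal ^ (1 / 2 : ℝ) * C) fun f => ?_,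
    fun f => (hmem f).coeFn_toLp⟩
  refine (Lp.norm_le_of_ae_bound (C := C * ‖f‖) (by positivity) ?_).trans (le_of_eq ?_)
  · filter_upwards [(hmem f).coeFn_toLp] with x hx
    change ‖((hmem f).toLp _) x‖ ≤ _
    rw [hx]
    exact hC f x
  · simp [measureUnivNNReal, ENNReal.coe_toNNReal_eq_toReal, mul_assoc]

/-- The Newtonian potential as a bounded operator on `L²(D)`. -/
def newtonL2 {D : Set Space3} (hD : volume D ≠ ⊤) : L2 D →L[ℂ] L2 D := (exists_newtonL2 hD).choose

theorem coeFn_newtonL2 {D : Set Space3} (hD : volume D ≠ ⊤) (f : L2 D) :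
    newtonL2 hD f =ᵐ[volume.restrict D] newtonPotential D f := (exists_newtonL2 hD).choose_spec f

theorem newtonEigenEq_iff {D : Set Space3} (hD : volume D ≠ ⊤) (lam : ℝ) (f : L2 D) :
    NewtonEigenEq lam f ↔ newtonL2 hD f = (lam : ℂ) • f := by
  unfold NewtonEigenEq
  constructor
  · intro h
    apply Lp.ext
    filter_upwards [coeFn_newtonL2 hD f, h, Lp.coeFn_smul (lam : ℂ) f] with x h1 h2 h3
    rw [h1, h2, h3, Pi.smul_apply, smul_eq_mul]
  · intro h
    filter_upwards [coeFn_newtonL2 hD f, Lp.coeFn_smul (lam : ℂ) f] with x h1 h3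
    rw [← h1, h, h3, Pi.smul_apply, smul_eq_mul]

/-- Absolute convergence of the double integral in the Newtonian energy. -/
theorem integrable_prod_greenFun {D : Set Space3} (hD : volume D ≠ ⊤) {f g : Space3 → ℂ}
    (hf : Integrable f (volume.restrict D)) (hg : MemLp g 2 (volume.restrict D)) :
    Integrable (fun p : Space3 × Space3 => f p.1 * (greenFun 0 (p.1 - p.2) * g p.2))
      ((volume.restrict D).prod (volume.restrict D)) := by
  have hG : Measurable fun p : Space3 × Space3 => greenFun 0 (p.1 - p.2) :=
    (measurable_greenFun 0).comp (by fun_prop)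
  have hm : AEStronglyMeasurable
      (fun p : Space3 × Space3 => f p.1 * (greenFun 0 (p.1 - p.2) * g p.2))
      ((volume.restrict D).prod (volume.restrict D)) :=
    hf.1.comp_fst.mul (hG.aestronglyMeasurable.mul hg.1.comp_snd)
  obtain ⟨C, hC⟩ := exists_eLpNorm_greenFun_le hD
  refine (integrable_prod_iff hm).2 ⟨ae_of_all _ fun x =>
    ((memLp_greenFun hD x).integrable_mul hg).const_mul (f x), ?_⟩
  refine (hf.norm.mul_const (C * (eLpNorm g 2 (volume.restrict D)).toReal)).mono'
    hm.norm.integral_prod_right' (ae_of_all _ fun x => ?_)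
  rw [Real.norm_of_nonneg (by positivity)]
  simp only [norm_mul]
  rw [integral_const_mul]
  gcongr
  have h1 : ∫ y in D, ‖greenFun 0 (x - y)‖ * ‖g y‖
      = (eLpNorm (fun y => greenFun 0 (x - y) * g y) 1 (volume.restrict D)).toReal := by
    rw [eLpNorm_one_eq_lintegral_enorm]
    refine Eq.trans ?_ (integral_norm_eq_lintegral_enorm ((memLp_greenFun hD x).1.mul hg.1))
    simp only [norm_mul]
  rw [h1, ← ENNReal.coe_toReal, ← ENNReal.toReal_mul]
  refine ENNReal.toReal_mono (ENNReal.mul_ne_top ENNReal.coe_ne_top hg.2.ne) ?_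
  refine (eLpNorm_smul_le_mul_eLpNorm (p := 2) (q := 2) (r := 1) hg.1
    (memLp_greenFun hD x).1).trans ?_
  gcongr
  exact hC x

theorem integral_mul_newtonPotential_comm {D : Set Space3} (hD : volume D ≠ ⊤) {f g : Space3 → ℂ}
    (hf : Integrable f (volume.restrict D)) (hg : MemLp g 2 (volume.restrict D)) :
    ∫ x in D, f x * newtonPotential D g x = ∫ x in D, newtonPotential D f x * g x := by
  unfold newtonPotential volumePotential
  simp_rw [← integral_const_mul, ← integral_mul_const]
  rw [integral_integral_swap (integrable_prod_greenFun hD hf hg)]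
  refine integral_congr_ae (ae_of_all _ fun x => integral_congr_ae (ae_of_all _ fun y => ?_))
  simp only
  rw [← greenFun_neg 0 (x - y), neg_sub]
  ring

theorem newtonPotential_star {D : Set Space3} (f : Space3 → ℂ) (x : Space3) :
    newtonPotential D (star f) x = star (newtonPotential D f x) := by
  unfold newtonPotential volumePotential
  rw [Complex.star_def, ← integral_conj]
  simp only [greenFun_zero_freq, Pi.star_apply, map_mul, Complex.conj_ofReal, Complex.star_def]

/-- The kernel is real and even in x − y, so Fubini moves the operator across the inner product. -/
theorem inner_newtonL2_comm {D : Set Space3} (hD : volume D ≠ ⊤) (f g : L2 D) :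
    inner ℂ f (newtonL2 hD g) = inner ℂ (newtonL2 hD f) g := by
  have : IsFiniteMeasure (volume.restrict D) := ⟨by simpa using hD.lt_top⟩
  rw [L2.inner_def, L2.inner_def]
  have hf : Integrable (star (f : Space3 → ℂ)) (volume.restrict D) :=
    ((Lp.memLp f).star).integrable (by norm_num)
  have := integral_mul_newtonPotential_comm hD hf (Lp.memLp g)
  convert this using 1
  · refine integral_congr_ae ?_
    filter_upwards [coeFn_newtonL2 hD g] with x hx
    rw [hx]; simp [mul_comm]
  · refine integral_congr_ae ?_
    filter_upwards [coeFn_newtonL2 hD f] with x hx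
    rw [hx, newtonPotential_star]; simp [mul_comm]

end Kernel

/-! ### Compactness of the Newtonian potential -/

section Compact

variable {H H' : Type*} [NormedAddCommGroup H] [InnerProductSpace ℂ H]
  [NormedAddCommGroup H'] [NormedSpace ℂ H'] [CompleteSpace H']

/-- A Hilbert–Schmidt operator is compact. -/
theorem isCompactOperator_of_summable_norm_sq {ι : Type*} (b : HilbertBasis ι ℂ H)
    (T : H →L[ℂ] H') (hT : Summable fun i => ‖T (b i)‖ ^ 2) : IsCompactOperator T := by
  classical
  let S (s : Finset ι) : H →L[ℂ] H' := ∑ i ∈ s, (innerSL ℂ (b i)).smulRight (T (b i))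
  have hS (s : Finset ι) (f : H) : S s f = T (∑ i ∈ s, b.repr f i • b i) := by
    simp [S, b.repr_apply_apply]
  have hlim (f : H) : Tendsto (fun s => S s f) atTop (𝓝 (T f)) := by
    simp_rw [hS]
    exact (T.continuous.tendsto f).comp (b.hasSum_repr f)
  have hcomp (s : Finset ι) : IsCompactOperator (S s) := by
    refine Finset.sum_induction _ (fun A : H →L[ℂ] H' => IsCompactOperator A)
      (fun A B hA hB => hA.add hB) isCompactOperator_zero (fun i _ => ?_)
    have : IsCompactOperator (ContinuousLinearMap.id ℂ ℂ) := isCompactOperator_id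
    exact (this.comp_clm (innerSL ℂ (b i))).clm_comp
      (ContinuousLinearMap.smulRight (ContinuousLinearMap.id ℂ ℂ) (T (b i)))
  refine isCompactOperator_of_tendsto (l := atTop) (F := S) ?_ (Eventually.of_forall hcomp)
  rw [Metric.tendsto_atTop]
  intro ε hε
  obtain ⟨s, hs⟩ := summable_iff_vanishing_norm.1 hT ((ε / 2) ^ 2) (by positivity)
  refine ⟨s, fun t hst => ?_⟩
  rw [dist_eq_norm]
  refine lt_of_le_of_lt (ContinuousLinearMap.opNorm_le_bound _ (half_pos hε).le fun f => ?_)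
    (half_lt_self hε)
  have hl : Tendsto (fun u => ‖S t f - S u f‖) atTop (𝓝 ‖S t f - T f‖) :=
    (tendsto_const_nhds.sub (hlim f)).norm
  rw [sub_apply]
  -- As T f is the limit of S u f, it suffices to bound S t − S u uniformly for u containing t;
  -- Cauchy–Schwarz and Bessel reduce this to a tail of the series of squares.
  refine le_of_tendsto hl ?_
  filter_upwards [eventually_ge_atTop t] with u htu
  have h1 : S u f - S t f = ∑ i ∈ u \ t, inner ℂ (b i) f • T (b i) := by
    have : S u = (∑ i ∈ u \ t, (innerSL ℂ (b i)).smulRight (T (b i))) + S t :=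
      (Finset.sum_sdiff htu).symm
    rw [this]
    simp
  rw [norm_sub_rev, h1]
  have h2 : ‖∑ i ∈ u \ t, inner ℂ (b i) f • T (b i)‖
      ≤ ∑ i ∈ u \ t, ‖inner ℂ (b i) f‖ * ‖T (b i)‖ :=
    (norm_sum_le _ _).trans (le_of_eq (by simp only [norm_smul]))
  refine h2.trans (abs_le_of_sq_le_sq' ?_ (by positivity)).2
  refine (Finset.sum_mul_sq_le_sq_mul_sq _ _ _).trans ?_
  rw [mul_pow, mul_comm]
  gcongr
  · refine (le_abs_self _).trans (hs (u \ t) ?_).le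
    exact Finset.disjoint_of_subset_right hst Finset.sdiff_disjoint
  · exact b.orthonormal.sum_inner_products_le f

/-- For fixed x the values of the potentials of an orthonormal family are Fourier coefficients of
the kernel with pole x. Bessel bounds their square sum by a constant independent of x, and
integrating over D gives the Hilbert–Schmidt condition. -/
theorem isCompactOperator_newtonL2 {D : Set Space3} (hD : volume D ≠ ⊤) :
    IsCompactOperator (newtonL2 hD) := by
  have : IsFiniteMeasure (volume.restrict D) := ⟨by simpa using hD.lt_top⟩
  obtain ⟨w, b, -⟩ := exists_hilbertBasis ℂ (L2 D)
  obtain ⟨C, hC⟩ := exists_eLpNorm_greenFun_le hD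
  refine isCompactOperator_of_summable_norm_sq b _ (summable_of_sum_le
    (c := ∫ _ in D, (C : ℝ) ^ 2) (fun i => by positivity) fun s => ?_)
  have h1 (f : L2 D) : ‖newtonL2 hD f‖ ^ 2 = ∫ x in D, ‖newtonPotential D f x‖ ^ 2 := by
    have h := L2.inner_def (𝕜 := ℂ) (newtonL2 hD f) (newtonL2 hD f)
    rw [inner_self_eq_norm_sq_to_K] at h
    have h' : ∫ x in D, inner ℂ (newtonL2 hD f x) (newtonL2 hD f x)
        = ((∫ x in D, ‖newtonPotential D f x‖ ^ 2 : ℝ) : ℂ) := by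
      rw [← integral_complex_ofReal]
      refine integral_congr_ae ?_
      filter_upwards [coeFn_newtonL2 hD f] with x hx
      rw [hx, inner_self_eq_norm_sq_to_K]
      simp
    rw [h'] at h
    exact Complex.ofReal_injective (by simpa using h)
  have hint (f : L2 D) :
      Integrable (fun x => ‖newtonPotential D f x‖ ^ 2) (volume.restrict D) := by
    have : MemLp (newtonPotential D f) 2 (volume.restrict D) :=
      (memLp_congr_ae (coeFn_newtonL2 hD f)).1 (Lp.memLp _)
    exact this.integrable_norm_pow (by norm_num)
  simp_rw [h1]
  rw [← integral_finsetSum _ fun i _ => hint _]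
  refine integral_mono (integrable_finsetSum _ fun i _ => hint _) (integrable_const _) fun x => ?_
  have h2 (f : L2 D) : newtonPotential D f x = inner ℂ (memLp_greenFun hD x).star.toLp f :=
    integral_mul_eq_inner (memLp_greenFun hD x) f
  simp only [h2]
  have h3 := b.orthonormal.sum_inner_products_le (s := s) (memLp_greenFun hD x).star.toLp
  calc _ = ∑ i ∈ s, ‖inner ℂ (b i) (memLp_greenFun hD x).star.toLp‖ ^ 2 := by
        refine Finset.sum_congr rfl fun i _ => ?_
        rw [norm_inner_symm]
    _ ≤ _ := h3
    _ ≤ (C : ℝ) ^ 2 := by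
        gcongr
        rw [norm_toLp_star (memLp_greenFun hD x)]
        exact ENNReal.toReal_le_of_le_ofReal C.2 (by simpa using hC x)

end Compact

/-! ### Lifting operators by closed graph, extending functionals by Hahn–Banach -/

section Lift

/-- A bounded operator whose range lies in a continuously embedded Banach space is bounded into
that space. -/
theorem exists_clm_lift {A Y H : Type*} [NormedAddCommGroup A] [NormedSpace ℂ A] [CompleteSpace A]
    [NormedAddCommGroup Y] [NormedSpace ℂ Y] [CompleteSpace Y]
    [NormedAddCommGroup H] [NormedSpace ℂ H] (j : Y →L[ℂ] H) (hj : Function.Injective j)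
    (T : A →L[ℂ] H) (hT : ∀ a, ∃ y, j y = T a) : ∃ S : A →L[ℂ] Y, j ∘L S = T := by
  choose s hs using hT
  let S : A →ₗ[ℂ] Y :=
    { toFun := s
      map_add' := fun a b => hj (by simp [hs])
      map_smul' := fun c a => hj (by simp [hs]) }
  refine ⟨ContinuousLinearMap.ofSeqClosedGraph (g := S) fun u x y hu hy => hj ?_,
    ContinuousLinearMap.ext fun a => hs a⟩
  have h1 : Tendsto (fun n => T (u n)) atTop (𝓝 (T x)) := (T.continuous.tendsto x).comp hu
  have h2 : Tendsto (fun n => T (u n)) atTop (𝓝 (j y)) := by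
    have := (j.continuous.tendsto y).comp hy
    refine this.congr fun n => ?_
    exact hs (u n)
  rw [tendsto_nhds_unique h2 h1]
  exact (hs x).symm

/-- The bound makes l vanish on the kernel of ι, so l descends to a bounded functional on the range
of ι, to which Hahn–Banach applies. No norm on V is needed, which suits spaces of test functions. -/
theorem exists_extension_of_bound {V E : Type*} [AddCommGroup V] [Module ℝ V]
    [NormedAddCommGroup E] [NormedSpace ℝ E] (ι : V →ₗ[ℝ] E) (l : V →ₗ[ℝ] ℝ) (C : ℝ)
    (h : ∀ v, |l v| ≤ C * ‖ι v‖) : ∃ T : E →L[ℝ] ℝ, ∀ v, T (ι v) = l v := by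
  have hker : LinearMap.ker ι ≤ LinearMap.ker l := fun v hv => by
    have := h v
    rw [LinearMap.mem_ker.1 hv, norm_zero, mul_zero] at this
    exact abs_eq_zero.1 (le_antisymm this (abs_nonneg _))
  let l' : LinearMap.range ι →ₗ[ℝ] ℝ := (LinearMap.ker ι).liftQ l hker ∘ₗ
    (ι.quotKerEquivRange.symm : LinearMap.range ι →ₗ[ℝ] _)
  have hl' (v : V) : l' ⟨ι v, LinearMap.mem_range_self ι v⟩ = l v := by
    have : ι.quotKerEquivRange.symm ⟨ι v, LinearMap.mem_range_self ι v⟩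
        = (LinearMap.ker ι).mkQ v := by
      rw [LinearEquiv.symm_apply_eq]
      rfl
    simp only [l', LinearMap.comp_apply, LinearEquiv.coe_coe, this]
    rfl
  let L : LinearMap.range ι →L[ℝ] ℝ := l'.mkContinuous C (by
    rintro ⟨_, v, rfl⟩
    rw [hl']
    exact h v)
  obtain ⟨T, hT, -⟩ := exists_extension_norm_eq _ L
  exact ⟨T, fun v => (hT ⟨ι v, LinearMap.mem_range_self ι v⟩).trans (hl' v)⟩

end Lift

/-! ### Fibre products of normed spaces -/

section Pullback

variable {E F H : Type*} [NormedAddCommGroup E] [NormedSpace ℂ E] [NormedAddCommGroup F]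
  [NormedSpace ℂ F] [NormedAddCommGroup H] [NormedSpace ℂ H]

/-- The fibre product of two normed spaces over a third one. -/
def Pullback (p : E →L[ℂ] H) (q : F →L[ℂ] H) : Type _ :=
  (p ∘L ContinuousLinearMap.fst ℂ E F - q ∘L ContinuousLinearMap.snd ℂ E F : E × F →L[ℂ] H).ker

namespace Pullback

variable (p : E →L[ℂ] H) (q : F →L[ℂ] H)

instance : NormedAddCommGroup (Pullback p q) := Submodule.normedAddCommGroup _

instance : NormedSpace ℂ (Pullback p q) := Submodule.normedSpace _

instance [CompleteSpace E] [CompleteSpace F] : CompleteSpace (Pullback p q) :=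
  (ContinuousLinearMap.isClosed_ker (p ∘L ContinuousLinearMap.fst ℂ E F
    - q ∘L ContinuousLinearMap.snd ℂ E F : E × F →L[ℂ] H)).completeSpace_coe

/-- The first projection of a fibre product. -/
def fst : Pullback p q →L[ℂ] E := ContinuousLinearMap.fst ℂ E F ∘L Submodule.subtypeL _

/-- The second projection of a fibre product. -/
def snd : Pullback p q →L[ℂ] F := ContinuousLinearMap.snd ℂ E F ∘L Submodule.subtypeL _

variable {p q}

theorem condition (u : Pullback p q) : p (fst p q u) = q (snd p q u) := by
  have := u.2
  rw [LinearMap.mem_ker] at this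
  exact sub_eq_zero.1 this

theorem ext {u v : Pullback p q} (h1 : fst p q u = fst p q v) (h2 : snd p q u = snd p q v) :
    u = v := Subtype.ext (Prod.ext h1 h2)

theorem exists_fst_eq {x : E} {y : F} (h : p x = q y) : ∃ u : Pullback p q, fst p q u = x :=
  ⟨⟨(x, y), by rw [LinearMap.mem_ker]; exact sub_eq_zero.2 h⟩, rfl⟩

end Pullback

end Pullback

/-! ### Calculus of test functions -/

section TestFunctions

variable {D : Set Space3}

theorem IsTestFun.add {ψ χ : Space3 → ℝ} (h : IsTestFun D ψ) (h' : IsTestFun D χ) :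
    IsTestFun D (ψ + χ) :=
  ⟨h.1.add h'.1, h.2.1.add h'.2.1,
    (tsupport_add ψ χ).trans (Set.union_subset h.2.2 h'.2.2)⟩

theorem IsTestFun.of_eq_mul {ψ : Space3 → ℝ} {g : Space3 → ℝ} (h : IsTestFun D ψ)
    (hg : ContDiff ℝ (⊤ : ℕ∞) g) : IsTestFun D (fun x => g x * ψ x) :=
  ⟨hg.mul h.1, h.2.1.mul_left, (tsupport_mul_subset_right).trans h.2.2⟩

theorem IsTestFun.zero : IsTestFun D (0 : Space3 → ℝ) :=
  ⟨contDiff_const, HasCompactSupport.zero, by simp [tsupport]⟩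

theorem IsTestFun.smul {ψ : Space3 → ℝ} (h : IsTestFun D ψ) (c : ℝ) : IsTestFun D (c • ψ) :=
  h.of_eq_mul contDiff_const

theorem IsTestFun.partialDeriv {ψ : Space3 → ℝ} (h : IsTestFun D ψ) (i : Fin 3) :
    IsTestFun D (partialDeriv i ψ) := by
  refine ⟨?_, h.2.1.fderiv_apply (𝕜 := ℝ) (EuclideanSpace.single i 1), ?_⟩
  · exact (h.1.fderiv_right (m := (⊤ : ℕ∞)) (by simp)).clm_apply contDiff_const
  · exact (tsupport_fderiv_apply_subset ℝ _).trans h.2.2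

theorem IsTestFun.differentiable {ψ : Space3 → ℝ} (h : IsTestFun D ψ) : Differentiable ℝ ψ :=
  h.1.differentiable (by simp)

theorem IsTestFun.eq_zero {ψ : Space3 → ℝ} (h : IsTestFun D ψ) {x : Space3} (hx : x ∉ D) :
    ψ x = 0 := image_eq_zero_of_notMem_tsupport fun h' => hx (h.2.2 h')

theorem partialDeriv_add {ψ χ : Space3 → ℝ} (h : Differentiable ℝ ψ) (h' : Differentiable ℝ χ)
    (i : Fin 3) : partialDeriv i (ψ + χ) = partialDeriv i ψ + partialDeriv i χ := by
  funext x
  simp [partialDeriv, fderiv_add (h x) (h' x)]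

theorem partialDeriv_smul {ψ : Space3 → ℝ} (h : Differentiable ℝ ψ) (c : ℝ)
    (i : Fin 3) : partialDeriv i (c • ψ) = c • partialDeriv i ψ := by
  funext x
  simp [partialDeriv, fderiv_const_smul (h x)]

theorem partialDeriv_coord_mul {ψ : Space3 → ℝ} (h : Differentiable ℝ ψ) (i j : Fin 3)
    (x : Space3) : partialDeriv j (fun x => x i * ψ x) x
      = x i * partialDeriv j ψ x + (if i = j then ψ x else 0) := by
  have h1 : HasFDerivAt (fun x : Space3 => x i) (EuclideanSpace.proj i : Space3 →L[ℝ] ℝ) x :=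
    (EuclideanSpace.proj i : Space3 →L[ℝ] ℝ).hasFDerivAt
  unfold partialDeriv
  rw [HasFDerivAt.fderiv (f := fun x : Space3 => x i * ψ x) (h1.mul (h x).hasFDerivAt)]
  by_cases hij : i = j <;> simp [hij]

/-- A function that is integrable on an open set and orthogonal to all test functions vanishes. -/
theorem ae_eq_zero_of_forall_isTestFun (hD : IsOpen D) {g : Space3 → ℂ} (hg : IntegrableOn g D)
    (h : ∀ ψ, IsTestFun D ψ → ∫ x in D, g x * (ψ x : ℂ) = 0) :
    ∀ᵐ x ∂(volume.restrict D), g x = 0 := by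
  rw [ae_restrict_iff' hD.measurableSet]
  refine hD.ae_eq_zero_of_integral_contDiff_smul_eq_zero hg.locallyIntegrableOn
    fun ψ h1 h2 h3 => ?_
  have hψ : IsTestFun D ψ := ⟨h1, h2, h3⟩
  rw [← h ψ hψ, ← setIntegral_eq_integral_of_forall_compl_eq_zero (s := D)]
  · simp [mul_comm]
  · intro x hx
    simp [hψ.eq_zero hx]

theorem integral_mul_eq_inner' {D : Set Space3} {k : Space3 → ℂ}
    (hk : MemLp k 2 (volume.restrict D)) (f : L2 D) :
    ∫ y in D, f y * k y = inner ℂ hk.star.toLp f := by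
  rw [← integral_mul_eq_inner hk f]
  simp only [mul_comm]

end TestFunctions

/-! ### Weak derivatives, completeness of H²(D), and regularity by duality -/

section WeakDerivative

variable {D : Set Space3}

theorem HasWeakPartial.eq_zero [IsFiniteMeasure (volume.restrict D)] (hD : IsOpen D) {i : Fin 3}
    {g : L2 D} (h : HasWeakPartial i 0 g) : g = 0 := by
  apply (Lp.eq_zero_iff_ae_eq_zero).2
  refine ae_eq_zero_of_forall_isTestFun hD ((Lp.memLp g).integrable (by norm_num)) fun ψ hψ => ?_
  have h1 := h ψ hψ
  have h0 : ∫ x in D, (0 : L2 D) x * (_root_.partialDeriv i ψ x : ℂ) = 0 := by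
    rw [integral_mul_eq_inner' (hψ.memLp_partialDeriv i), inner_zero_right]
  rw [h0] at h1
  simpa using h1.symm

/-- The jet components of a Sobolev function. -/
def H2.comp (k : Jet2Index) : H2 D →L[ℂ] L2 D :=
  (PiLp.proj 2 (fun _ : Jet2Index => L2 D) k : PiLp 2 (fun _ : Jet2Index => L2 D) →L[ℂ] L2 D) ∘L
    (H2 D).subtypeL

theorem H2.norm_comp_le (k : Jet2Index) (u : H2 D) : ‖H2.comp k u‖ ≤ ‖u‖ :=
  PiLp.norm_apply_le u.1 k

/-- Weak derivatives on an open set are unique, so a jet is determined by its function. Elements of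
H²(D) can therefore be compared in L²(D). -/
theorem toL2_injective [IsFiniteMeasure (volume.restrict D)] (hD : IsOpen D) :
    Function.Injective (H2.comp (D := D) (.inl ())) := by
  rw [injective_iff_map_eq_zero]
  rintro ⟨F, hF⟩ h0
  change F (.inl ()) = 0 at h0
  have h1 (i : Fin 3) : F (.inr (.inl i)) = 0 :=
    HasWeakPartial.eq_zero hD (i := i) (h0 ▸ hF.1 i)
  have h2 (i j : Fin 3) : F (.inr (.inr (i, j))) = 0 :=
    HasWeakPartial.eq_zero hD (i := j) (h1 i ▸ hF.2 i j)
  apply Subtype.ext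
  ext1 k
  rcases k with u | i | ⟨i, j⟩
  exacts [h0, h1 i, h2 i j]

theorem isClosed_hasWeakPartial (i : Fin 3) :
    IsClosed {p : L2 D × L2 D | HasWeakPartial i p.1 p.2} := by
  simp only [HasWeakPartial, Set.ofPred_forall]
  refine isClosed_iInter fun ψ => isClosed_iInter fun hψ => ?_
  simp_rw [integral_mul_eq_inner' (hψ.memLp_partialDeriv i), integral_mul_eq_inner' hψ.memLp]
  exact isClosed_eq (by fun_prop) (by fun_prop)

/-- Pairing with a fixed test function is L²-continuous, so being a weak derivative is a closed
relation and H²(D) is closed in the space of jets. -/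
instance : CompleteSpace (H2 D) := by
  have : IsClosed ((H2 D : Submodule ℂ _) : Set (PiLp 2 (fun _ : Jet2Index => L2 D))) := by
    have h (k : Jet2Index) : Continuous fun F : PiLp 2 (fun _ : Jet2Index => L2 D) => F k :=
      PiLp.continuous_apply 2 _ k
    change IsClosed {F : PiLp 2 (fun _ : Jet2Index => L2 D) | _ ∧ _}
    rw [Set.ofPred_and]
    simp only [Set.ofPred_forall]
    refine .inter (isClosed_iInter fun i => ?_)
      (isClosed_iInter fun i => isClosed_iInter fun j => ?_)
    · exact (isClosed_hasWeakPartial i).preimage ((h _).prodMk (h _))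
    · exact (isClosed_hasWeakPartial j).preimage ((h _).prodMk (h _))
  exact this.completeSpace_coe

variable (D) in
/-- The real vector space of test functions. -/
def testFunSubmodule : Submodule ℝ (Space3 → ℝ) where
  carrier := {ψ | IsTestFun D ψ}
  zero_mem' := IsTestFun.zero
  add_mem' := IsTestFun.add
  smul_mem' c _ h := h.smul c

/-- Riesz: a functional on test functions that is bounded in `L²(D)` is an integral. -/
theorem exists_integral_eq_of_bound (l : testFunSubmodule D →ₗ[ℝ] ℝ) (C : ℝ)
    (h : ∀ ψ : testFunSubmodule D,
      |l ψ| ≤ C * (eLpNorm (ψ : Space3 → ℝ) 2 (volume.restrict D)).toReal) :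
    ∃ g : Lp ℝ 2 (volume.restrict D), ∀ ψ : testFunSubmodule D,
      l ψ = ∫ x in D, g x * (ψ : Space3 → ℝ) x := by
  have hmem (ψ : testFunSubmodule D) : MemLp (ψ : Space3 → ℝ) 2 (volume.restrict D) :=
    ψ.2.1.continuous.memLp_of_hasCompactSupport ψ.2.2.1
  let ι : testFunSubmodule D →ₗ[ℝ] Lp ℝ 2 (volume.restrict D) :=
    { toFun := fun ψ => (hmem ψ).toLp
      map_add' := fun ψ χ => MemLp.toLp_add (hmem ψ) (hmem χ)
      map_smul' := fun c ψ => MemLp.toLp_const_smul c (hmem ψ) }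
  obtain ⟨T, hT⟩ := exists_extension_of_bound ι l C fun ψ => by
    refine (h ψ).trans_eq ?_
    change _ = C * ‖(hmem ψ).toLp‖
    rw [Lp.norm_toLp]
  refine ⟨(InnerProductSpace.toDual ℝ _).symm T, fun ψ => ?_⟩
  rw [← hT ψ, ← InnerProductSpace.toDual_symm_apply, L2.inner_def]
  refine integral_congr_ae ?_
  filter_upwards [(hmem ψ).coeFn_toLp] with x hx
  change inner ℝ _ ((hmem ψ).toLp _ x) = _
  rw [hx]
  simp [mul_comm]

/-- The real and imaginary parts of the distributional derivative are L²-bounded real functionals on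
test functions; Riesz represents each, and the two representatives are recombined. -/
theorem exists_hasWeakPartial_of_bound (i : Fin 3) (f : L2 D) (C : ℝ)
    (h : ∀ ψ, IsTestFun D ψ → ‖∫ x in D, f x * (partialDeriv i ψ x : ℂ)‖
      ≤ C * (eLpNorm ψ 2 (volume.restrict D)).toReal) : ∃ g : L2 D, HasWeakPartial i f g := by
  let l : testFunSubmodule D →ₗ[ℝ] ℂ :=
    { toFun := fun ψ => -∫ x in D, f x * (partialDeriv i ψ x : ℂ)
      map_add' := fun ψ χ => by
        have e : ∀ x, f x * (partialDeriv i ((ψ + χ : testFunSubmodule D) : Space3 → ℝ) x : ℂ)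
            = f x * (partialDeriv i ψ x : ℂ) + f x * (partialDeriv i χ x : ℂ) := fun x => by
          rw [Submodule.coe_add, partialDeriv_add ψ.2.differentiable χ.2.differentiable,
            Pi.add_apply, Complex.ofReal_add, mul_add]
        simp_rw [e]
        have h1 : Integrable (fun x => f x * (partialDeriv i ψ x : ℂ)) (volume.restrict D) :=
          (Lp.memLp f).integrable_mul (ψ.2.memLp_partialDeriv i)
        have h2 : Integrable (fun x => f x * (partialDeriv i χ x : ℂ)) (volume.restrict D) :=
          (Lp.memLp f).integrable_mul (χ.2.memLp_partialDeriv i)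
        rw [integral_add h1 h2, neg_add]
      map_smul' := fun c ψ => by
        have e : ∀ x, f x * (partialDeriv i ((c • ψ : testFunSubmodule D) : Space3 → ℝ) x : ℂ)
            = c * (f x * (partialDeriv i ψ x : ℂ)) := fun x => by
          rw [Submodule.coe_smul, partialDeriv_smul ψ.2.differentiable,
            Pi.smul_apply, smul_eq_mul, Complex.ofReal_mul, mul_left_comm]
        simp_rw [e]
        rw [integral_const_mul]
        simp }
  have hl (ψ : testFunSubmodule D) :
      ‖l ψ‖ ≤ C * (eLpNorm (ψ : Space3 → ℝ) 2 (volume.restrict D)).toReal := by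
    have := h ψ ψ.2
    rwa [← norm_neg] at this
  obtain ⟨g₁, h₁⟩ := exists_integral_eq_of_bound (Complex.reLm ∘ₗ l) C fun ψ =>
    (Complex.abs_re_le_norm _).trans (hl ψ)
  obtain ⟨g₂, h₂⟩ := exists_integral_eq_of_bound (Complex.imLm ∘ₗ l) C fun ψ =>
    (Complex.abs_im_le_norm _).trans (hl ψ)
  have m₁ : MemLp (fun x => (g₁ x : ℂ)) 2 (volume.restrict D) := (Lp.memLp g₁).ofReal
  have m₂ : MemLp (fun x => (g₂ x : ℂ)) 2 (volume.restrict D) := (Lp.memLp g₂).ofReal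
  refine ⟨m₁.toLp _ + Complex.I • m₂.toLp _, fun ψ hψ => ?_⟩
  have e₁ : ∫ x in D, m₁.toLp _ x * (ψ x : ℂ) = ((l ⟨ψ, hψ⟩).re : ℂ) := by
    rw [show (l ⟨ψ, hψ⟩).re = _ from h₁ ⟨ψ, hψ⟩, ← integral_complex_ofReal]
    refine integral_congr_ae ?_
    filter_upwards [m₁.coeFn_toLp] with x hx
    rw [hx, Complex.ofReal_mul]
  have e₂ : ∫ x in D, m₂.toLp _ x * (ψ x : ℂ) = ((l ⟨ψ, hψ⟩).im : ℂ) := by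
    rw [show (l ⟨ψ, hψ⟩).im = _ from h₂ ⟨ψ, hψ⟩, ← integral_complex_ofReal]
    refine integral_congr_ae ?_
    filter_upwards [m₂.coeFn_toLp] with x hx
    rw [hx, Complex.ofReal_mul]
  rw [setIntegral_L2_add_mul _ _ hψ.memLp, setIntegral_L2_smul_mul, e₁, e₂, mul_comm Complex.I,
    Complex.re_add_im]
  simp [l]

/-- Weak regularity: if the distributional first and second derivatives of `f` are bounded in
`L²(D)`, then `f ∈ H²(D)`. -/
theorem exists_toL2_eq_of_bound (f : L2 D) (C : ℝ)
    (h1 : ∀ i, ∀ ψ, IsTestFun D ψ → ‖∫ x in D, f x * (partialDeriv i ψ x : ℂ)‖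
      ≤ C * (eLpNorm ψ 2 (volume.restrict D)).toReal)
    (h2 : ∀ i j, ∀ ψ, IsTestFun D ψ →
      ‖∫ x in D, f x * (partialDeriv i (partialDeriv j ψ) x : ℂ)‖
        ≤ C * (eLpNorm ψ 2 (volume.restrict D)).toReal) :
    ∃ F : H2 D, H2.comp (.inl ()) F = f := by
  choose g hg using fun i => exists_hasWeakPartial_of_bound i f C (h1 i)
  have h3 (i j : Fin 3) : ∃ q : L2 D, HasWeakPartial j (g i) q := by
    refine exists_hasWeakPartial_of_bound j (g i) C fun ψ hψ => ?_
    rw [← norm_neg, ← hg i _ (hψ.partialDeriv j)]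
    exact h2 i j ψ hψ
  choose q hq using h3
  let F : PiLp 2 (fun _ : Jet2Index => L2 D) := WithLp.toLp 2 fun k => match k with
    | .inl _ => f
    | .inr (.inl i) => g i
    | .inr (.inr (i, j)) => q i j
  exact ⟨⟨F, fun i => hg i, fun i j => hq i j⟩, rfl⟩

end WeakDerivative

/-! ### The space H²(D) ∩ L^∞(D) -/

section RegularSpace

variable {D : Set Space3}

/-- The Banach space `L^∞(D)`. -/
abbrev LInf (D : Set Space3) : Type := Lp ℂ ⊤ (volume.restrict D)

/-- Multiplication of a square integrable function by a bounded one. -/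
def mulL2 : LInf D →L[ℂ] L2 D →L[ℂ] L2 D :=
  (ContinuousLinearMap.mul ℂ ℂ).holderL (volume.restrict D) ⊤ 2 2

/-- Multiplication of bounded functions. -/
def mulLInf : LInf D →L[ℂ] LInf D →L[ℂ] LInf D :=
  (ContinuousLinearMap.mul ℂ ℂ).holderL (volume.restrict D) ⊤ ⊤ ⊤

theorem coeFn_mulL2 (f : LInf D) (g : L2 D) :
    mulL2 f g =ᵐ[volume.restrict D] fun x => f x * g x :=
  ContinuousLinearMap.coeFn_holder (r := 2) (ContinuousLinearMap.mul ℂ ℂ) f g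

theorem coeFn_mulLInf (f g : LInf D) :
    mulLInf f g =ᵐ[volume.restrict D] fun x => f x * g x :=
  ContinuousLinearMap.coeFn_holder (r := ⊤) (ContinuousLinearMap.mul ℂ ℂ) f g

variable [IsFiniteMeasure (volume.restrict D)]

variable (D) in
/-- The inclusion `L^∞(D) ⊆ L²(D)`. -/
def lInfToL2 : LInf D →L[ℂ] L2 D :=
  mulL2.flip ((memLp_const (1 : ℂ)).toLp : L2 D)

theorem coeFn_lInfToL2 (f : LInf D) : lInfToL2 D f =ᵐ[volume.restrict D] f := by
  filter_upwards [coeFn_mulL2 f ((memLp_const (1 : ℂ)).toLp : L2 D),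
    (memLp_const (μ := volume.restrict D) (p := 2) (1 : ℂ)).coeFn_toLp] with x h1 h2
  change mulL2 f ((memLp_const (1 : ℂ)).toLp : L2 D) x = _
  rw [h1, h2, mul_one]

theorem lInfToL2_injective : Function.Injective (lInfToL2 D) := by
  intro f g h
  apply Lp.ext
  filter_upwards [coeFn_lInfToL2 f, coeFn_lInfToL2 g] with x h1 h2
  rw [← h1, ← h2, h]

variable (D) in
/-- The Banach space `H²(D) ∩ L^∞(D)`. -/
abbrev H2Inf : Type := Pullback (H2.comp (D := D) (.inl ())) (lInfToL2 D)

variable (D) in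
/-- The projection `H²(D) ∩ L^∞(D) → H²(D)`. -/
def H2Inf.toH2 : H2Inf D →L[ℂ] H2 D := Pullback.fst _ _

variable (D) in
/-- The projection `H²(D) ∩ L^∞(D) → L^∞(D)`. -/
def H2Inf.toLInf : H2Inf D →L[ℂ] LInf D := Pullback.snd _ _

variable (D) in
/-- The inclusion `H²(D) ∩ L^∞(D) ⊆ L²(D)`. -/
def H2Inf.incl : H2Inf D →L[ℂ] L2 D := H2.comp (.inl ()) ∘L H2Inf.toH2 D

theorem H2Inf.toL2_toH2 (u : H2Inf D) : toL2 (H2Inf.toH2 D u) = H2Inf.incl D u := rfl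

theorem H2Inf.lInfToL2_toLInf (u : H2Inf D) : lInfToL2 D (H2Inf.toLInf D u) = H2Inf.incl D u :=
  (Pullback.condition u).symm

theorem H2Inf.incl_injective (hD : IsOpen D) : Function.Injective (H2Inf.incl D) := by
  intro u v h
  refine Pullback.ext (toL2_injective hD h) (lInfToL2_injective ?_)
  change lInfToL2 D (H2Inf.toLInf D u) = lInfToL2 D (H2Inf.toLInf D v)
  rw [H2Inf.lInfToL2_toLInf, H2Inf.lInfToL2_toLInf, h]

theorem H2Inf.exists_incl_eq {f : L2 D} {g : LInf D} (h : (f : Space3 → ℂ) =ᵐ[volume.restrict D] g)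
    (hf : ∃ F : H2 D, H2.comp (.inl ()) F = f) : ∃ u, H2Inf.incl D u = f := by
  obtain ⟨F, hF⟩ := hf
  have h' : H2.comp (.inl ()) F = lInfToL2 D g := by
    rw [hF]
    apply Lp.ext
    filter_upwards [h, coeFn_lInfToL2 g] with x h1 h2
    rw [h1, h2]
  obtain ⟨u, hu⟩ := Pullback.exists_fst_eq h'
  exact ⟨u, (congrArg _ hu).trans hF⟩

end RegularSpace

/-! ### Coordinate functions as multipliers -/

section Coordinates

variable {D : Set Space3}

theorem memLp_coord (hD : Bornology.IsBounded D) (hDo : IsOpen D) (i : Fin 3) :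
    MemLp (fun x : Space3 => ((x i : ℝ) : ℂ)) ⊤ (volume.restrict D) := by
  obtain ⟨R, hR⟩ := hD.exists_norm_le
  refine memLp_top_of_bound (by fun_prop) R ?_
  filter_upwards [ae_restrict_mem hDo.measurableSet] with x hx
  rw [Complex.norm_real]
  exact (PiLp.norm_apply_le x i).trans (hR x hx)

/-- The coordinate function `xᵢ` in `L^∞(D)`. -/
def coordLInf (hD : Bornology.IsBounded D) (hDo : IsOpen D) (i : Fin 3) : LInf D :=
  (memLp_coord hD hDo i).toLp

theorem coeFn_coordLInf (hD : Bornology.IsBounded D) (hDo : IsOpen D) (i : Fin 3) :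
    coordLInf hD hDo i =ᵐ[volume.restrict D] fun x => ((x i : ℝ) : ℂ) :=
  (memLp_coord hD hDo i).coeFn_toLp

theorem coeFn_mulL2_coord (hD : Bornology.IsBounded D) (hDo : IsOpen D) (i : Fin 3) (f : L2 D) :
    mulL2 (coordLInf hD hDo i) f =ᵐ[volume.restrict D] fun x => ((x i : ℝ) : ℂ) * f x := by
  filter_upwards [coeFn_mulL2 (coordLInf hD hDo i) f, coeFn_coordLInf hD hDo i] with x h1 h2
  rw [h1, h2]

/-- The Leibniz rule, obtained by using the weak derivative of f on the test function xᵢψ. -/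
theorem HasWeakPartial.mul_coord (hD : Bornology.IsBounded D) (hDo : IsOpen D) {i j : Fin 3}
    {f g : L2 D} (h : HasWeakPartial j f g) :
    HasWeakPartial j (mulL2 (coordLInf hD hDo i) f)
      (mulL2 (coordLInf hD hDo i) g + (if i = j then (1 : ℂ) else 0) • f) := by
  intro ψ hψ
  have hx : IsTestFun D (fun x => x i * ψ x) := hψ.of_eq_mul (by fun_prop)
  have h1 := h _ hx
  have e (q : L2 D) (m : Space3 → ℂ) : ∫ x in D, mulL2 (coordLInf hD hDo i) q x * m x
      = ∫ x in D, q x * (((x i : ℝ) : ℂ) * m x) := by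
    refine integral_congr_ae ?_
    filter_upwards [coeFn_mulL2_coord hD hDo i q] with x hx
    rw [hx]; ring
  rw [setIntegral_L2_add_mul _ _ hψ.memLp, setIntegral_L2_smul_mul, e, e]
  simp_rw [partialDeriv_coord_mul hψ.differentiable] at h1
  have i1 : Integrable (fun x => f x * (((x i : ℝ) : ℂ) * (partialDeriv j ψ x : ℂ)))
      (volume.restrict D) := by
    have := (Lp.memLp f).integrable_mul
      (((hψ.partialDeriv j).of_eq_mul (g := fun x => x i) (by fun_prop)).memLp)
    refine this.congr (ae_of_all _ fun x => ?_)
    simp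
  have i2 : Integrable (fun x => f x * (ψ x : ℂ)) (volume.restrict D) :=
    (Lp.memLp f).integrable_mul hψ.memLp
  have e2 : ∫ x in D, f x * ((x i * partialDeriv j ψ x + (if i = j then ψ x else 0) : ℝ) : ℂ)
      = (∫ x in D, f x * (((x i : ℝ) : ℂ) * (partialDeriv j ψ x : ℂ)))
        + (if i = j then (1 : ℂ) else 0) * ∫ x in D, f x * (ψ x : ℂ) := by
    rw [← integral_const_mul, ← integral_add i1 (i2.const_mul _)]
    refine integral_congr_ae (ae_of_all _ fun x => ?_)
    split_ifs <;> simp [mul_add]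
  rw [e2] at h1
  rw [eq_sub_of_add_eq h1]
  push_cast
  ring

/-- `H²(D)` is stable under multiplication by coordinate functions. -/
theorem exists_toL2_eq_mul_coord (hD : Bornology.IsBounded D) (hDo : IsOpen D) (i : Fin 3)
    (F : H2 D) : ∃ F' : H2 D, H2.comp (.inl ()) F' = mulL2 (coordLInf hD hDo i) (toL2 F) := by
  let δ (j : Fin 3) : ℂ := if i = j then 1 else 0
  let m := mulL2 (coordLInf hD hDo i)
  let G : PiLp 2 (fun _ : Jet2Index => L2 D) := WithLp.toLp 2 fun k => match k with
    | .inl _ => m (F.1 (.inl ()))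
    | .inr (.inl j) => m (F.1 (.inr (.inl j))) + δ j • F.1 (.inl ())
    | .inr (.inr (j, k)) =>
      (m (F.1 (.inr (.inr (j, k)))) + δ k • F.1 (.inr (.inl j))) + δ j • F.1 (.inr (.inl k))
  refine ⟨⟨G, fun j => ?_, fun j k => ?_⟩, rfl⟩
  · exact (F.2.1 j).mul_coord hD hDo
  · exact ((F.2.2 j k).mul_coord hD hDo).add ((F.2.1 k).smul (δ j))

/-- Boundedness comes from the closed graph theorem through `exists_clm_lift`. These multipliers
enter the commutators that generate the kernels |z|ⁿ/(4π|z|). -/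
theorem exists_mulCoord [IsFiniteMeasure (volume.restrict D)] (hD : Bornology.IsBounded D)
    (hDo : IsOpen D) (i : Fin 3) : ∃ M : H2Inf D →L[ℂ] H2Inf D,
      H2Inf.incl D ∘L M = mulL2 (coordLInf hD hDo i) ∘L H2Inf.incl D := by
  refine exists_clm_lift _ (H2Inf.incl_injective hDo) _ fun u => ?_
  refine H2Inf.exists_incl_eq (g := mulLInf (coordLInf hD hDo i) (H2Inf.toLInf D u)) ?_
    (exists_toL2_eq_mul_coord hD hDo i (H2Inf.toH2 D u))
  filter_upwards [coeFn_mulL2 (coordLInf hD hDo i) (H2Inf.incl D u),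
    coeFn_mulLInf (coordLInf hD hDo i) (H2Inf.toLInf D u), coeFn_lInfToL2 (H2Inf.toLInf D u)]
    with x h1 h2 h3
  rw [ContinuousLinearMap.comp_apply, h1, h2, ← h3, H2Inf.lInfToL2_toLInf]

variable (D) in
/-- The constant function one in `L²(D)`. -/
def oneL2 [IsFiniteMeasure (volume.restrict D)] : L2 D := (memLp_const (1 : ℂ)).toLp

theorem coeFn_oneL2 [IsFiniteMeasure (volume.restrict D)] :
    oneL2 D =ᵐ[volume.restrict D] fun _ => 1 :=
  (memLp_const (μ := volume.restrict D) (p := 2) (1 : ℂ)).coeFn_toLp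

theorem IsTestFun.integral_partialDeriv {ψ : Space3 → ℝ} (hψ : IsTestFun D ψ) (i : Fin 3) :
    ∫ x in D, _root_.partialDeriv i ψ x = 0 := by
  rw [setIntegral_eq_integral_of_forall_compl_eq_zero
    fun x hx => (hψ.partialDeriv i).eq_zero hx]
  have h1 : Integrable (_root_.partialDeriv i ψ) :=
    (hψ.partialDeriv i).1.continuous.integrable_of_hasCompactSupport (hψ.partialDeriv i).2.1
  have h2 : Integrable ψ := hψ.1.continuous.integrable_of_hasCompactSupport hψ.2.1
  have := integral_mul_fderiv_eq_neg_fderiv_mul_of_integrable (μ := volume) (𝕜 := ℝ)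
    (f := fun _ : Space3 => (1 : ℝ)) (g := ψ) (v := EuclideanSpace.single i 1) (by simp)
    (by simp only [one_mul]; exact h1) (by simpa using h2) (fun x _ => by fun_prop)
    (fun x _ => hψ.differentiable x)
  simpa [_root_.partialDeriv] using this

theorem hasWeakPartial_oneL2 [IsFiniteMeasure (volume.restrict D)] (i : Fin 3) :
    HasWeakPartial i (oneL2 D) 0 := by
  intro ψ hψ
  rw [integral_mul_eq_inner' hψ.memLp, inner_zero_right, neg_zero]
  calc _ = ∫ x in D, (partialDeriv i ψ x : ℂ) := by
        refine integral_congr_ae ?_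
        filter_upwards [coeFn_oneL2 (D := D)] with x hx
        rw [hx, one_mul]
    _ = 0 := by rw [integral_complex_ofReal, hψ.integral_partialDeriv]; simp

theorem exists_incl_eq_one [IsFiniteMeasure (volume.restrict D)] :
    ∃ u, H2Inf.incl D u = oneL2 D := by
  have m : MemLp (fun _ : Space3 => (1 : ℂ)) ⊤ (volume.restrict D) := memLp_const _
  refine H2Inf.exists_incl_eq (g := m.toLp) ?_ ?_
  · filter_upwards [coeFn_oneL2 (D := D), m.coeFn_toLp] with x h1 h2
    rw [h1, h2]
  · let F : PiLp 2 (fun _ : Jet2Index => L2 D) := WithLp.toLp 2 fun k => match k with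
      | .inl _ => oneL2 D
      | .inr _ => 0
    exact ⟨⟨F, fun i => hasWeakPartial_oneL2 i, fun i j => HasWeakPartial.zero j⟩, rfl⟩

end Coordinates

/-! ### The Newtonian energy in frequency space, through the heat kernel -/

section Heat

open Real FourierTransform

/-- The heat kernel of `ℝ³`. -/
def heatKernel (τ : ℝ) (z : Space3) : ℝ :=
  (4 * π * τ) ^ (-(3 / 2) : ℝ) * Real.exp (-‖z‖ ^ 2 / (4 * τ))

theorem heatKernel_nonneg {τ : ℝ} (hτ : 0 < τ) (z : Space3) : 0 ≤ heatKernel τ z := by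
  unfold heatKernel; positivity

theorem measurable_heatKernel : Measurable fun p : ℝ × Space3 => heatKernel p.1 p.2 := by
  unfold heatKernel; fun_prop

theorem integral_heatKernel_time {z : Space3} (hz : z ≠ 0) :
    ∫ τ in Set.Ioi (0 : ℝ), heatKernel τ z = (4 * π * ‖z‖)⁻¹ := by
  have hr : 0 < ‖z‖ := norm_pos_iff.2 hz
  -- The substitution τ = u⁻² absorbs the factor τ^(-3/2) into the Jacobian and leaves a half-line
  -- Gaussian integral.
  rw [← integral_comp_rpow_Ioi (fun τ => heatKernel τ z) (p := -2) (by norm_num)]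
  have h1 : ∀ u ∈ Set.Ioi (0 : ℝ), (|(-2 : ℝ)| * u ^ ((-2 : ℝ) - 1)) • heatKernel (u ^ (-2 : ℝ)) z
      = 2 * (4 * π) ^ (-(3 / 2) : ℝ) * Real.exp (-(‖z‖ ^ 2 / 4) * u ^ 2) := by
    intro u hu
    have hu' : (0 : ℝ) < u := hu
    unfold heatKernel
    rw [Real.mul_rpow (by positivity) (by positivity), ← Real.rpow_mul hu'.le, smul_eq_mul]
    have e1 : u ^ ((-2 : ℝ) - 1) * u ^ ((-2 : ℝ) * -(3 / 2)) = 1 := by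
      rw [← Real.rpow_add hu']; norm_num
    have e2 : -‖z‖ ^ 2 / (4 * u ^ (-2 : ℝ)) = -(‖z‖ ^ 2 / 4) * u ^ 2 := by
      rw [Real.rpow_neg hu'.le, Real.rpow_two]; field_simp
    rw [e2, abs_neg, abs_two]
    linear_combination (2 * (4 * π) ^ (-(3 / 2) : ℝ) * Real.exp (-(‖z‖ ^ 2 / 4) * u ^ 2)) * e1
  rw [setIntegral_congr_fun measurableSet_Ioi h1, integral_const_mul, integral_gaussian_Ioi]
  have e3 : √(π / (‖z‖ ^ 2 / 4)) = (4 * π) ^ (1 / 2 : ℝ) / ‖z‖ := by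
    rw [← Real.sqrt_eq_rpow, show π / (‖z‖ ^ 2 / 4) = (4 * π) / ‖z‖ ^ 2 by field_simp,
      Real.sqrt_div (by positivity), Real.sqrt_sq hr.le]
  have e4 : (4 * π) ^ (-(3 / 2) : ℝ) * (4 * π) ^ (1 / 2 : ℝ) = (4 * π)⁻¹ := by
    rw [← Real.rpow_add (by positivity), ← Real.rpow_neg_one]; norm_num
  rw [e3, mul_inv, ← e4]
  ring

theorem integrableOn_heatKernel_time {z : Space3} (hz : z ≠ 0) :
    IntegrableOn (fun τ => heatKernel τ z) (Set.Ioi 0) := by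
  -- A divergent integral has value zero by convention, so the nonzero value already computed
  -- certifies integrability.
  refine Integrable.of_integral_ne_zero ?_
  rw [integral_heatKernel_time hz]
  have : 0 < ‖z‖ := norm_pos_iff.2 hz
  positivity

theorem fourier_gaussian_modulated {τ : ℝ} (hτ : 0 < τ) (x y : Space3) :
    𝓕 (fun ξ : Space3 => Complex.exp (-((4 * π ^ 2 * τ : ℝ) : ℂ) * (‖ξ‖ : ℂ) ^ 2
      + 2 * π * Complex.I * (inner ℝ x ξ : ℝ))) y = heatKernel τ (x - y) := by
  rw [fourier_gaussian_innerProductSpace' (by rw [Complex.ofReal_re]; positivity)]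
  have h1 : (π : ℂ) / ((4 * π ^ 2 * τ : ℝ) : ℂ) = (((4 * π * τ)⁻¹ : ℝ) : ℂ) := by
    push_cast
    have : (π : ℂ) ≠ 0 := by exact_mod_cast pi_ne_zero
    field_simp
  have h2 : ((Module.finrank ℝ Space3 : ℂ) / 2) = ((3 / 2 : ℝ) : ℂ) := by simp
  have h3 : -(π : ℂ) ^ 2 * (‖x - y‖ : ℂ) ^ 2 / ((4 * π ^ 2 * τ : ℝ) : ℂ)
      = ((-‖x - y‖ ^ 2 / (4 * τ) : ℝ) : ℂ) := by
    push_cast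
    have : (π : ℂ) ≠ 0 := by exact_mod_cast pi_ne_zero
    have : (τ : ℂ) ≠ 0 := by exact_mod_cast hτ.ne'
    field_simp
  rw [h1, h2, h3, ← Complex.ofReal_cpow (by positivity), ← Complex.ofReal_exp,
    ← Complex.ofReal_mul, heatKernel, Real.rpow_neg (by positivity), Real.inv_rpow (by positivity)]

theorem integral_heatKernel {τ : ℝ} (hτ : 0 < τ) : ∫ z, heatKernel τ z = 1 := by
  have h1 (z : Space3) : heatKernel τ z
      = (4 * π * τ) ^ (-(3 / 2) : ℝ) * Real.exp (-(4 * τ)⁻¹ * ‖z‖ ^ 2) := by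
    unfold heatKernel; congr 2; field_simp
  simp_rw [h1]
  rw [integral_const_mul, GaussianFourier.integral_rexp_neg_mul_sq_norm (by positivity)]
  have : (Module.finrank ℝ Space3 / 2 : ℝ) = 3 / 2 := by simp
  rw [this, show π / (4 * τ)⁻¹ = 4 * π * τ by field_simp, ← Real.rpow_add (by positivity)]
  norm_num

theorem integrable_heatKernel {τ : ℝ} (hτ : 0 < τ) : Integrable (heatKernel τ) := by
  refine Integrable.of_integral_ne_zero ?_
  rw [integral_heatKernel hτ]
  norm_num

/-- The Gaussian cutoff in frequency space. -/
def gaussCut (τ : ℝ) (ξ : Space3) : ℝ := Real.exp (-(4 * π ^ 2 * τ) * ‖ξ‖ ^ 2)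

theorem measurable_gaussCut : Measurable fun p : ℝ × Space3 => gaussCut p.1 p.2 := by
  unfold gaussCut; fun_prop

theorem integrable_gaussCut {τ : ℝ} (hτ : 0 < τ) : Integrable (gaussCut τ) := by
  refine Integrable.of_integral_ne_zero ?_
  unfold gaussCut
  rw [GaussianFourier.integral_rexp_neg_mul_sq_norm (by positivity)]
  positivity

theorem continuous_fourier {f : Space3 → ℂ} (hf : Integrable f) : Continuous (𝓕 f) :=
  VectorFourier.fourierIntegral_continuous Real.continuous_fourierChar continuous_inner hf

theorem norm_fourier_le (f : Space3 → ℂ) (ξ : Space3) : ‖𝓕 f ξ‖ ≤ ∫ x, ‖f x‖ :=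
  VectorFourier.norm_fourierIntegral_le_integral_norm _ _ _ f ξ

theorem integral_fourier_mul {f g : Space3 → ℂ} (hf : Integrable f) (hg : Integrable g) :
    ∫ ξ, 𝓕 f ξ * g ξ = ∫ x, f x * 𝓕 g x := by
  simpa using! (VectorFourier.integral_fourierIntegral_smul_eq_flip (L := innerₗ Space3)
      Real.continuous_fourierChar continuous_inner hf hg)

/-- The quadratic form of the heat semigroup in frequency space. -/
theorem integral_mul_heatKernel {a b : Space3 → ℂ} (ha : Integrable a) (hb : Integrable b)
    {τ : ℝ} (hτ : 0 < τ) :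
    ∫ x, a x * ∫ y, (heatKernel τ (x - y) : ℂ) * star (b y)
      = ∫ ξ, (gaussCut τ ξ : ℂ) * (𝓕 a ξ * star (𝓕 b ξ)) := by
  set H : Space3 → ℂ := fun ξ => (gaussCut τ ξ : ℂ) * star (𝓕 b ξ)
  have hH : Integrable H := by
    refine (integrable_gaussCut hτ).ofReal.mul_bdd (c := ∫ x, ‖b x‖)
      (continuous_fourier hb).star.aestronglyMeasurable (ae_of_all _ fun ξ => ?_)
    rw [norm_star]
    exact norm_fourier_le b ξ
  have h1 : ∫ ξ, (gaussCut τ ξ : ℂ) * (𝓕 a ξ * star (𝓕 b ξ)) = ∫ ξ, 𝓕 a ξ * H ξ :=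
    integral_congr_ae (ae_of_all _ fun ξ => by simp only [H]; ring)
  rw [h1, integral_fourier_mul ha hH]
  refine integral_congr_ae (ae_of_all _ fun x => ?_)
  simp only
  congr 1
  let M : Space3 → ℂ := fun ξ => Complex.exp (-((4 * π ^ 2 * τ : ℝ) : ℂ) * (‖ξ‖ : ℂ) ^ 2
      + 2 * π * Complex.I * (inner ℝ x ξ : ℝ))
  have hM : Integrable M := GaussianFourier.integrable_cexp_neg_mul_sq_norm_add
    (by rw [Complex.ofReal_re]; positivity) _ _
  -- The multiplication formula for b and a modulated Gaussian, whose transform is the heat kernel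
  -- centred at x; its conjugate gives 𝓕 H at x.
  have h2 := integral_fourier_mul hb hM
  have h3 := congrArg (starRingEnd ℂ) h2
  rw [← integral_conj, ← integral_conj] at h3
  have h4 : 𝓕 H x = ∫ ξ, starRingEnd ℂ (𝓕 b ξ * M ξ) := by
    rw [Real.fourier_eq']
    refine integral_congr_ae (ae_of_all _ fun ξ => ?_)
    simp only [H, M, gaussCut, map_mul, smul_eq_mul, ← Complex.exp_conj, Complex.star_def,
      Complex.ofReal_exp]
    rw [mul_left_comm, mul_comm (starRingEnd ℂ _), ← mul_assoc, ← Complex.exp_add,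
      mul_comm (Complex.exp _), mul_comm (Complex.exp _)]
    congr 2
    simp [real_inner_comm, map_ofNat]
    ring
  rw [h4, h3]
  refine integral_congr_ae (ae_of_all _ fun y => ?_)
  simp only [M, map_mul, fourier_gaussian_modulated hτ, Complex.conj_ofReal, Complex.star_def]
  ring

/-- Schur's test: st ≤ s²/2 + t²/2 splits the form into two halves, and the heat kernel has unit
mass in each variable. -/
theorem enorm_integral_mul_heatKernel_le {a : Space3 → ℂ} (ha : Integrable a) {τ : ℝ}
    (hτ : 0 < τ) : ‖∫ x, a x * ∫ y, (heatKernel τ (x - y) : ℂ) * star (a y)‖ₑ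
      ≤ ∫⁻ x, ‖a x‖ₑ ^ 2 := by
  have hm : Measurable (heatKernel τ) := measurable_heatKernel.comp measurable_prodMk_left
  have hone : ∫⁻ z, ENNReal.ofReal (heatKernel τ z) = 1 := by
    rw [← ofReal_integral_eq_lintegral_ofReal (integrable_heatKernel hτ)
      (ae_of_all _ fun z => heatKernel_nonneg hτ z), integral_heatKernel hτ, ENNReal.ofReal_one]
  have hyoung (s t : ENNReal) : s * t ≤ s ^ 2 / 2 + t ^ 2 / 2 := by
    simpa using ENNReal.young_inequality s t Real.HolderConjugate.two_two
  have hae : AEMeasurable (fun x => ‖a x‖ₑ) := ha.1.enorm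
  have hk1 : AEMeasurable (fun p : Space3 × Space3 => ENNReal.ofReal (heatKernel τ (p.1 - p.2)))
      (volume.prod volume) := by
    exact (ENNReal.measurable_ofReal.comp (hm.comp (by fun_prop))).aemeasurable
  calc ‖∫ x, a x * ∫ y, (heatKernel τ (x - y) : ℂ) * star (a y)‖ₑ
      ≤ ∫⁻ x, ‖a x * ∫ y, (heatKernel τ (x - y) : ℂ) * star (a y)‖ₑ :=
        enorm_integral_le_lintegral_enorm _
    _ ≤ ∫⁻ x, ∫⁻ y, ‖a x‖ₑ * (ENNReal.ofReal (heatKernel τ (x - y)) * ‖a y‖ₑ) := by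
        refine lintegral_mono fun x => ?_
        rw [enorm_mul, lintegral_const_mul' _ _ enorm_ne_top]
        gcongr
        refine (enorm_integral_le_lintegral_enorm _).trans (lintegral_mono fun y => ?_)
        rw [enorm_mul, ← ofReal_norm, Complex.norm_real,
          Real.norm_of_nonneg (heatKernel_nonneg hτ _)]
        gcongr
        rw [← ofReal_norm, ← ofReal_norm, norm_star]
    _ ≤ ∫⁻ x, ∫⁻ y, (ENNReal.ofReal (heatKernel τ (x - y)) * (‖a x‖ₑ ^ 2 / 2)
          + ENNReal.ofReal (heatKernel τ (x - y)) * (‖a y‖ₑ ^ 2 / 2)) := by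
        refine lintegral_mono fun x => lintegral_mono fun y => ?_
        rw [← mul_add, mul_left_comm]
        gcongr
        exact hyoung _ _
    _ = (∫⁻ x, ∫⁻ y, ENNReal.ofReal (heatKernel τ (x - y)) * (‖a x‖ₑ ^ 2 / 2))
          + ∫⁻ x, ∫⁻ y, ENNReal.ofReal (heatKernel τ (x - y)) * (‖a y‖ₑ ^ 2 / 2) := by
        have hl (x : Space3) : Measurable fun y => ENNReal.ofReal (heatKernel τ (x - y)) :=
          ENNReal.measurable_ofReal.comp (hm.comp (by fun_prop))
        rw [lintegral_congr fun x => lintegral_add_left ((hl x).mul_const (‖a x‖ₑ ^ 2 / 2))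
          (fun y => ENNReal.ofReal (heatKernel τ (x - y)) * (‖a y‖ₑ ^ 2 / 2))]
        refine lintegral_add_right' _ ?_
        exact (hk1.mul ((hae.pow_const 2).div_const 2).comp_snd).lintegral_prod_right'
    _ = (∫⁻ x, ‖a x‖ₑ ^ 2 / 2) + ∫⁻ y, ‖a y‖ₑ ^ 2 / 2 := by
        congr 1
        · refine lintegral_congr fun x => ?_
          have hc : Measurable fun y => ENNReal.ofReal (heatKernel τ (x - y)) :=
            ENNReal.measurable_ofReal.comp (hm.comp (by fun_prop))
          rw [lintegral_mul_const _ hc,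
            lintegral_sub_left_eq_self (f := fun z => ENNReal.ofReal (heatKernel τ z)), hone,
            one_mul]
        · rw [lintegral_lintegral_swap (hk1.mul ((hae.pow_const 2).div_const 2).comp_snd)]
          refine lintegral_congr fun y => ?_
          have hc : Measurable fun x => ENNReal.ofReal (heatKernel τ (x - y)) :=
            ENNReal.measurable_ofReal.comp (hm.comp (by fun_prop))
          rw [lintegral_mul_const _ hc,
            lintegral_sub_right_eq_self (fun z => ENNReal.ofReal (heatKernel τ z)), hone,
            one_mul]
    _ = ∫⁻ x, ‖a x‖ₑ ^ 2 := by
        rw [← lintegral_add_left' ((hae.pow_const 2).div_const 2)]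
        simp

/-- Bessel's inequality for the Fourier transform. -/
theorem lintegral_enorm_fourier_sq_le {a : Space3 → ℂ} (ha : Integrable a) :
    ∫⁻ ξ, ‖𝓕 a ξ‖ₑ ^ 2 ≤ ∫⁻ x, ‖a x‖ₑ ^ 2 := by
  have hτ (n : ℕ) : (0 : ℝ) < 1 / ((n : ℝ) + 1) := by positivity
  have h1 (n : ℕ) : ∫⁻ ξ, ENNReal.ofReal (gaussCut (1 / ((n : ℝ) + 1)) ξ) * ‖𝓕 a ξ‖ₑ ^ 2
      ≤ ∫⁻ x, ‖a x‖ₑ ^ 2 := by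
    have h := enorm_integral_mul_heatKernel_le ha (hτ n)
    rw [integral_mul_heatKernel ha ha (hτ n)] at h
    have hi : Integrable fun ξ => gaussCut (1 / ((n : ℝ) + 1)) ξ * ‖𝓕 a ξ‖ ^ 2 := by
      refine (integrable_gaussCut (hτ n)).mul_bdd (c := (∫ x, ‖a x‖) ^ 2)
        ((continuous_fourier ha).norm.pow 2).aestronglyMeasurable (ae_of_all _ fun ξ => ?_)
      rw [norm_pow, norm_norm]
      gcongr
      exact norm_fourier_le a ξ
    have e : ∫ ξ, (gaussCut (1 / ((n : ℝ) + 1)) ξ : ℂ) * (𝓕 a ξ * star (𝓕 a ξ))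
        = ((∫ ξ, gaussCut (1 / ((n : ℝ) + 1)) ξ * ‖𝓕 a ξ‖ ^ 2 : ℝ) : ℂ) := by
      rw [← integral_complex_ofReal]
      refine integral_congr_ae (ae_of_all _ fun ξ => ?_)
      simp only [Complex.star_def, Complex.mul_conj, Complex.normSq_eq_norm_sq, Complex.ofReal_mul]
    have hnn (ξ : Space3) : 0 ≤ gaussCut (1 / ((n : ℝ) + 1)) ξ * ‖𝓕 a ξ‖ ^ 2 := by
      unfold gaussCut; positivity
    rw [e, ← ofReal_norm, Complex.norm_real, Real.norm_of_nonneg (integral_nonneg hnn),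
      ofReal_integral_eq_lintegral_ofReal hi (ae_of_all _ hnn)] at h
    refine le_trans (le_of_eq (lintegral_congr fun ξ => ?_)) h
    rw [ENNReal.ofReal_mul (by unfold gaussCut; positivity), ENNReal.ofReal_pow (norm_nonneg _),
      ofReal_norm]
  have h2 (ξ : Space3) : Tendsto (fun n : ℕ => ENNReal.ofReal (gaussCut (1 / ((n : ℝ) + 1)) ξ)
      * ‖𝓕 a ξ‖ₑ ^ 2) atTop (𝓝 (‖𝓕 a ξ‖ₑ ^ 2)) := by
    have h3 : Tendsto (fun n : ℕ => gaussCut (1 / ((n : ℝ) + 1)) ξ) atTop (𝓝 (gaussCut 0 ξ)) := by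
      have hc : Continuous fun τ => gaussCut τ ξ := by unfold gaussCut; fun_prop
      exact (hc.tendsto 0).comp tendsto_one_div_add_atTop_nhds_zero_nat
    have h4 := ENNReal.Tendsto.mul_const (b := ‖𝓕 a ξ‖ₑ ^ 2) (ENNReal.tendsto_ofReal h3)
      (Or.inr (by finiteness))
    simpa [gaussCut] using h4
  -- Fatou's lemma along τ = 1/(n+1), where the Gaussian cutoff tends to one pointwise.
  calc ∫⁻ ξ, ‖𝓕 a ξ‖ₑ ^ 2 = ∫⁻ ξ, liminf (fun n : ℕ =>
        ENNReal.ofReal (gaussCut (1 / ((n : ℝ) + 1)) ξ) * ‖𝓕 a ξ‖ₑ ^ 2) atTop :=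
        lintegral_congr fun ξ => (h2 ξ).liminf_eq.symm
    _ ≤ liminf (fun n : ℕ => ∫⁻ ξ, ENNReal.ofReal (gaussCut (1 / ((n : ℝ) + 1)) ξ)
          * ‖𝓕 a ξ‖ₑ ^ 2) atTop := by
        refine lintegral_liminf_le' fun n => ?_
        refine AEMeasurable.mul ?_ ((continuous_fourier ha).aemeasurable.enorm.pow_const 2)
        exact (ENNReal.measurable_ofReal.comp
          (measurable_gaussCut.comp measurable_prodMk_left)).aemeasurable
    _ ≤ _ := by
        refine liminf_le_of_le (by isBoundedDefault) fun b hb => ?_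
        obtain ⟨n, hn⟩ := hb.exists
        exact hn.trans (h1 n)

/-- Subordination of the Newtonian energy to the heat semigroup. -/
theorem integral_integral_greenFun_mul {a b : Space3 → ℂ} (ha : Integrable a) (hb : Integrable b)
    (hab : Integrable (fun p : Space3 × Space3 => a p.1 * (greenFun 0 (p.1 - p.2) * star (b p.2)))
      (volume.prod volume)) :
    ∫ x, a x * ∫ y, greenFun 0 (x - y) * star (b y)
      = ∫ τ in Set.Ioi (0 : ℝ), ∫ ξ, (gaussCut τ ξ : ℂ) * (𝓕 a ξ * star (𝓕 b ξ)) := by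
  let F : Space3 × Space3 → ℝ → ℂ := fun p τ =>
    a p.1 * ((heatKernel τ (p.1 - p.2) : ℂ) * star (b p.2))
  have hne : ∀ᵐ p : Space3 × Space3 ∂(volume.prod volume), p.1 - p.2 ≠ 0 := by
    have hms : MeasurableSet {p : Space3 × Space3 | ¬ (p.1 - p.2 ≠ 0)} :=
      (measurableSet_eq_fun (by fun_prop) (by fun_prop)).compl.compl
    rw [ae_iff, Measure.measure_prod_null hms]
    refine ae_of_all _ fun x => ?_
    have : Prod.mk x ⁻¹' {p : Space3 × Space3 | ¬ (p.1 - p.2 ≠ 0)} = {x} := by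
      ext y; simp [sub_eq_zero, eq_comm]
    change volume (Prod.mk x ⁻¹' _) = 0
    rw [this]
    simp
  have hFm : AEStronglyMeasurable (Function.uncurry F)
      ((volume.prod volume).prod (volume.restrict (Set.Ioi (0 : ℝ)))) := by
    have h1 : AEStronglyMeasurable (fun q : (Space3 × Space3) × ℝ => a q.1.1)
        ((volume.prod volume).prod (volume.restrict (Set.Ioi (0 : ℝ)))) := ha.1.comp_fst.comp_fst
    have h2 : AEStronglyMeasurable (fun q : (Space3 × Space3) × ℝ => star (b q.1.2))
        ((volume.prod volume).prod (volume.restrict (Set.Ioi (0 : ℝ)))) :=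
      (hb.1.comp_snd.comp_fst).star
    have h3 : Measurable fun q : (Space3 × Space3) × ℝ => (heatKernel q.2 (q.1.1 - q.1.2) : ℂ) :=
      Complex.measurable_ofReal.comp (measurable_heatKernel.comp
        (f := fun q : (Space3 × Space3) × ℝ => (q.2, q.1.1 - q.1.2)) (by fun_prop))
    exact h1.mul (h3.aestronglyMeasurable.mul h2)
  have hint : ∀ p : Space3 × Space3, p.1 - p.2 ≠ 0 →
      ∫ τ in Set.Ioi (0 : ℝ), (heatKernel τ (p.1 - p.2) : ℂ) = greenFun 0 (p.1 - p.2) := by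
    intro p hp
    rw [integral_complex_ofReal, integral_heatKernel_time hp, greenFun_zero_freq]
  have hFi : Integrable (Function.uncurry F)
      ((volume.prod volume).prod (volume.restrict (Set.Ioi (0 : ℝ)))) := by
    refine (integrable_prod_iff hFm).2 ⟨?_, ?_⟩
    · filter_upwards [hne] with p hp
      exact ((integrableOn_heatKernel_time hp).ofReal.mul_const (star (b p.2))).const_mul (a p.1)
    -- Since the heat kernel is nonnegative, integrating absolute values over time reproduces the
    -- Green function exactly, and Fubini's hypothesis reduces to `hab`.
    · refine hab.norm.congr ?_
      filter_upwards [hne] with p hp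
      change _ = ∫ τ in Set.Ioi (0 : ℝ), ‖a p.1 * ((heatKernel τ (p.1 - p.2) : ℂ) * star (b p.2))‖
      simp only [norm_mul]
      rw [integral_const_mul, integral_mul_const, norm_greenFun_zero_freq,
        ← integral_heatKernel_time hp]
      congr 2
      refine setIntegral_congr_fun measurableSet_Ioi fun τ hτ => ?_
      rw [Complex.norm_real, Real.norm_of_nonneg (heatKernel_nonneg hτ _)]
  calc ∫ x, a x * ∫ y, greenFun 0 (x - y) * star (b y)
      = ∫ p : Space3 × Space3, a p.1 * (greenFun 0 (p.1 - p.2) * star (b p.2))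
          ∂(volume.prod volume) := by
        rw [integral_prod _ hab]
        simp only [integral_const_mul]
    _ = ∫ p : Space3 × Space3, (∫ τ in Set.Ioi (0 : ℝ), F p τ) ∂(volume.prod volume) := by
        refine integral_congr_ae ?_
        filter_upwards [hne] with p hp
        simp only [F]
        rw [integral_const_mul, integral_mul_const, hint p hp]
    _ = ∫ τ in Set.Ioi (0 : ℝ), ∫ p : Space3 × Space3, F p τ ∂(volume.prod volume) :=
        integral_integral_swap hFi
    _ = _ := by
        refine setIntegral_congr_ae measurableSet_Ioi ?_
        have h5 := (ae_restrict_iff' measurableSet_Ioi).1 hFi.prod_left_ae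
        filter_upwards [h5] with τ hτi hτ
        rw [← integral_mul_heatKernel ha hb hτ]
        refine (integral_prod _ (hτi hτ)).trans (integral_congr_ae (ae_of_all _ fun x => ?_))
        exact integral_const_mul (a x) _

theorem lintegral_gaussCut_time {ξ : Space3} (hξ : ξ ≠ 0) :
    ∫⁻ τ in Set.Ioi (0 : ℝ), ENNReal.ofReal (gaussCut τ ξ)
      = ENNReal.ofReal ((4 * π ^ 2 * ‖ξ‖ ^ 2)⁻¹) := by
  have hr : 0 < ‖ξ‖ := norm_pos_iff.2 hξ
  have e (τ : ℝ) : gaussCut τ ξ = Real.exp (-(4 * π ^ 2 * ‖ξ‖ ^ 2) * τ) := by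
    unfold gaussCut; ring_nf
  simp_rw [e]
  rw [← ofReal_integral_eq_lintegral_ofReal
    (integrableOn_exp_mul_Ioi (by simp only [neg_lt_zero]; positivity) 0)
    (ae_of_all _ fun τ => (Real.exp_pos _).le),
    integral_exp_mul_Ioi (by simp only [neg_lt_zero]; positivity)]
  simp [neg_div]

/-- The Newtonian energy is bounded by its expression in frequency space. -/
theorem enorm_integral_greenFun_le {a b : Space3 → ℂ} (ha : Integrable a) (hb : Integrable b)
    (hab : Integrable (fun p : Space3 × Space3 => a p.1 * (greenFun 0 (p.1 - p.2) * star (b p.2)))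
      (volume.prod volume)) :
    ‖∫ x, a x * ∫ y, greenFun 0 (x - y) * star (b y)‖ₑ
      ≤ ∫⁻ ξ, ENNReal.ofReal ((4 * π ^ 2 * ‖ξ‖ ^ 2)⁻¹) * (‖𝓕 a ξ‖ₑ * ‖𝓕 b ξ‖ₑ) := by
  rw [integral_integral_greenFun_mul ha hb hab]
  have hm : Measurable fun p : ℝ × Space3 => ENNReal.ofReal (gaussCut p.1 p.2)
      * (‖𝓕 a p.2‖ₑ * ‖𝓕 b p.2‖ₑ) := by
    have h1 := (continuous_fourier ha).measurable
    have h2 := (continuous_fourier hb).measurable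
    exact (ENNReal.measurable_ofReal.comp measurable_gaussCut).mul
      ((h1.comp measurable_snd).enorm.mul (h2.comp measurable_snd).enorm)
  calc _ ≤ ∫⁻ τ in Set.Ioi (0 : ℝ), ‖∫ ξ, (gaussCut τ ξ : ℂ) * (𝓕 a ξ * star (𝓕 b ξ))‖ₑ :=
        enorm_integral_le_lintegral_enorm _
    _ ≤ ∫⁻ τ in Set.Ioi (0 : ℝ), ∫⁻ ξ, ENNReal.ofReal (gaussCut τ ξ) * (‖𝓕 a ξ‖ₑ * ‖𝓕 b ξ‖ₑ) := by
        refine lintegral_mono fun τ => (enorm_integral_le_lintegral_enorm _).trans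
          (le_of_eq (lintegral_congr fun ξ => ?_))
        rw [enorm_mul, enorm_mul, ← ofReal_norm (gaussCut τ ξ : ℂ), Complex.norm_real,
          Real.norm_of_nonneg (show 0 ≤ gaussCut τ ξ from (Real.exp_pos _).le),
          ← ofReal_norm (star _), norm_star, ofReal_norm]
    _ = ∫⁻ ξ, ∫⁻ τ in Set.Ioi (0 : ℝ), ENNReal.ofReal (gaussCut τ ξ)
          * (‖𝓕 a ξ‖ₑ * ‖𝓕 b ξ‖ₑ) := lintegral_lintegral_swap hm.aemeasurable
    _ = _ := by
        refine lintegral_congr_ae ?_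
        have h0 : ∀ᵐ ξ : Space3, ξ ≠ 0 := by simp [ae_iff]
        filter_upwards [h0] with ξ hξ
        have hc : Measurable fun τ => ENNReal.ofReal (gaussCut τ ξ) :=
          ENNReal.measurable_ofReal.comp (measurable_gaussCut.comp measurable_prodMk_right)
        rw [lintegral_mul_const _ hc, lintegral_gaussCut_time hξ]

/-- The Newtonian energy is nonnegative. -/
theorem re_integral_greenFun_nonneg {a : Space3 → ℂ} (ha : Integrable a)
    (haa : Integrable (fun p : Space3 × Space3 => a p.1 * (greenFun 0 (p.1 - p.2) * star (a p.2)))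
      (volume.prod volume)) :
    0 ≤ (∫ x, a x * ∫ y, greenFun 0 (x - y) * star (a y)).re := by
  rw [integral_integral_greenFun_mul ha ha haa]
  have e (τ : ℝ) : ∫ ξ, (gaussCut τ ξ : ℂ) * (𝓕 a ξ * star (𝓕 a ξ))
      = ((∫ ξ, gaussCut τ ξ * ‖𝓕 a ξ‖ ^ 2 : ℝ) : ℂ) := by
    rw [← integral_complex_ofReal]
    refine integral_congr_ae (ae_of_all _ fun ξ => ?_)
    simp only [Complex.star_def, Complex.mul_conj, Complex.normSq_eq_norm_sq, Complex.ofReal_mul]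
  simp_rw [e]
  rw [integral_complex_ofReal, Complex.ofReal_re]
  refine integral_nonneg fun τ => integral_nonneg fun ξ => ?_
  unfold gaussCut
  positivity

end Heat

/-! ### H² regularity and nonnegativity of the Newtonian potential -/

section Regularity

open Real FourierTransform

variable {D : Set Space3}

/-- The conjugate of `f ∈ L²(D)`, extended by zero. -/
def starExt (f : L2 D) : Space3 → ℂ := D.indicator (star (f : Space3 → ℂ))

theorem star_starExt (f : L2 D) (y : Space3) :
    star (starExt f y) = D.indicator (f : Space3 → ℂ) y := by
  by_cases hy : y ∈ D <;> simp [starExt, hy]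

theorem integrable_starExt [IsFiniteMeasure (volume.restrict D)] (hD : IsOpen D) (f : L2 D) :
    Integrable (starExt f) :=
  (integrable_indicator_iff hD.measurableSet).2 ((Lp.memLp f).star.integrable (by norm_num))

theorem lintegral_enorm_starExt_sq (hD : IsOpen D) (f : L2 D) :
    ∫⁻ x, ‖starExt f x‖ₑ ^ 2 = eLpNorm f 2 (volume.restrict D) ^ 2 := by
  have h := eLpNorm_nnreal_pow_eq_lintegral (f := f) (μ := volume.restrict D) (p := 2) (by simp)
  norm_num at h
  rw [h, ← lintegral_indicator hD.measurableSet]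
  refine lintegral_congr fun x => ?_
  by_cases hx : x ∈ D
  · simp [starExt, hx, ← ofReal_norm]
  · simp [starExt, hx]

theorem integrable_mul_greenFun_starExt (hDo : IsOpen D) (hD : volume D ≠ ⊤) {χ : Space3 → ℂ}
    (hχ : Integrable χ (volume.restrict D)) (h0 : ∀ x ∉ D, χ x = 0) (f : L2 D) :
    Integrable (fun p : Space3 × Space3 => χ p.1 * (greenFun 0 (p.1 - p.2) * star (starExt f p.2)))
      (volume.prod volume) := by
  have h := integrable_prod_greenFun hD hχ (Lp.memLp f)
  rw [Measure.prod_restrict] at h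
  refine ((integrable_indicator_iff (hDo.measurableSet.prod hDo.measurableSet)).2 h).congr
    (ae_of_all _ fun p => ?_)
  simp only [star_starExt]
  by_cases h1 : p.1 ∈ D <;> by_cases h2 : p.2 ∈ D <;> simp [h0, h1, h2]

theorem integral_mul_newtonPotential_eq (hDo : IsOpen D) {χ : Space3 → ℂ} (h0 : ∀ x ∉ D, χ x = 0)
    (f : L2 D) : ∫ x in D, newtonPotential D f x * χ x
      = ∫ x, χ x * ∫ y, greenFun 0 (x - y) * star (starExt f y) := by
  have h1 (x : Space3) : newtonPotential D f x = ∫ y, greenFun 0 (x - y) * star (starExt f y) := by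
    unfold newtonPotential volumePotential
    rw [← integral_indicator hDo.measurableSet]
    refine integral_congr_ae (ae_of_all _ fun y => ?_)
    simp only [star_starExt]
    by_cases h2 : y ∈ D <;> simp [h2]
  simp_rw [← h1]
  rw [setIntegral_eq_integral_of_forall_compl_eq_zero fun x hx => by rw [h0 x hx, mul_zero]]
  simp only [mul_comm]

theorem norm_fourier_partialDeriv_le {ψ : Space3 → ℝ} (hψ : IsTestFun D ψ) (i : Fin 3)
    (ξ : Space3) : ‖𝓕 (fun x => (partialDeriv i ψ x : ℂ)) ξ‖
      ≤ 2 * π * ‖ξ‖ * ‖𝓕 (fun x => (ψ x : ℂ)) ξ‖ := by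
  set g : Space3 → ℂ := fun x => (ψ x : ℂ)
  have hg : ContDiff ℝ (⊤ : ℕ∞) g := Complex.ofRealCLM.contDiff.comp hψ.1
  have hgs : HasCompactSupport g := hψ.2.1.comp_left Complex.ofReal_zero
  have h1 : Integrable g := hg.continuous.integrable_of_hasCompactSupport hgs
  have h2 : Integrable (fderiv ℝ g) :=
    (hg.continuous_fderiv (by simp)).integrable_of_hasCompactSupport (hgs.fderiv (𝕜 := ℝ))
  have h3 : (fun x => (partialDeriv i ψ x : ℂ))
      = fun x => fderiv ℝ g x (EuclideanSpace.single i 1) := by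
    funext x
    have := (Complex.ofRealCLM.hasFDerivAt.comp x (hψ.differentiable x).hasFDerivAt).fderiv
    change _ = fderiv ℝ (Complex.ofRealCLM ∘ ψ) x (EuclideanSpace.single i 1)
    rw [this]
    rfl
  rw [h3, ← Real.fourier_continuousLinearMap_apply h2,
    Real.fourier_fderiv h1 (hg.differentiable (by simp)) h2]
  rw [VectorFourier.fourierSMulRight_apply, norm_smul, norm_smul]
  have h4 : ‖(-innerSL ℝ ξ) (EuclideanSpace.single i (1 : ℝ))‖ ≤ ‖ξ‖ := by
    rw [neg_apply, norm_neg, innerSL_apply_apply]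
    refine (norm_inner_le_norm (𝕜 := ℝ) _ _).trans ?_
    simp
  change ‖-(2 * (π : ℂ) * Complex.I)‖ *
    (‖(-innerSL ℝ ξ) (EuclideanSpace.single i (1 : ℝ))‖ * ‖𝓕 g ξ‖) ≤ _
  have h5 : ‖-(2 * (π : ℂ) * Complex.I)‖ = 2 * π := by
    simp [abs_of_pos pi_pos]
  rw [h5, mul_assoc (2 * π)]
  gcongr

/-- The weight `(2π|ξ|)⁻²`. -/
def freqWeight (ξ : Space3) : ENNReal := ENNReal.ofReal ((4 * π ^ 2 * ‖ξ‖ ^ 2)⁻¹)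

theorem measurable_freqWeight : Measurable freqWeight := by
  unfold freqWeight; fun_prop

/-- In the unit ball 𝓕 a is bounded and |ξ|⁻² is integrable in dimension three; outside it the
weight is at most one and Bessel's inequality applies. -/
theorem lintegral_freqWeight_fourier_lt_top {a : Space3 → ℂ} (ha : Integrable a)
    (ha2 : ∫⁻ x, ‖a x‖ₑ ^ 2 ≠ ⊤) : ∫⁻ ξ, freqWeight ξ * ‖𝓕 a ξ‖ₑ ^ 2 ≠ ⊤ := by
  have hb : ∫⁻ ξ in Metric.ball (0 : Space3) 1, ENNReal.ofReal ((‖ξ‖ ^ 2)⁻¹) ≠ ⊤ := by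
    have := (integrableOn_norm_sq_inv 1).hasFiniteIntegral
    rw [hasFiniteIntegral_iff_ofReal (ae_of_all _ fun z => by positivity)] at this
    exact this.ne
  have hπ : 1 ≤ 4 * π ^ 2 := by nlinarith [Real.pi_gt_three]
  have hw (ξ : Space3) : (4 * π ^ 2 * ‖ξ‖ ^ 2)⁻¹ ≤ (‖ξ‖ ^ 2)⁻¹ := by
    rw [mul_inv]
    exact mul_le_of_le_one_left (by positivity) (inv_le_one_of_one_le₀ hπ)
  set c : ENNReal := ENNReal.ofReal (∫ x, ‖a x‖)
  have h1 (ξ : Space3) : freqWeight ξ * ‖𝓕 a ξ‖ₑ ^ 2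
      ≤ (Metric.ball (0 : Space3) 1).indicator (fun ξ => ENNReal.ofReal ((‖ξ‖ ^ 2)⁻¹) * c ^ 2) ξ
        + ‖𝓕 a ξ‖ₑ ^ 2 := by
    by_cases h : ξ ∈ Metric.ball (0 : Space3) 1
    · rw [Set.indicator_of_mem h]
      refine le_add_right ?_
      refine mul_le_mul' (ENNReal.ofReal_le_ofReal (hw ξ)) (pow_le_pow_left' ?_ 2)
      · rw [← ofReal_norm]
        exact ENNReal.ofReal_le_ofReal (norm_fourier_le a ξ)
    · have h2 : 1 ≤ ‖ξ‖ := by simpa using h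
      rw [Set.indicator_of_notMem h, zero_add]
      refine mul_le_of_le_one_left' ?_
      unfold freqWeight
      rw [← ENNReal.ofReal_one]
      exact ENNReal.ofReal_le_ofReal ((hw ξ).trans (inv_le_one_of_one_le₀ (one_le_pow₀ h2)))
  refine ne_top_of_le_ne_top ?_ (lintegral_mono h1)
  rw [lintegral_add_right _ ((continuous_fourier ha).measurable.enorm.pow_const 2),
    lintegral_indicator measurableSet_ball, lintegral_mul_const _ (by fun_prop)]
  refine ENNReal.add_ne_top.2 ⟨ENNReal.mul_ne_top hb (by finiteness), ?_⟩
  exact ne_top_of_le_ne_top ha2 (lintegral_enorm_fourier_sq_le ha)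

theorem lintegral_enorm_testFun_sq {ψ : Space3 → ℝ} (hψ : IsTestFun D ψ) (hD : IsOpen D) :
    ∫⁻ x, ‖(ψ x : ℂ)‖ₑ ^ 2 = eLpNorm ψ 2 (volume.restrict D) ^ 2 := by
  have h := eLpNorm_nnreal_pow_eq_lintegral (f := ψ) (μ := volume.restrict D) (p := 2) (by simp)
  norm_num at h
  rw [h, ← lintegral_indicator hD.measurableSet]
  refine lintegral_congr fun x => ?_
  by_cases hx : x ∈ D
  · simp [hx, ← ofReal_norm]
  · simp [hx, hψ.eq_zero hx]

/-- Cauchy–Schwarz in frequency space against a test function. -/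
theorem lintegral_mul_fourier_testFun_le {ψ : Space3 → ℝ} (hψ : IsTestFun D ψ) (hD : IsOpen D)
    {g : Space3 → ENNReal} (hg : Measurable g) :
    ∫⁻ ξ, g ξ * ‖𝓕 (fun x => (ψ x : ℂ)) ξ‖ₑ
      ≤ (∫⁻ ξ, g ξ ^ 2) ^ (1 / 2 : ℝ) * eLpNorm ψ 2 (volume.restrict D) := by
  have hi : Integrable fun x => (ψ x : ℂ) :=
    (Complex.continuous_ofReal.comp hψ.1.continuous).integrable_of_hasCompactSupport
      (hψ.2.1.comp_left Complex.ofReal_zero)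
  have h := ENNReal.lintegral_mul_le_Lp_mul_Lq volume Real.HolderConjugate.two_two
    hg.aemeasurable (continuous_fourier hi).measurable.enorm.aemeasurable
  simp only [Pi.mul_apply, ENNReal.rpow_ofNat] at h
  refine h.trans ?_
  gcongr
  have h2 := (lintegral_enorm_fourier_sq_le hi).trans_eq (lintegral_enorm_testFun_sq hψ hD)
  calc _ ≤ (eLpNorm ψ 2 (volume.restrict D) ^ 2) ^ (1 / 2 : ℝ) := by gcongr
    _ = _ := by
      rw [← ENNReal.rpow_ofNat, ← ENNReal.rpow_mul]
      norm_num

/-- The Newtonian potential of a square integrable function has two square integrable weak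
derivatives. -/
theorem exists_toL2_eq_newtonL2 (hDo : IsOpen D) (hD : volume D ≠ ⊤) (f : L2 D) :
    ∃ F : H2 D, H2.comp (.inl ()) F = newtonL2 hD f := by
  have : IsFiniteMeasure (volume.restrict D) := ⟨by simpa using hD.lt_top⟩
  set b := starExt f
  have hb : Integrable b := integrable_starExt hDo f
  have hb2 : ∫⁻ x, ‖b x‖ₑ ^ 2 ≠ ⊤ := by
    rw [lintegral_enorm_starExt_sq hDo]
    exact ENNReal.pow_ne_top (Lp.memLp f).2.ne
  have hmb : Measurable fun ξ => ‖𝓕 b ξ‖ₑ := (continuous_fourier hb).measurable.enorm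
  set C : ENNReal := (∫⁻ ξ, ‖𝓕 b ξ‖ₑ ^ 2) ^ (1 / 2 : ℝ)
    + (∫⁻ ξ, freqWeight ξ * ‖𝓕 b ξ‖ₑ ^ 2) ^ (1 / 2 : ℝ)
  have hC : C ≠ ⊤ := by
    refine ENNReal.add_ne_top.2 ⟨ENNReal.rpow_ne_top_of_nonneg (by norm_num) ?_,
      ENNReal.rpow_ne_top_of_nonneg (by norm_num) (lintegral_freqWeight_fourier_lt_top hb hb2)⟩
    exact ne_top_of_le_ne_top hb2 (lintegral_enorm_fourier_sq_le hb)
  -- The duality estimate common to first and second derivatives: χ will be ∂ᵢψ or ∂ᵢ∂ⱼψ, and g is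
  -- what remains of the weight and of 𝓕 b once the transform of χ has been compared with that of ψ.
  have key (g : Space3 → ENNReal) (hg : Measurable g)
      (hgC : (∫⁻ ξ, g ξ ^ 2) ^ (1 / 2 : ℝ) ≤ C) (χ ψ : Space3 → ℝ) (hχ : IsTestFun D χ)
      (hψ : IsTestFun D ψ)
      (h : ∀ ξ, freqWeight ξ * (‖𝓕 (fun x => (χ x : ℂ)) ξ‖ₑ * ‖𝓕 b ξ‖ₑ)
          ≤ g ξ * ‖𝓕 (fun x => (ψ x : ℂ)) ξ‖ₑ) :
      ‖∫ x in D, newtonL2 hD f x * (χ x : ℂ)‖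
        ≤ C.toReal * (eLpNorm ψ 2 (volume.restrict D)).toReal := by
    have hχi : Integrable fun x => (χ x : ℂ) :=
      (Complex.continuous_ofReal.comp hχ.1.continuous).integrable_of_hasCompactSupport
        (hχ.2.1.comp_left Complex.ofReal_zero)
    have h0 : ∀ x ∉ D, (χ x : ℂ) = 0 := fun x hx => by rw [hχ.eq_zero hx, Complex.ofReal_zero]
    have hψ2 : eLpNorm ψ 2 (volume.restrict D) ≠ ⊤ :=
      (hψ.1.continuous.memLp_of_hasCompactSupport hψ.2.1).2.ne
    have e : ∫ x in D, newtonL2 hD f x * (χ x : ℂ)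
        = ∫ x, (χ x : ℂ) * ∫ y, greenFun 0 (x - y) * star (b y) := by
      rw [← integral_mul_newtonPotential_eq hDo h0]
      refine integral_congr_ae ?_
      filter_upwards [coeFn_newtonL2 hD f] with x hx
      rw [hx]
    rw [e, ← ENNReal.toReal_mul, ← toReal_enorm]
    refine ENNReal.toReal_mono (ENNReal.mul_ne_top hC hψ2) ?_
    calc _ ≤ _ := enorm_integral_greenFun_le hχi hb
          (integrable_mul_greenFun_starExt hDo hD hχi.integrableOn h0 f)
      _ ≤ _ := lintegral_mono h
      _ ≤ _ := lintegral_mul_fourier_testFun_le hψ hDo hg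
      _ ≤ _ := by gcongr
  have hder (χ : Space3 → ℝ) (hχ : IsTestFun D χ) (i : Fin 3) (ξ : Space3) :
      ‖𝓕 (fun x => (partialDeriv i χ x : ℂ)) ξ‖ₑ
        ≤ ENNReal.ofReal (2 * π * ‖ξ‖) * ‖𝓕 (fun x => (χ x : ℂ)) ξ‖ₑ := by
    rw [← ofReal_norm, ← ofReal_norm, ← ENNReal.ofReal_mul (by positivity)]
    exact ENNReal.ofReal_le_ofReal (norm_fourier_partialDeriv_le hχ i ξ)
  have hw (ξ : Space3) : freqWeight ξ * (ENNReal.ofReal (2 * π * ‖ξ‖)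
      * ENNReal.ofReal (2 * π * ‖ξ‖)) ≤ 1 := by
    unfold freqWeight
    rw [← ENNReal.ofReal_mul (by positivity), ← ENNReal.ofReal_mul (by positivity),
      ← ENNReal.ofReal_one]
    refine ENNReal.ofReal_le_ofReal ?_
    rw [show 2 * π * ‖ξ‖ * (2 * π * ‖ξ‖) = 4 * π ^ 2 * ‖ξ‖ ^ 2 by ring]
    exact inv_mul_le_one
  have hw' (ξ : Space3) : freqWeight ξ * ENNReal.ofReal (2 * π * ‖ξ‖)
      ≤ freqWeight ξ ^ (1 / 2 : ℝ) := by
    have e : freqWeight ξ = freqWeight ξ ^ (1 / 2 : ℝ) * freqWeight ξ ^ (1 / 2 : ℝ) := by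
      rw [← ENNReal.rpow_add_of_nonneg _ _ (by norm_num) (by norm_num)]
      norm_num
    have h1 : freqWeight ξ ^ (1 / 2 : ℝ) = ENNReal.ofReal ((2 * π * ‖ξ‖)⁻¹) := by
      unfold freqWeight
      rw [ENNReal.ofReal_rpow_of_nonneg (by positivity) (by norm_num), ← Real.sqrt_eq_rpow,
        Real.sqrt_inv, show 4 * π ^ 2 * ‖ξ‖ ^ 2 = (2 * π * ‖ξ‖) ^ 2 by ring,
        Real.sqrt_sq (by positivity)]
    nth_rw 1 [e]
    rw [mul_assoc]
    refine mul_le_of_le_one_right' ?_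
    rw [h1, ← ENNReal.ofReal_mul (by positivity), ← ENNReal.ofReal_one]
    exact ENNReal.ofReal_le_ofReal inv_mul_le_one
  refine exists_toL2_eq_of_bound _ C.toReal (fun i ψ hψ => ?_) (fun i j ψ hψ => ?_)
  -- One derivative cancels only half of the weight; the other half stays with 𝓕 b, where it is
  -- square integrable.
  · have hg : Measurable fun ξ => freqWeight ξ ^ (1 / 2 : ℝ) * ‖𝓕 b ξ‖ₑ :=
      (measurable_freqWeight.pow_const _).mul hmb
    refine key _ hg ?_ _ ψ (hψ.partialDeriv i) hψ fun ξ => ?_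
    · refine le_trans (le_of_eq ?_) le_add_self
      congr 1
      refine lintegral_congr fun ξ => ?_
      rw [mul_pow, ← ENNReal.rpow_ofNat, ← ENNReal.rpow_mul]
      norm_num
    · calc _ ≤ freqWeight ξ * ((ENNReal.ofReal (2 * π * ‖ξ‖) * ‖𝓕 (fun x => (ψ x : ℂ)) ξ‖ₑ)
            * ‖𝓕 b ξ‖ₑ) := by gcongr; exact hder ψ hψ i ξ
        _ = (freqWeight ξ * ENNReal.ofReal (2 * π * ‖ξ‖))
            * (‖𝓕 (fun x => (ψ x : ℂ)) ξ‖ₑ * ‖𝓕 b ξ‖ₑ) := by ring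
        _ ≤ freqWeight ξ ^ (1 / 2 : ℝ) * (‖𝓕 (fun x => (ψ x : ℂ)) ξ‖ₑ * ‖𝓕 b ξ‖ₑ) := by
            gcongr; exact hw' ξ
        _ = _ := by ring
  -- Two derivatives cancel the whole weight, and the square integrability of 𝓕 b is enough.
  · refine key _ hmb le_self_add _ ψ ((hψ.partialDeriv j).partialDeriv i) hψ fun ξ => ?_
    calc _ ≤ freqWeight ξ * ((ENNReal.ofReal (2 * π * ‖ξ‖) * (ENNReal.ofReal (2 * π * ‖ξ‖)
            * ‖𝓕 (fun x => (ψ x : ℂ)) ξ‖ₑ)) * ‖𝓕 b ξ‖ₑ) := by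
          gcongr
          exact (hder _ (hψ.partialDeriv j) i ξ).trans (by gcongr; exact hder ψ hψ j ξ)
      _ = (freqWeight ξ * (ENNReal.ofReal (2 * π * ‖ξ‖) * ENNReal.ofReal (2 * π * ‖ξ‖)))
            * (‖𝓕 b ξ‖ₑ * ‖𝓕 (fun x => (ψ x : ℂ)) ξ‖ₑ) := by ring
      _ ≤ 1 * (‖𝓕 b ξ‖ₑ * ‖𝓕 (fun x => (ψ x : ℂ)) ξ‖ₑ) := by gcongr; exact hw ξ
      _ = _ := one_mul _

/-- The Newtonian potential is a nonnegative operator. -/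
theorem re_inner_newtonL2_nonneg (hDo : IsOpen D) (hD : volume D ≠ ⊤) (f : L2 D) :
    0 ≤ (inner ℂ f (newtonL2 hD f)).re := by
  have : IsFiniteMeasure (volume.restrict D) := ⟨by simpa using hD.lt_top⟩
  have hb := integrable_starExt hDo f
  have h0 : ∀ x ∉ D, starExt f x = 0 := fun x hx => Set.indicator_of_notMem hx _
  have h := re_integral_greenFun_nonneg hb
    (integrable_mul_greenFun_starExt hDo hD hb.integrableOn h0 f)
  rw [← integral_mul_newtonPotential_eq hDo h0] at h
  convert h using 2
  rw [L2.inner_def]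
  refine integral_congr_ae ?_
  filter_upwards [coeFn_newtonL2 hD f, ae_restrict_mem hDo.measurableSet] with x hx hxD
  rw [hx]
  simp [starExt, hxD]

/-- The Newtonian potential as a bounded operator `L²(D) → H²(D) ∩ L^∞(D)`. -/
theorem exists_newtonH2Inf [IsFiniteMeasure (volume.restrict D)] (hDo : IsOpen D)
    (hD : volume D ≠ ⊤) : ∃ T : L2 D →L[ℂ] H2Inf D, H2Inf.incl D ∘L T = newtonL2 hD := by
  refine exists_clm_lift _ (H2Inf.incl_injective hDo) _ fun f => ?_
  obtain ⟨C, -, hC⟩ := exists_norm_newtonPotential_le hD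
  have m : MemLp (newtonPotential D f) ⊤ (volume.restrict D) :=
    memLp_top_of_bound (stronglyMeasurable_volumePotential 0 f).aestronglyMeasurable (C * ‖f‖)
      (ae_of_all _ (hC f))
  refine H2Inf.exists_incl_eq (g := m.toLp) ?_ (exists_toL2_eq_newtonL2 hDo hD f)
  filter_upwards [coeFn_newtonL2 hD f, m.coeFn_toLp] with x h1 h2
  rw [h1, h2]

end Regularity

/-! ### The regularised Green function and its Helmholtz defect -/

section Fundamental

open Real

/-- The regularised norm `√(|z|² + s²)`. -/
def regNorm (s : ℝ) (z : Space3) : ℝ := √(‖z‖ ^ 2 + s ^ 2)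

/-- The regularised Green function. -/
def regGreen (k : ℂ) (s : ℝ) (z : Space3) : ℂ :=
  Complex.exp (Complex.I * k * (regNorm s z : ℂ)) / (4 * (π : ℂ) * (regNorm s z : ℂ))

/-- The radial factor of the gradient of the regularised Green function. -/
def regGreenSlope (k : ℂ) (s : ℝ) (z : Space3) : ℂ :=
  Complex.exp (Complex.I * k * (regNorm s z : ℂ)) / (4 * (π : ℂ))
    * (Complex.I * k / (regNorm s z : ℂ) ^ 2 - 1 / (regNorm s z : ℂ) ^ 3)

/-- The radial factor of the second derivatives of the regularised Green function. -/
def regGreenCurv (k : ℂ) (s : ℝ) (z : Space3) : ℂ :=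
  Complex.exp (Complex.I * k * (regNorm s z : ℂ)) / (4 * (π : ℂ))
    * (-k ^ 2 / (regNorm s z : ℂ) ^ 3 - 3 * Complex.I * k / (regNorm s z : ℂ) ^ 4
      + 3 / (regNorm s z : ℂ) ^ 5)

variable {s : ℝ}

theorem regNorm_pos (hs : 0 < s) (z : Space3) : 0 < regNorm s z := by
  unfold regNorm; positivity

theorem regNorm_sq (z : Space3) : regNorm s z ^ 2 = ‖z‖ ^ 2 + s ^ 2 :=
  Real.sq_sqrt (by positivity)

theorem continuous_regNorm : Continuous (regNorm s) := by unfold regNorm; fun_prop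

theorem regNorm_ofReal_ne_zero (hs : 0 < s) (z : Space3) : (regNorm s z : ℂ) ≠ 0 :=
  Complex.ofReal_ne_zero.2 (regNorm_pos hs z).ne'

theorem continuous_regGreen (k : ℂ) (hs : 0 < s) : Continuous (regGreen k s) := by
  have h := Complex.continuous_ofReal.comp (continuous_regNorm (s := s))
  have hπ : (π : ℂ) ≠ 0 := Complex.ofReal_ne_zero.2 pi_ne_zero
  refine Continuous.div (by fun_prop) (by fun_prop) fun z => ?_
  have := regNorm_ofReal_ne_zero hs z
  simp [hπ, this]

theorem continuous_regGreenSlope (k : ℂ) (hs : 0 < s) : Continuous (regGreenSlope k s) := by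
  have h := Complex.continuous_ofReal.comp (continuous_regNorm (s := s))
  have h0 := regNorm_ofReal_ne_zero hs
  refine Continuous.mul (by fun_prop) (.sub (.div (by fun_prop) (by fun_prop) fun z => ?_)
    (.div (by fun_prop) (by fun_prop) fun z => ?_)) <;> exact pow_ne_zero _ (h0 z)

theorem continuous_regGreenCurv (k : ℂ) (hs : 0 < s) : Continuous (regGreenCurv k s) := by
  have h := Complex.continuous_ofReal.comp (continuous_regNorm (s := s))
  have h0 := regNorm_ofReal_ne_zero hs
  refine Continuous.mul (by fun_prop) (.add (.sub (.div (by fun_prop) (by fun_prop) fun z => ?_)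
    (.div (by fun_prop) (by fun_prop) fun z => ?_)) (.div (by fun_prop) (by fun_prop) fun z => ?_))
    <;> exact pow_ne_zero _ (h0 z)

theorem hasLineDerivAt_regNorm (hs : 0 < s) (i : Fin 3) (z : Space3) :
    HasDerivAt (fun t : ℝ => ((regNorm s (z + t • EuclideanSpace.single i 1) : ℝ) : ℂ))
      ((z i : ℂ) / (regNorm s z : ℂ)) 0 := by
  have h1 : HasDerivAt (fun t : ℝ => z + t • EuclideanSpace.single i (1 : ℝ))
      (EuclideanSpace.single i (1 : ℝ)) 0 := by
    simpa using ((hasDerivAt_id (0 : ℝ)).smul_const (EuclideanSpace.single i (1 : ℝ))).const_add z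
  have h2 := ((h1.norm_sq.add_const (s ^ 2)).sqrt (by simp; positivity)).ofReal_comp
  refine h2.congr_deriv ?_
  have : inner ℝ z (EuclideanSpace.single i (1 : ℝ)) = z i := by
    simp [EuclideanSpace.inner_single_right]
  simp only [zero_smul, add_zero, this]
  have h0 := (regNorm_pos hs z).ne'
  unfold regNorm at h0 ⊢
  push_cast
  have h0' : ((√(‖z‖ ^ 2 + s ^ 2) : ℝ) : ℂ) ≠ 0 := Complex.ofReal_ne_zero.2 h0
  field_simp

theorem hasLineDerivAt_regGreen (k : ℂ) (hs : 0 < s) (i : Fin 3) (z : Space3) :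
    HasLineDerivAt ℝ (regGreen k s) ((z i : ℂ) * regGreenSlope k s z) z
      (EuclideanSpace.single i 1) := by
  have h := hasLineDerivAt_regNorm hs i z
  have h0 := regNorm_ofReal_ne_zero hs z
  have hπ : (π : ℂ) ≠ 0 := Complex.ofReal_ne_zero.2 pi_ne_zero
  have h1 := ((h.const_mul (Complex.I * k)).cexp).div (h.const_mul (4 * (π : ℂ)))
    (by simp [h0, hπ])
  refine HasDerivAt.congr_deriv (f := fun t : ℝ => regGreen k s (z + t • EuclideanSpace.single i 1))
    h1 ?_
  simp only [zero_smul, add_zero, regGreenSlope]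
  field_simp

theorem hasLineDerivAt_regGreenSlope (k : ℂ) (hs : 0 < s) (i : Fin 3) (z : Space3) :
    HasLineDerivAt ℝ (regGreenSlope k s) ((z i : ℂ) * regGreenCurv k s z) z
      (EuclideanSpace.single i 1) := by
  have h := hasLineDerivAt_regNorm hs i z
  have h0 := regNorm_ofReal_ne_zero hs z
  have hπ : (π : ℂ) ≠ 0 := Complex.ofReal_ne_zero.2 pi_ne_zero
  have h0' : ((regNorm s (z + (0 : ℝ) • EuclideanSpace.single i 1) : ℝ) : ℂ) ≠ 0 := by
    simpa using h0
  have h1 := (((h.const_mul (Complex.I * k)).cexp).div_const (4 * (π : ℂ))).mul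
    (((hasDerivAt_const (0 : ℝ) (Complex.I * k)).div (h.pow 2) (pow_ne_zero _ h0')).sub
      ((hasDerivAt_const (0 : ℝ) (1 : ℂ)).div (h.pow 3) (pow_ne_zero _ h0')))
  refine HasDerivAt.congr_deriv
    (f := fun t : ℝ => regGreenSlope k s (z + t • EuclideanSpace.single i 1)) h1 ?_
  simp only [zero_smul, add_zero, regGreenCurv, Pi.sub_apply, Pi.div_apply, Pi.pow_apply]
  field_simp
  push_cast
  linear_combination k ^ 2 * (regNorm s z : ℂ) ^ 4 * (z i : ℂ) * Complex.I_sq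

theorem hasLineDerivAt_coord_mul_regGreenSlope (k : ℂ) (hs : 0 < s) (i : Fin 3) (z : Space3) :
    HasLineDerivAt ℝ (fun z : Space3 => (z i : ℂ) * regGreenSlope k s z)
      (regGreenSlope k s z + (z i : ℂ) ^ 2 * regGreenCurv k s z) z
      (EuclideanSpace.single i 1) := by
  have h1 : HasDerivAt (fun t : ℝ => (((z + t • EuclideanSpace.single i (1 : ℝ)) i : ℝ) : ℂ))
      1 0 := by
    have : HasDerivAt (fun t : ℝ => z i + t) 1 0 := (hasDerivAt_id (0 : ℝ)).const_add (z i)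
    simpa using this.ofReal_comp
  refine (h1.mul (hasLineDerivAt_regGreenSlope k hs i z)).congr_deriv ?_
  simp
  ring

/-- With ρ = √(|z|² + s²), the profile e^{ikρ}/(4πρ) would solve the radial Helmholtz equation if
the coordinates satisfied ∑ zᵢ² = ρ². In fact ∑ zᵢ² = ρ² − s², and the missing s² is the whole
defect. -/
theorem sum_regGreen_second_deriv (k : ℂ) (hs : 0 < s) (z : Space3) :
    ∑ i : Fin 3, (regGreenSlope k s z + (z i : ℂ) ^ 2 * regGreenCurv k s z) + k ^ 2 * regGreen k s z
      = -(s : ℂ) ^ 2 * regGreenCurv k s z := by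
  have h0 := regNorm_ofReal_ne_zero hs z
  have hπ : (π : ℂ) ≠ 0 := Complex.ofReal_ne_zero.2 pi_ne_zero
  have h1 : ∑ i : Fin 3, (z i : ℂ) ^ 2 = (regNorm s z : ℂ) ^ 2 - (s : ℂ) ^ 2 := by
    have := regNorm_sq (s := s) z
    rw [EuclideanSpace.norm_sq_eq] at this
    simp only [Real.norm_eq_abs, sq_abs] at this
    rw [eq_sub_iff_add_eq]
    exact_mod_cast this.symm
  rw [Finset.sum_add_distrib, ← Finset.sum_mul, h1]
  simp only [Finset.sum_const, Finset.card_univ, Fintype.card_fin, regGreen, regGreenSlope,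
    regGreenCurv, nsmul_eq_mul]
  field_simp
  push_cast
  ring

theorem integral_mul_partialDeriv_eq_neg {D : Set Space3} {ψ : Space3 → ℝ} (hψ : IsTestFun D ψ)
    {f f' : Space3 → ℂ} (hf : Continuous f) (hf' : Continuous f') (i : Fin 3)
    (h : ∀ y, HasLineDerivAt ℝ f (f' y) y (EuclideanSpace.single i 1)) :
    ∫ y, f y * (partialDeriv i ψ y : ℂ) = -∫ y, f' y * (ψ y : ℂ) := by
  have hi (g : Space3 → ℂ) (hg : Continuous g) (χ : Space3 → ℝ) (hχ : IsTestFun D χ) :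
      Integrable fun y => g y * (χ y : ℂ) := by
    refine (hg.mul (Complex.continuous_ofReal.comp hχ.1.continuous)).integrable_of_hasCompactSupport
      ?_
    exact HasCompactSupport.mul_left (hχ.2.1.comp_left Complex.ofReal_zero)
  refine integral_bilinear_hasLineDerivAt_right_eq_neg_left_of_integrable
    (B := ContinuousLinearMap.mul ℝ ℂ) (g := fun y => (ψ y : ℂ))
    (g' := fun y => (partialDeriv i ψ y : ℂ)) (v := EuclideanSpace.single i 1)
    (hi f' hf' ψ hψ) (hi f hf _ (hψ.partialDeriv i)) (hi f hf ψ hψ) (fun y _ => h y) fun y _ => ?_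
  exact HasDerivAt.ofReal_comp ((hψ.differentiable y).hasFDerivAt.hasLineDerivAt _)

/-- The Helmholtz operator `Δψ + k²ψ` applied to a test function. -/
def helmholtz (k : ℂ) (ψ : Space3 → ℝ) (y : Space3) : ℂ :=
  ∑ i : Fin 3, (partialDeriv i (partialDeriv i ψ) y : ℂ) + k ^ 2 * (ψ y : ℂ)

/-- Two integrations by parts in each coordinate; the regularised kernel has no pole, so no small
sphere has to be excised. -/
theorem integral_regGreen_mul_helmholtz {D : Set Space3} {ψ : Space3 → ℝ} (hψ : IsTestFun D ψ)
    (k : ℂ) (hs : 0 < s) (x : Space3) :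
    ∫ y, regGreen k s (y - x) * helmholtz k ψ y
      = ∫ y, (-(s : ℂ) ^ 2 * regGreenCurv k s (y - x)) * (ψ y : ℂ) := by
  have hi (g : Space3 → ℂ) (hg : Continuous g) (χ : Space3 → ℝ) (hχ : IsTestFun D χ) :
      Integrable fun y => g y * (χ y : ℂ) := by
    refine (hg.mul (Complex.continuous_ofReal.comp hχ.1.continuous)).integrable_of_hasCompactSupport
      ?_
    exact HasCompactSupport.mul_left (hχ.2.1.comp_left Complex.ofReal_zero)
  have hsub : Continuous fun y : Space3 => y - x := by fun_prop
  have c0 : Continuous fun y => regGreen k s (y - x) := (continuous_regGreen k hs).comp hsub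
  have c1 (i : Fin 3) : Continuous fun y : Space3 =>
      (((y - x) i : ℝ) : ℂ) * regGreenSlope k s (y - x) :=
    Continuous.mul (by fun_prop) ((continuous_regGreenSlope k hs).comp hsub)
  have c2 (i : Fin 3) : Continuous fun y : Space3 =>
      regGreenSlope k s (y - x) + (((y - x) i : ℝ) : ℂ) ^ 2 * regGreenCurv k s (y - x) :=
    ((continuous_regGreenSlope k hs).comp hsub).add
      (Continuous.mul (by fun_prop) ((continuous_regGreenCurv k hs).comp hsub))
  have c3 : Continuous fun y => k ^ 2 * regGreen k s (y - x) := continuous_const.mul c0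
  have tr {f : Space3 → ℂ} {f' : ℂ} {y v : Space3} (h : HasLineDerivAt ℝ f f' (y - x) v) :
      HasLineDerivAt ℝ (fun y => f (y - x)) f' y v := by
    unfold HasLineDerivAt at h ⊢
    refine h.congr_of_eventuallyEq (Eventually.of_forall fun t => ?_)
    simp only
    rw [add_sub_right_comm]
  have h2 (i : Fin 3) : ∫ y, regGreen k s (y - x) * (partialDeriv i (partialDeriv i ψ) y : ℂ)
      = ∫ y, (regGreenSlope k s (y - x) + (((y - x) i : ℝ) : ℂ) ^ 2 * regGreenCurv k s (y - x))
        * (ψ y : ℂ) := by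
    rw [integral_mul_partialDeriv_eq_neg (hψ.partialDeriv i) c0 (c1 i) i
      fun y => tr (hasLineDerivAt_regGreen k hs i (y - x)),
      integral_mul_partialDeriv_eq_neg hψ (c1 i) (c2 i) i
      fun y => tr (hasLineDerivAt_coord_mul_regGreenSlope k hs i (y - x)), neg_neg]
  calc ∫ y, regGreen k s (y - x) * helmholtz k ψ y
      = ∫ y, (∑ i : Fin 3, regGreen k s (y - x) * (partialDeriv i (partialDeriv i ψ) y : ℂ)
          + (k ^ 2 * regGreen k s (y - x)) * (ψ y : ℂ)) := by
        refine integral_congr_ae (ae_of_all _ fun y => ?_)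
        simp only [helmholtz, mul_add, Finset.mul_sum]
        ring
    _ = (∑ i : Fin 3, ∫ y, (regGreenSlope k s (y - x) + (((y - x) i : ℝ) : ℂ) ^ 2
          * regGreenCurv k s (y - x)) * (ψ y : ℂ))
          + ∫ y, (k ^ 2 * regGreen k s (y - x)) * (ψ y : ℂ) := by
        rw [integral_add (integrable_finsetSum _ fun i _ =>
          hi _ c0 _ ((hψ.partialDeriv i).partialDeriv i)) (hi _ c3 ψ hψ),
          integral_finsetSum _ fun i _ => hi _ c0 _ ((hψ.partialDeriv i).partialDeriv i)]
        simp only [h2]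
    _ = ∫ y, (∑ i : Fin 3, (regGreenSlope k s (y - x) + (((y - x) i : ℝ) : ℂ) ^ 2
          * regGreenCurv k s (y - x)) * (ψ y : ℂ)
          + (k ^ 2 * regGreen k s (y - x)) * (ψ y : ℂ)) := by
        rw [integral_add (integrable_finsetSum _ fun i _ => hi _ (c2 i) ψ hψ)
          (hi _ c3 ψ hψ), integral_finsetSum _ fun i _ => hi _ (c2 i) ψ hψ]
    _ = _ := by
        refine integral_congr_ae (ae_of_all _ fun y => ?_)
        simp only
        rw [← sum_regGreen_second_deriv k hs (y - x), ← Finset.sum_mul, add_mul]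

end Fundamental

/-! ### The Green function as a fundamental solution -/

section FundamentalLimit

open Real

/-- An explicit antiderivative for the radial integral that fixes the mass of the limiting point
source. -/
theorem hasDerivAt_div_sqrt_cube (y : ℝ) :
    HasDerivAt (fun y : ℝ => (y / √(y ^ 2 + 1)) ^ 3 / 3) (y ^ 2 * (√(y ^ 2 + 1) ^ 5)⁻¹) y := by
  have h1 : HasDerivAt (fun y : ℝ => √(y ^ 2 + 1)) _ y :=
    (((hasDerivAt_id y).pow 2).add_const 1).sqrt (by simp; positivity)
  have h0 : √(y ^ 2 + 1) ≠ 0 := by positivity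
  refine ((((hasDerivAt_id y).div h1 h0).pow 3).div_const 3).congr_deriv ?_
  have h2 : √(y ^ 2 + 1) ^ 2 = y ^ 2 + 1 := Real.sq_sqrt (by positivity)
  simp only [id, Pi.pow_apply, Pi.div_apply]
  clear h1
  generalize √(y ^ 2 + 1) = q at h0 h2 ⊢
  norm_num
  field_simp
  linear_combination y ^ 2 * h2

theorem integral_Ioi_sq_mul_sqrt_inv :
    ∫ y in Set.Ioi (0 : ℝ), y ^ 2 * (√(y ^ 2 + 1) ^ 5)⁻¹ = 1 / 3 := by
  have hlim : Tendsto (fun y : ℝ => (y / √(y ^ 2 + 1)) ^ 3 / 3) atTop (𝓝 (1 ^ 3 / 3)) := by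
    refine Tendsto.div_const (Tendsto.pow ?_ 3) 3
    have h1 : Tendsto (fun y : ℝ => (√(1 + (y⁻¹) ^ 2))⁻¹) atTop (𝓝 (√(1 + 0 ^ 2))⁻¹) := by
      refine Tendsto.inv₀ ?_ (by simp)
      exact (continuous_sqrt.tendsto _).comp
        (tendsto_const_nhds.add (tendsto_inv_atTop_zero.pow 2))
    simp only [ne_eq, OfNat.ofNat_ne_zero, not_false_eq_true, zero_pow, add_zero, sqrt_one,
      inv_one] at h1
    refine h1.congr' ?_
    filter_upwards [eventually_gt_atTop 0] with y hy
    have : y ^ 2 + 1 = y ^ 2 * (1 + (y⁻¹) ^ 2) := by field_simp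
    rw [this, Real.sqrt_mul (by positivity), Real.sqrt_sq hy.le]
    field_simp
  rw [integral_Ioi_of_hasDerivAt_of_nonneg' (fun y _ => hasDerivAt_div_sqrt_cube y)
    (fun y _ => by positivity) hlim]
  simp

/-- Multiplied by the coefficient 3/(4π) of the rescaled defect, this value makes the point source
have mass one. -/
theorem integral_regNorm_one_pow_inv : ∫ w : Space3, (regNorm 1 w ^ 5)⁻¹ = 4 * π / 3 := by
  have h := integral_fun_norm_addHaar (volume : Measure Space3)
    (fun y : ℝ => (√(y ^ 2 + 1) ^ 5)⁻¹)
  have h2 : (fun w : Space3 => (regNorm 1 w ^ 5)⁻¹) = fun w => (√(‖w‖ ^ 2 + 1) ^ 5)⁻¹ := by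
    funext w; simp [regNorm]
  rw [h2, h]
  have h3 : volume.real (Metric.ball (0 : Space3) 1) = π * 4 / 3 := by
    rw [Measure.real, EuclideanSpace.volume_ball_fin_three]
    simp
    positivity
  rw [h3]
  simp only [finrank_euclideanSpace, Fintype.card_fin, Nat.add_one_sub_one, smul_eq_mul,
    integral_Ioi_sq_mul_sqrt_inv, nsmul_eq_mul]
  push_cast
  ring

theorem integrable_regNorm_one_pow_inv : Integrable fun w : Space3 => (regNorm 1 w ^ 5)⁻¹ := by
  by_contra h
  have := integral_undef h
  rw [integral_regNorm_one_pow_inv] at this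
  have := pi_pos
  linarith

theorem continuous_helmholtz {D : Set Space3} {ψ : Space3 → ℝ} (hψ : IsTestFun D ψ) (k : ℂ) :
    Continuous (helmholtz k ψ) := by
  unfold helmholtz
  have h1 := Complex.continuous_ofReal.comp hψ.1.continuous
  have h2 (i : Fin 3) :=
    Complex.continuous_ofReal.comp ((hψ.partialDeriv i).partialDeriv i).1.continuous
  exact (continuous_finsetSum _ fun i _ => h2 i).add (continuous_const.mul h1)

theorem helmholtz_eq_zero {D : Set Space3} {ψ : Space3 → ℝ} (hψ : IsTestFun D ψ) (k : ℂ)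
    {y : Space3} (hy : y ∉ D) : helmholtz k ψ y = 0 := by
  unfold helmholtz
  simp [hψ.eq_zero hy, ((hψ.partialDeriv _).partialDeriv _).eq_zero hy]

theorem memLp_helmholtz {D : Set Space3} {ψ : Space3 → ℝ} (hψ : IsTestFun D ψ) (k : ℂ) :
    MemLp (helmholtz k ψ) 2 (volume.restrict D) := by
  unfold helmholtz
  exact (memLp_finsetSum _ fun i _ => ((hψ.partialDeriv i).partialDeriv i).memLp).add
    (hψ.memLp.const_mul _)

theorem norm_exp_I_mul_le (k : ℂ) {r R : ℝ} (hr : 0 ≤ r) (hR : r ≤ R) :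
    ‖Complex.exp (Complex.I * k * (r : ℂ))‖ ≤ rexp (‖k‖ * R) := by
  refine (Complex.norm_exp_le_exp_norm _).trans (exp_le_exp.2 ?_)
  simp only [norm_mul, Complex.norm_I, one_mul, Complex.norm_real, norm_of_nonneg hr]
  gcongr

theorem le_regNorm (s : ℝ) (z : Space3) : ‖z‖ ≤ regNorm s z :=
  Real.le_sqrt_of_sq_le (by nlinarith [sq_nonneg s])

theorem regNorm_le {s : ℝ} (hs : 0 ≤ s) (z : Space3) : regNorm s z ≤ ‖z‖ + s := by
  refine Real.sqrt_le_iff.2 ⟨by positivity, ?_⟩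
  nlinarith [norm_nonneg z, mul_nonneg (norm_nonneg z) hs]

theorem regNorm_smul {s : ℝ} (hs : 0 ≤ s) (w : Space3) : regNorm s (s • w) = s * regNorm 1 w := by
  unfold regNorm
  rw [norm_smul, Real.norm_of_nonneg hs,
    show (s * ‖w‖) ^ 2 + s ^ 2 = s ^ 2 * (‖w‖ ^ 2 + 1 ^ 2) by ring,
    Real.sqrt_mul (by positivity), Real.sqrt_sq hs]

theorem regNorm_zero (z : Space3) : regNorm 0 z = ‖z‖ := by simp [regNorm]

theorem continuous_regNorm_param (z : Space3) : Continuous fun s => regNorm s z := by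
  unfold regNorm; fun_prop

/-- Regularisation only increases the denominator, so on bounded sets the integrands are dominated
by a constant times the Newtonian kernel. -/
theorem tendsto_integral_regGreen {D : Set Space3} (hDb : Bornology.IsBounded D)
    {ψ : Space3 → ℝ} (hψ : IsTestFun D ψ) (k : ℂ) (x : Space3) {s : ℕ → ℝ}
    (hs : ∀ n, 0 < s n) (hs1 : ∀ n, s n ≤ 1) (hs0 : Tendsto s atTop (𝓝 0)) :
    Tendsto (fun n => ∫ y in D, regGreen k (s n) (y - x) * helmholtz k ψ y) atTop
      (𝓝 (∫ y in D, greenFun k (x - y) * helmholtz k ψ y)) := by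
  obtain ⟨R, hR⟩ := hDb.subset_ball x
  have hD : volume D ≠ ⊤ := hDb.measure_lt_top.ne
  have hne : ∀ᵐ y ∂volume.restrict D, y ≠ x := ae_restrict_of_ae (Measure.ae_ne volume x)
  refine tendsto_integral_of_dominated_convergence
    (fun y => rexp (‖k‖ * (R + 1)) * (‖greenFun 0 (x - y)‖ * ‖helmholtz k ψ y‖))
    (fun n => (((continuous_regGreen k (hs n)).comp (by fun_prop)).mul
      (continuous_helmholtz hψ k)).aestronglyMeasurable) ?_ (fun n => ?_) ?_
  · exact (((memLp_greenFun hD x).norm).integrable_mul ((memLp_helmholtz hψ k).norm)).const_mul _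
  · filter_upwards [hne] with y hyx
    by_cases hy : y ∈ D
    swap
    · simp [helmholtz_eq_zero hψ k hy]
    rw [norm_mul, ← mul_assoc]
    gcongr
    have hyR : ‖y - x‖ ≤ R := by simpa [dist_eq_norm] using (hR hy).le
    have hb := norm_exp_I_mul_le k (regNorm_pos (hs n) (y - x)).le
      ((regNorm_le (hs n).le (y - x)).trans (add_le_add hyR (hs1 n)))
    rw [norm_greenFun_zero_freq, regGreen, norm_div, div_eq_mul_inv, norm_sub_rev x y]
    have h0 := norm_pos_iff.2 (sub_ne_zero.2 hyx)
    have h1 := le_regNorm (s n) (y - x)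
    gcongr
    simp only [norm_mul, Complex.norm_real, Complex.norm_ofNat, norm_of_nonneg pi_nonneg]
    gcongr
    exact h1.trans (le_abs_self _)
  · filter_upwards [hne] with y hy
    refine Tendsto.mul_const _ ?_
    have h1 := ((continuous_regNorm_param (y - x)).tendsto 0).comp hs0
    rw [regNorm_zero] at h1
    have h2 := (Complex.continuous_ofReal.tendsto _).comp h1
    rw [← greenFun_neg, neg_sub, greenFun]
    refine Tendsto.div ?_ (tendsto_const_nhds.mul h2) ?_
    · exact (Complex.continuous_exp.tendsto _).comp (tendsto_const_nhds.mul h2)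
    · simpa [pi_ne_zero, sub_eq_zero] using hy

/-- Under y = x + s w the defect turns into a fixed integrable profile times a bounded factor and
ψ(x + s w), and it concentrates at x as s → 0. -/
theorem tendsto_integral_regGreenCurv {D : Set Space3} 
    {ψ : Space3 → ℝ} (hψ : IsTestFun D ψ) (k : ℂ) (x : Space3) {s : ℕ → ℝ}
    (hs : ∀ n, 0 < s n) (hs1 : ∀ n, s n ≤ 1) (hs0 : Tendsto s atTop (𝓝 0)) :
    Tendsto (fun n => ∫ y, (-(s n : ℂ) ^ 2 * regGreenCurv k (s n) (y - x)) * (ψ y : ℂ)) atTop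
      (𝓝 (-(ψ x : ℂ))) := by
  have hscale (n : ℕ) : ∫ y, (-(s n : ℂ) ^ 2 * regGreenCurv k (s n) (y - x)) * (ψ y : ℂ)
      = ∫ w, Complex.exp (Complex.I * k * ((s n * regNorm 1 w : ℝ) : ℂ)) / (4 * (π : ℂ))
        * (k ^ 2 * (s n * regNorm 1 w : ℝ) ^ 2 + 3 * Complex.I * k * (s n * regNorm 1 w : ℝ) - 3)
        * ((regNorm 1 w ^ 5)⁻¹ : ℝ) * (ψ (s n • w + x) : ℂ) := by
    rw [← integral_add_right_eq_self _ x]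
    have h := Measure.integral_comp_smul (volume : Measure Space3) (fun z =>
      (-(s n : ℂ) ^ 2 * regGreenCurv k (s n) (z + x - x)) * (ψ (z + x) : ℂ)) (s n)
    have hn := hs n
    rw [finrank_euclideanSpace, Fintype.card_fin, abs_of_pos (by positivity),
      eq_inv_smul_iff₀ (by positivity)] at h
    rw [← h, ← integral_smul]
    refine integral_congr_ae (ae_of_all _ fun w => ?_)
    have h1 := (regNorm_pos one_pos w).ne'
    simp only [add_sub_cancel_right, regGreenCurv, regNorm_smul hn.le, Complex.real_smul]
    have h1' : (regNorm 1 w : ℂ) ≠ 0 := Complex.ofReal_ne_zero.2 h1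
    have h2' : (s n : ℂ) ≠ 0 := Complex.ofReal_ne_zero.2 hn.ne'
    have hπ : (π : ℂ) ≠ 0 := Complex.ofReal_ne_zero.2 pi_ne_zero
    push_cast
    field_simp
    ring
  simp_rw [hscale]
  obtain ⟨C, hC⟩ := hψ.2.1.exists_bound_of_continuous hψ.1.continuous
  obtain ⟨R, hR⟩ := hψ.2.1.isCompact.isBounded.subset_ball x
  have hR0 : 0 ≤ |R| + 1 := by positivity
  have hlim : -(ψ x : ℂ) = ∫ w, Complex.exp (Complex.I * k * ((0 : ℝ) : ℂ)) / (4 * (π : ℂ))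
        * (k ^ 2 * ((0 : ℝ) : ℂ) ^ 2 + 3 * Complex.I * k * ((0 : ℝ) : ℂ) - 3)
        * ((regNorm 1 w ^ 5)⁻¹ : ℝ) * (ψ x : ℂ) := by
    have hπ : (π : ℂ) ≠ 0 := Complex.ofReal_ne_zero.2 pi_ne_zero
    rw [integral_mul_const, integral_const_mul, integral_complex_ofReal,
      integral_regNorm_one_pow_inv]
    simp
    field_simp
  rw [hlim]
  refine tendsto_integral_of_dominated_convergence
    (fun w => rexp (‖k‖ * (|R| + 1)) * (‖k‖ ^ 2 * (|R| + 1) ^ 2 + 3 * ‖k‖ * (|R| + 1) + 3) * C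
      * (regNorm 1 w ^ 5)⁻¹)
    (fun n => ?_) (integrable_regNorm_one_pow_inv.const_mul _) (fun n => ae_of_all _ fun w => ?_)
    (ae_of_all _ fun w => ?_)
  · have hc := continuous_regNorm (s := 1)
    have hc' : Continuous fun w => (regNorm 1 w ^ 5)⁻¹ :=
      (hc.pow 5).inv₀ fun w => (pow_pos (regNorm_pos one_pos w) 5).ne'
    have hc'' := hψ.1.continuous
    exact Continuous.aestronglyMeasurable (by fun_prop)
  · have hn := hs n
    have hσ := regNorm_pos one_pos w
    by_cases hw : ψ (s n • w + x) = 0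
    · have hC0 : 0 ≤ C := (norm_nonneg _).trans (hC x)
      simp only [hw, Complex.ofReal_zero, mul_zero, norm_zero]
      positivity
    -- Where ψ does not vanish, s w is confined to a fixed ball; this bounds the exponential and the
    -- polynomial factors uniformly in n.
    have hw' : ‖s n • w‖ ≤ |R| := by
      have := hR (subset_tsupport ψ hw)
      simp only [Metric.mem_ball, dist_eq_norm, add_sub_cancel_right] at this
      exact this.le.trans (le_abs_self _)
    have hsσ : s n * regNorm 1 w ≤ |R| + 1 := by
      rw [← regNorm_smul hn.le]
      exact (regNorm_le hn.le _).trans (add_le_add hw' (hs1 n))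
    have hsσ0 : 0 ≤ s n * regNorm 1 w := by positivity
    have hb := norm_exp_I_mul_le k hsσ0 hsσ
    generalize s n * regNorm 1 w = ρ at *
    rw [norm_mul, norm_mul, norm_mul, norm_div, Complex.norm_real, Complex.norm_real,
      norm_of_nonneg (show 0 ≤ (regNorm 1 w ^ 5)⁻¹ by positivity)]
    have h1 : ‖Complex.exp (Complex.I * k * (ρ : ℂ))‖ / ‖(4 * (π : ℂ))‖
        ≤ rexp (‖k‖ * (|R| + 1)) := by
      refine (div_le_self (norm_nonneg _) ?_).trans hb
      simp only [norm_mul, Complex.norm_real, Complex.norm_ofNat, norm_of_nonneg pi_nonneg]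
      nlinarith [pi_gt_three]
    have h2 : ‖k ^ 2 * (ρ : ℂ) ^ 2 + 3 * Complex.I * k * (ρ : ℂ) - 3‖
        ≤ ‖k‖ ^ 2 * (|R| + 1) ^ 2 + 3 * ‖k‖ * (|R| + 1) + 3 := by
      refine (norm_sub_le _ _).trans (add_le_add ((norm_add_le _ _).trans (add_le_add ?_ ?_)) ?_)
      · simp only [norm_mul, norm_pow, Complex.norm_real, norm_of_nonneg hsσ0]
        gcongr
      · simp only [norm_mul, Complex.norm_ofNat, Complex.norm_I, mul_one, Complex.norm_real,
          norm_of_nonneg hsσ0]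
        gcongr
      · simp
    calc _ ≤ rexp (‖k‖ * (|R| + 1)) * (‖k‖ ^ 2 * (|R| + 1) ^ 2 + 3 * ‖k‖ * (|R| + 1) + 3)
          * (regNorm 1 w ^ 5)⁻¹ * C := by
          gcongr
          exact hC _
      _ = _ := by ring
  · have hc'' := hψ.1.continuous
    have hF : Continuous fun t : ℝ => Complex.exp (Complex.I * k * ((t * regNorm 1 w : ℝ) : ℂ))
        / (4 * (π : ℂ))
        * (k ^ 2 * (t * regNorm 1 w : ℝ) ^ 2 + 3 * Complex.I * k * (t * regNorm 1 w : ℝ) - 3)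
        * ((regNorm 1 w ^ 5)⁻¹ : ℝ) * (ψ (t • w + x) : ℂ) := by fun_prop
    have h := (hF.tendsto 0).comp hs0
    simp only [zero_mul, zero_smul, zero_add] at h
    exact h

/-- Both sides are limits of the same regularised integral, rewritten by
`integral_regGreen_mul_helmholtz`. -/
theorem integral_greenFun_mul_helmholtz {D : Set Space3} (hDb : Bornology.IsBounded D)
    {ψ : Space3 → ℝ} (hψ : IsTestFun D ψ) (k : ℂ) (x : Space3) :
    ∫ y in D, greenFun k (x - y) * helmholtz k ψ y = -(ψ x : ℂ) := by
  let s (n : ℕ) : ℝ := 1 / ((n : ℝ) + 1)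
  have hs (n : ℕ) : 0 < s n := by positivity
  have hs1 (n : ℕ) : s n ≤ 1 := by
    refine div_le_one_of_le₀ ?_ (by positivity)
    simp
  have hs0 : Tendsto s atTop (𝓝 0) := tendsto_one_div_add_atTop_nhds_zero_nat
  refine tendsto_nhds_unique (tendsto_integral_regGreen hDb hψ k x hs hs1 hs0) ?_
  refine (tendsto_integral_regGreenCurv hψ k x hs hs1 hs0).congr fun n => ?_
  rw [← integral_regGreen_mul_helmholtz hψ k (hs n) x]
  refine (setIntegral_eq_integral_of_forall_compl_eq_zero fun y hy => ?_).symm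
  simp [helmholtz_eq_zero hψ k hy]

end FundamentalLimit

/-! ### Recovering the source from an H² state -/

section SourceRecovery

variable {D : Set Space3}

theorem norm_greenFun_le (k : ℂ) {z : Space3} {R : ℝ} (hR : ‖z‖ ≤ R) :
    ‖greenFun k z‖ ≤ Real.exp (‖k‖ * R) * ‖greenFun 0 z‖ := by
  rw [norm_greenFun_zero_freq, greenFun, norm_div, div_eq_mul_inv]
  refine mul_le_mul (norm_exp_I_mul_le k (norm_nonneg z) hR) (le_of_eq ?_) (by positivity)
    (by positivity)
  simp [abs_of_pos Real.pi_pos]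

theorem norm_greenFun_inv_le (k : ℂ) {z : Space3} {R : ℝ} (hR : ‖z‖ ≤ R) :
    ‖(greenFun k z)⁻¹‖ ≤ 4 * Real.pi * R * Real.exp (‖k‖ * R) := by
  have h : (greenFun k z)⁻¹ = (4 * (Real.pi : ℂ) * (‖z‖ : ℂ))
      * Complex.exp (Complex.I * (-k) * (‖z‖ : ℂ)) := by
    rw [greenFun, inv_div, div_eq_mul_inv, ← Complex.exp_neg]
    congr 2
    ring
  have h0 : 0 ≤ R := (norm_nonneg z).trans hR
  rw [h, norm_mul]
  refine mul_le_mul ?_ ?_ (norm_nonneg _) (by positivity [Real.pi_pos])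
  · simp only [norm_mul, Complex.norm_ofNat, Complex.norm_real, norm_norm,
      Real.norm_of_nonneg Real.pi_nonneg]
    gcongr
  · simpa using norm_exp_I_mul_le (-k) (norm_nonneg z) hR

theorem ae_mem_mem (hDo : IsOpen D) :
    ∀ᵐ p ∂(volume.restrict D).prod (volume.restrict D), p.1 ∈ D ∧ p.2 ∈ D := by
  rw [Measure.prod_restrict]
  exact ae_restrict_mem (hDo.measurableSet.prod hDo.measurableSet)

theorem exists_norm_sub_le (hDb : Bornology.IsBounded D) :
    ∃ R : ℝ, 0 ≤ R ∧ ∀ x ∈ D, ∀ y ∈ D, ‖x - y‖ ≤ R :=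
  ⟨Metric.diam D, Metric.diam_nonneg, fun x hx y hy => by
    rw [← dist_eq_norm]; exact Metric.dist_le_diam_of_mem hDb hx hy⟩

theorem integrable_prod_greenFun_freq (hDo : IsOpen D) (hDb : Bornology.IsBounded D) (k : ℂ)
    {f g : Space3 → ℂ} (hf : Integrable f (volume.restrict D))
    (hg : MemLp g 2 (volume.restrict D)) :
    Integrable (fun p : Space3 × Space3 => f p.1 * (greenFun k (p.1 - p.2) * g p.2))
      ((volume.restrict D).prod (volume.restrict D)) := by
  have hD : volume D ≠ ⊤ := hDb.measure_lt_top.ne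
  obtain ⟨R, -, hR⟩ := exists_norm_sub_le hDb
  have hG : Measurable fun p : Space3 × Space3 => greenFun k (p.1 - p.2) :=
    (measurable_greenFun k).comp (by fun_prop)
  refine ((integrable_prod_greenFun hD hf hg).norm.const_mul (Real.exp (‖k‖ * R))).mono'
    (hf.1.comp_fst.mul (hG.aestronglyMeasurable.mul hg.1.comp_snd)) ?_
  filter_upwards [ae_mem_mem hDo] with p hp
  simp only [norm_mul]
  have := norm_greenFun_le k (hR _ hp.1 _ hp.2)
  calc ‖f p.1‖ * (‖greenFun k (p.1 - p.2)‖ * ‖g p.2‖)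
      ≤ ‖f p.1‖ * ((Real.exp (‖k‖ * R) * ‖greenFun 0 (p.1 - p.2)‖) * ‖g p.2‖) := by gcongr
    _ = _ := by ring

/-- Fubini transfers the Helmholtz operator to the kernel, which is even. Integrability of g
suffices, so the identity applies to sources not yet known to be in L². -/
theorem integral_volumePotential_mul_helmholtz (hDo : IsOpen D) (hDb : Bornology.IsBounded D)
    (k : ℂ) {g : Space3 → ℂ} (hg : Integrable g (volume.restrict D)) {ψ : Space3 → ℝ}
    (hψ : IsTestFun D ψ) :
    ∫ x in D, volumePotential D k g x * helmholtz k ψ x = -∫ x in D, g x * (ψ x : ℂ) := by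
  have hi := integrable_prod_greenFun_freq hDo hDb k hg (memLp_helmholtz hψ k)
  have h1 := integral_integral_swap
    (f := fun x y => g x * (greenFun k (x - y) * helmholtz k ψ y)) hi
  have h2 (x : Space3) : ∫ y in D, g x * (greenFun k (x - y) * helmholtz k ψ y)
      = -(g x * (ψ x : ℂ)) := by
    rw [integral_const_mul, integral_greenFun_mul_helmholtz hDb hψ k x, mul_neg]
  simp only [h2, integral_neg] at h1
  rw [h1]
  refine integral_congr_ae (ae_of_all _ fun y => ?_)
  simp only [volumePotential]
  rw [← integral_mul_const]
  refine integral_congr_ae (ae_of_all _ fun x => ?_)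
  simp only
  rw [← neg_sub, greenFun_neg]
  ring

/-- A vanishing potential has a vanishing distributional Laplacian, which is minus the source. -/
theorem newtonL2_injective (hDo : IsOpen D) (hDb : Bornology.IsBounded D) (hD : volume D ≠ ⊤) :
    Function.Injective (newtonL2 hD) := by
  rw [injective_iff_map_eq_zero]
  intro f hf
  have : IsFiniteMeasure (volume.restrict D) := ⟨by simpa using hD.lt_top⟩
  have hfi : Integrable f (volume.restrict D) := (Lp.memLp f).integrable (by norm_num)
  have h0 : newtonPotential D f =ᵐ[volume.restrict D] 0 := by
    refine (coeFn_newtonL2 hD f).symm.trans ?_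
    rw [hf]
    exact Lp.coeFn_zero _ _ _
  apply Lp.ext
  refine EventuallyEq.trans ?_ (Lp.coeFn_zero _ _ _).symm
  refine ae_eq_zero_of_forall_isTestFun hDo hfi fun ψ hψ => ?_
  rw [← neg_eq_zero, ← integral_volumePotential_mul_helmholtz hDo hDb 0 hfi hψ]
  refine integral_eq_zero_of_ae ?_
  filter_upwards [h0] with x hx
  change newtonPotential D f x * _ = 0
  simp [hx]

/-- The distribution `Δu + k²u` for `u ∈ H²(D)`. -/
def H2.helmholtz (k : ℂ) (u : H2 D) : L2 D :=
  ∑ i : Fin 3, H2.comp (.inr (.inr (i, i))) u + k ^ 2 • toL2 u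

theorem H2.norm_helmholtz_le (k : ℂ) (u : H2 D) : ‖H2.helmholtz k u‖ ≤ (3 + ‖k‖ ^ 2) * ‖u‖ := by
  unfold H2.helmholtz
  refine (norm_add_le _ _).trans ?_
  rw [add_mul]
  refine add_le_add ((norm_sum_le_of_le _ fun i _ => H2.norm_comp_le _ u).trans (by simp)) ?_
  rw [norm_smul, norm_pow]
  exact mul_le_mul_of_nonneg_left (H2.norm_comp_le (.inl ()) u) (by positivity)

theorem integral_toL2_mul_helmholtz (k : ℂ) (u : H2 D) {ψ : Space3 → ℝ} (hψ : IsTestFun D ψ) :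
    ∫ x in D, toL2 u x * helmholtz k ψ x = ∫ x in D, H2.helmholtz k u x * (ψ x : ℂ) := by
  have h2 (i : Fin 3) : ∫ x in D, toL2 u x * (partialDeriv i (partialDeriv i ψ) x : ℂ)
      = ∫ x in D, H2.comp (.inr (.inr (i, i))) u x * (ψ x : ℂ) := by
    have e1 := u.2.1 i _ (hψ.partialDeriv i)
    have e2 := u.2.2 i i _ hψ
    exact e1.trans (by rw [e2, neg_neg]; rfl)
  have i2 (i : Fin 3) := (Lp.memLp (toL2 u)).integrable_mul
    ((hψ.partialDeriv i).partialDeriv i).memLp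
  have i0 := (Lp.memLp (toL2 u)).integrable_mul (hψ.memLp.const_mul (k ^ 2))
  have i01 := (i2 0).add (i2 1)
  have i012 := i01.add (i2 2)
  simp only [Pi.mul_def, Pi.add_def] at i2 i0 i01 i012
  simp only [helmholtz, H2.helmholtz, Fin.sum_univ_three, mul_add]
  rw [setIntegral_L2_add_mul _ _ hψ.memLp, setIntegral_L2_add_mul _ _ hψ.memLp,
    setIntegral_L2_add_mul _ _ hψ.memLp, setIntegral_L2_smul_mul,
    integral_add i012 i0, integral_add i01 (i2 2),
    integral_add (i2 0) (i2 1), h2, h2, h2, ← integral_const_mul]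
  congr 1
  refine integral_congr_ae (ae_of_all _ fun x => ?_)
  simp only
  ring

/-- Test both sides of the equation with (Δ + k²)ψ: the potential returns −g, while the derivatives
can be moved onto u ∈ H²(D). A merely integrable source is thereby seen to be in L². -/
theorem ae_eq_of_toL2_eq_volumePotential (hDo : IsOpen D) (hDb : Bornology.IsBounded D) {k ω : ℂ}
    (hω : ω ≠ 0) {u : H2 D} {g : Space3 → ℂ} (hg : Integrable g (volume.restrict D))
    (h : ∀ᵐ x ∂volume.restrict D, toL2 u x = ω ^ 2 * volumePotential D k g x) :
    g =ᵐ[volume.restrict D] (-(ω ^ 2)⁻¹ • H2.helmholtz k u : L2 D) := by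
  have : IsFiniteMeasure (volume.restrict D) := ⟨by simpa using hDb.measure_lt_top⟩
  set F : L2 D := -(ω ^ 2)⁻¹ • H2.helmholtz k u with hF
  have hFi : Integrable F (volume.restrict D) := (Lp.memLp F).integrable (by norm_num)
  have hψb {ψ : Space3 → ℝ} (hψ : IsTestFun D ψ) {f : Space3 → ℂ}
      (hf : Integrable f (volume.restrict D)) :
      Integrable (fun x => f x * (ψ x : ℂ)) (volume.restrict D) := by
    obtain ⟨C, hC⟩ := hψ.2.1.exists_bound_of_continuous hψ.1.continuous
    exact hf.mul_bdd (c := C) (Complex.continuous_ofReal.comp hψ.1.continuous).aestronglyMeasurable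
      (ae_of_all _ fun x => by simpa using hC x)
  have h0 := ae_eq_zero_of_forall_isTestFun hDo (g := fun x => g x - F x) (hg.sub hFi)
    fun ψ hψ => ?_
  · filter_upwards [h0] with x hx
    exact sub_eq_zero.1 hx
  · simp only [sub_mul]
    rw [integral_sub (hψb hψ hg) (hψb hψ hFi), sub_eq_zero, hF, setIntegral_L2_smul_mul,
      ← integral_toL2_mul_helmholtz k u hψ]
    have e : ∫ x in D, toL2 u x * helmholtz k ψ x
        = ω ^ 2 * ∫ x in D, volumePotential D k g x * helmholtz k ψ x := by
      rw [← integral_const_mul]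
      refine integral_congr_ae ?_
      filter_upwards [h] with x hx
      rw [hx, mul_assoc]
    rw [e, integral_volumePotential_mul_helmholtz hDo hDb k hg hψ]
    field_simp

/-- The reciprocal of the kernel is bounded on a bounded set, so integrability of kernel times g
would force that of g; a divergent integral is zero by convention. -/
theorem volumePotential_eq_zero_of_not_integrable (hDb : Bornology.IsBounded D) (hDo : IsOpen D)
    (k : ℂ) {g : Space3 → ℂ} (hg : ¬ Integrable g (volume.restrict D)) {x : Space3} (hx : x ∈ D) :
    volumePotential D k g x = 0 := by
  refine integral_undef fun h => hg ?_
  obtain ⟨R, -, hR⟩ := exists_norm_sub_le hDb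
  have h1 : Integrable (fun y => (greenFun k (x - y))⁻¹ * (greenFun k (x - y) * g y))
      (volume.restrict D) := by
    refine h.bdd_mul (c := 4 * Real.pi * R * Real.exp (‖k‖ * R))
      ((measurable_greenFun k).comp (by fun_prop)).inv.aestronglyMeasurable ?_
    filter_upwards [ae_restrict_mem hDo.measurableSet] with y hy
    exact norm_greenFun_inv_le k (hR x hx y hy)
  refine h1.congr ?_
  filter_upwards [ae_restrict_of_ae (Measure.ae_ne volume x)] with y hy
  refine inv_mul_cancel_left₀ ?_ _
  simp [greenFun, Real.pi_ne_zero, sub_eq_zero, hy.symm]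

theorem kerr_zero : kerr 0 = 0 := by simp [kerr]

theorem SolvesScaledLS.exists_source (hDo : IsOpen D) (hDb : Bornology.IsBounded D) {ε : ℝ} {ω : ℂ}
    (hω : ω ≠ 0) {u : H2 D} (h : SolvesScaledLS ε ω u) :
    ∃ g : L2 D, g =ᵐ[volume.restrict D] (fun x => kerr (toL2 u x)) ∧
      ‖g‖ ≤ (‖ω‖ ^ 2)⁻¹ * ((3 + (|ε| * ‖ω‖) ^ 2) * ‖u‖) := by
  have hg : Integrable (fun x => kerr (toL2 u x)) (volume.restrict D) := by
    -- If the source were not integrable, its potential would be zero on D by convention; then u and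
    -- the source would vanish almost everywhere, a contradiction.
    by_contra hg
    refine hg ((integrable_zero _ ℂ _).congr ?_)
    filter_upwards [h, ae_restrict_mem hDo.measurableSet] with x hx hxD
    rw [volumePotential_eq_zero_of_not_integrable hDb hDo _ hg hxD, mul_zero] at hx
    simp [hx, kerr_zero]
  refine ⟨_, (ae_eq_of_toL2_eq_volumePotential hDo hDb hω hg h).symm, ?_⟩
  rw [norm_smul, norm_neg, norm_inv, norm_pow]
  gcongr
  refine (H2.norm_helmholtz_le _ u).trans ?_
  simp

end SourceRecovery

/-! ### Power series of the Green function in the frequency -/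

theorem greenFun_eq_exp_mul (k : ℂ) (z : Space3) :
    greenFun k z = Complex.exp (Complex.I * k * (‖z‖ : ℂ)) * greenFun 0 z := by
  simp [greenFun, div_eq_mul_inv]

theorem hasSum_greenFun (k : ℂ) (z : Space3) :
    HasSum (fun n : ℕ => ((Complex.I * k) ^ n / (n.factorial : ℂ)) * ((‖z‖ : ℂ) ^ n * greenFun 0 z))
      (greenFun k z) := by
  have e : greenFun k z = NormedSpace.exp (Complex.I * k * (‖z‖ : ℂ)) * greenFun 0 z := by
    rw [greenFun_eq_exp_mul, Complex.exp_eq_exp_ℂ]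
  rw [e]
  have h := (NormedSpace.expSeries_div_hasSum_exp (Complex.I * k * (‖z‖ : ℂ))).mul_right
    (greenFun 0 z)
  refine h.congr_fun fun n => ?_
  rw [mul_pow]
  ring

theorem hasSum_integral_greenFun {D : Set Space3} (hDb : Bornology.IsBounded D) (hDo : IsOpen D)
    (k : ℂ) (f : L2 D)
    {x : Space3} (hx : x ∈ D) :
    HasSum (fun n : ℕ => ((Complex.I * k) ^ n / (n.factorial : ℂ))
      * ∫ y in D, ((‖x - y‖ : ℂ) ^ n * greenFun 0 (x - y)) * f y) (volumePotential D k f x) := by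
  obtain ⟨R, hR0, hR⟩ := exists_norm_sub_le hDb
  have hD : volume D ≠ ⊤ := hDb.measure_lt_top.ne
  have hi := (integrable_greenFun_mul hD f x).norm
  have hs (y : Space3) : HasSum (fun n : ℕ => (‖k‖ * R) ^ n / (n.factorial : ℝ)
      * ‖greenFun 0 (x - y) * f y‖) (Real.exp (‖k‖ * R) * ‖greenFun 0 (x - y) * f y‖) := by
    rw [Real.exp_eq_exp_ℝ]
    exact (NormedSpace.expSeries_div_hasSum_exp (‖k‖ * R)).mul_right _
  simp_rw [← integral_const_mul]
  refine hasSum_integral_of_dominated_convergence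
    (fun n y => (‖k‖ * R) ^ n / (n.factorial : ℝ) * ‖greenFun 0 (x - y) * f y‖) (fun n => ?_)
    (fun n => ?_) (ae_of_all _ fun y => (hs y).summable) ?_ (ae_of_all _ fun y => ?_)
  · have h1 : AEStronglyMeasurable (fun y => greenFun 0 (x - y)) (volume.restrict D) :=
      (memLp_greenFun hD x).1
    have h2 : AEStronglyMeasurable (fun y : Space3 => (‖x - y‖ : ℂ) ^ n) (volume.restrict D) :=
      Continuous.aestronglyMeasurable (by fun_prop)
    exact ((h2.mul h1).mul (Lp.aestronglyMeasurable f)).const_mul _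
  · filter_upwards [ae_restrict_mem hDo.measurableSet] with y hy
    simp only [norm_mul, norm_div, norm_pow, Complex.norm_I, one_mul, Complex.norm_natCast,
      Complex.norm_real, norm_norm]
    have := hR x hx y hy
    calc _ ≤ ‖k‖ ^ n / (n.factorial : ℝ) * (R ^ n * ‖greenFun 0 (x - y)‖ * ‖f y‖) := by gcongr
      _ = _ := by rw [mul_pow]; ring
  · simp_rw [(hs _).tsum_eq]
    exact hi.const_mul _
  · have := (hasSum_greenFun k (x - y)).mul_right (f y)
    simpa only [mul_assoc] using this

/-! ### The volume potential as an entire family of operators into H²(D) ∩ L^∞(D) -/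

section ConvolutionKernels

variable {D : Set Space3} [IsFiniteMeasure (volume.restrict D)]

/-- `A` is the integral operator on `D` with the convolution kernel `a`. -/
def HasConvKernel (A : L2 D →L[ℂ] H2Inf D) (a : Space3 → ℂ) : Prop :=
  (∀ x ∈ D, MemLp (fun y => a (x - y)) 2 (volume.restrict D)) ∧
    ∀ f : L2 D, H2Inf.incl D (A f) =ᵐ[volume.restrict D] fun x => ∫ y in D, a (x - y) * f y

theorem HasConvKernel.congr {A : L2 D →L[ℂ] H2Inf D} {a b : Space3 → ℂ} (h : HasConvKernel A a)
    (hab : ∀ z ≠ 0, a z = b z) : HasConvKernel A b := by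
  have e (x : Space3) : (fun y => a (x - y)) =ᵐ[volume.restrict D] fun y => b (x - y) := by
    filter_upwards [ae_restrict_of_ae (Measure.ae_ne volume x)] with y hy
    exact hab _ (sub_ne_zero.2 hy.symm)
  refine ⟨fun x hx => (memLp_congr_ae (e x)).1 (h.1 x hx), fun f => (h.2 f).trans ?_⟩
  refine ae_of_all _ fun x => integral_congr_ae ?_
  filter_upwards [e x] with y hy
  rw [hy]

theorem HasConvKernel.integrable {A : L2 D →L[ℂ] H2Inf D} {a : Space3 → ℂ} (h : HasConvKernel A a)
    {x : Space3} (hx : x ∈ D) (f : L2 D) :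
    Integrable (fun y => a (x - y) * f y) (volume.restrict D) :=
  (h.1 x hx).integrable_mul (Lp.memLp f)

theorem HasConvKernel.add (hDo : IsOpen D) {A B : L2 D →L[ℂ] H2Inf D} {a b : Space3 → ℂ}
    (hA : HasConvKernel A a)
    (hB : HasConvKernel B b) : HasConvKernel (A + B) (fun z => a z + b z) := by
  refine ⟨fun x hx => (hA.1 x hx).add (hB.1 x hx), fun f => ?_⟩
  rw [add_apply, map_add]
  filter_upwards [Lp.coeFn_add (H2Inf.incl D (A f)) (H2Inf.incl D (B f)), hA.2 f, hB.2 f,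
    ae_restrict_mem hDo.measurableSet] with x h1 h2 h3 hx
  rw [h1, Pi.add_apply, h2, h3, ← integral_add (hA.integrable hx f)
    (hB.integrable hx f)]
  simp only [add_mul]

/-- Multiplying by xᵢ after A and by yᵢ before it changes the kernel by the factor xᵢ − yᵢ. The
mapping property into H²(D) ∩ L^∞(D) is preserved without differentiating any new kernel. -/
theorem HasConvKernel.commutator (hDb : Bornology.IsBounded D) (hDo : IsOpen D)
    {M : H2Inf D →L[ℂ] H2Inf D} {i : Fin 3}
    (hM : H2Inf.incl D ∘L M = mulL2 (coordLInf hDb hDo i) ∘L H2Inf.incl D)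
    {A : L2 D →L[ℂ] H2Inf D} {a : Space3 → ℂ} (hA : HasConvKernel A a) :
    HasConvKernel (M ∘L A - A ∘L mulL2 (coordLInf hDb hDo i)) (fun z => ((z i : ℝ) : ℂ) * a z) := by
  obtain ⟨R, hR0, hR⟩ := exists_norm_sub_le hDb
  constructor
  · intro x hx
    refine (hA.1 x hx).of_le_mul (c := R) (Continuous.aestronglyMeasurable (by fun_prop) |>.mul
      (hA.1 x hx).1) ?_
    filter_upwards [ae_restrict_mem hDo.measurableSet] with y hy
    rw [norm_mul, Complex.norm_real]
    gcongr
    exact (PiLp.norm_apply_le _ _).trans (hR x hx y hy)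
  · intro f
    have h1 := DFunLike.congr_fun hM (A f)
    simp only [ContinuousLinearMap.comp_apply] at h1
    rw [sub_apply, map_sub, ContinuousLinearMap.comp_apply, h1,
      ContinuousLinearMap.comp_apply]
    filter_upwards [Lp.coeFn_sub (mulL2 (coordLInf hDb hDo i) (H2Inf.incl D (A f)))
      (H2Inf.incl D (A (mulL2 (coordLInf hDb hDo i) f))), coeFn_mulL2_coord hDb hDo i
      (H2Inf.incl D (A f)), hA.2 f, hA.2 (mulL2 (coordLInf hDb hDo i) f),
      ae_restrict_mem hDo.measurableSet] with x e1 e2 e3 e4 hx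
    rw [e1, Pi.sub_apply, e2, e3, e4, ← integral_const_mul, ← integral_sub
      ((hA.integrable hx f).const_mul _) (hA.integrable hx _)]
    refine integral_congr_ae ?_
    filter_upwards [coeFn_mulL2_coord hDb hDo i f] with y hy
    simp only [hy, PiLp.sub_apply]
    push_cast
    ring

/-- The commutator `A ↦ M A - A m`, as a bounded operator. -/
def commL (M : H2Inf D →L[ℂ] H2Inf D) (m : L2 D →L[ℂ] L2 D) :
    (L2 D →L[ℂ] H2Inf D) →L[ℂ] (L2 D →L[ℂ] H2Inf D) :=
  ContinuousLinearMap.compL ℂ (L2 D) (H2Inf D) (H2Inf D) M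
    - (ContinuousLinearMap.compL ℂ (L2 D) (L2 D) (H2Inf D)).flip m

theorem exists_clm_distSq (hDb : Bornology.IsBounded D) (hDo : IsOpen D) :
    ∃ S : (L2 D →L[ℂ] H2Inf D) →L[ℂ] (L2 D →L[ℂ] H2Inf D), ∀ A a, HasConvKernel A a →
      HasConvKernel (S A) (fun z => (‖z‖ : ℂ) ^ 2 * a z) := by
  choose M hM using fun i => exists_mulCoord hDb hDo i
  let L (i : Fin 3) := commL (M i) (mulL2 (coordLInf hDb hDo i))
  refine ⟨L 0 ∘L L 0 + L 1 ∘L L 1 + L 2 ∘L L 2, fun A a hA => ?_⟩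
  have h (i : Fin 3) := (hA.commutator hDb hDo (hM i)).commutator hDb hDo (hM i)
  refine ((((h 0).add hDo (h 1)).add hDo (h 2)).congr fun z _ => ?_)
  rw [← Complex.ofReal_pow, EuclideanSpace.norm_sq_eq, Fin.sum_univ_three]
  simp only [Real.norm_eq_abs, sq_abs]
  push_cast
  ring

/-- A rank-one operator with range the constants. Its kernel is |z| times the Newtonian one, the
seed for the odd powers. -/
theorem exists_clm_const : ∃ J : L2 D →L[ℂ] H2Inf D,
    HasConvKernel J (fun _ => ((4 * Real.pi : ℝ)⁻¹ : ℂ)) := by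
  obtain ⟨u, hu⟩ := exists_incl_eq_one (D := D)
  have m : MemLp (fun _ : Space3 => ((4 * Real.pi : ℝ)⁻¹ : ℂ)) 2 (volume.restrict D) :=
    memLp_const _
  refine ⟨(innerSL ℂ m.star.toLp).smulRight u, fun x _ => m, fun f => ?_⟩
  rw [ContinuousLinearMap.smulRight_apply, map_smul, hu, innerSL_apply_apply,
    ← integral_mul_eq_inner m f]
  filter_upwards [Lp.coeFn_smul (∫ y in D, ((4 * Real.pi : ℝ)⁻¹ : ℂ) * f y) (oneL2 D),
    coeFn_oneL2 (D := D)] with x h1 h2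
  rw [h1, Pi.smul_apply, h2, smul_eq_mul, mul_one]

/-- Each application of S raises the power of |z| by two, so the even powers start from the
Newtonian operator T and the odd ones from J. -/
theorem exists_clm_distPow (hDb : Bornology.IsBounded D) (hDo : IsOpen D) :
    ∃ (B : ℕ → L2 D →L[ℂ] H2Inf D) (C r : ℝ), 0 ≤ r ∧ ∀ n, ‖B n‖ ≤ C * r ^ n ∧
      HasConvKernel (B n) (fun z => (‖z‖ : ℂ) ^ n * greenFun 0 z) := by
  have hD : volume D ≠ ⊤ := hDb.measure_lt_top.ne
  obtain ⟨S, hS⟩ := exists_clm_distSq hDb hDo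
  obtain ⟨T, hT⟩ := exists_newtonH2Inf hDo hD
  obtain ⟨J, hJ⟩ := exists_clm_const (D := D)
  have hT' : HasConvKernel T (greenFun 0) := by
    refine ⟨fun x _ => memLp_greenFun hD x, fun f => ?_⟩
    rw [← ContinuousLinearMap.comp_apply, hT]
    exact coeFn_newtonL2 hD f
  obtain ⟨B, h0, h1, h2⟩ : ∃ B : ℕ → L2 D →L[ℂ] H2Inf D, B 0 = T ∧ B 1 = J ∧
      ∀ n, B (n + 2) = S (B n) := by
    refine ⟨fun n => (S ^ (n / 2)) (if n % 2 = 0 then T else J), by simp, by simp, fun n => ?_⟩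
    simp only [Nat.add_mod_right, Nat.add_div_right n two_pos, pow_succ']
    rfl
  -- The added 1 makes the ratio at least one, as the case n = 1 requires.
  refine ⟨B, max ‖T‖ ‖J‖, ‖S‖ + 1, by positivity, fun n => ⟨?_, ?_⟩⟩
  · induction n using Nat.twoStepInduction with
    | zero => simp [h0]
    | one =>
      rw [h1, pow_one]
      exact (le_max_right ‖T‖ ‖J‖).trans (le_mul_of_one_le_right (by positivity)
        (le_add_of_nonneg_left (norm_nonneg S)))
    | more n ih _ =>
      rw [h2, pow_add]
      calc ‖S (B n)‖ ≤ ‖S‖ * ‖B n‖ := S.le_opNorm _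
        _ ≤ (‖S‖ + 1) ^ 2 * (max ‖T‖ ‖J‖ * (‖S‖ + 1) ^ n) :=
          mul_le_mul (by nlinarith [norm_nonneg S]) ih (norm_nonneg _) (by positivity)
        _ = _ := by ring
  · induction n using Nat.twoStepInduction with
    | zero => simpa [h0] using hT'
    | one =>
      rw [h1]
      refine hJ.congr fun z hz => ?_
      have : (‖z‖ : ℂ) ≠ 0 := by simpa using hz
      have hπ : (Real.pi : ℂ) ≠ 0 := Complex.ofReal_ne_zero.2 Real.pi_ne_zero
      simp only [greenFun_zero_freq]
      push_cast
      field_simp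
    | more n ih _ =>
      rw [h2]
      refine (hS _ _ ih).congr fun z _ => ?_
      ring

/-- The operators with kernels |z|ⁿ/(4π|z|) grow geometrically and are divided by n!, so the series
converges normally on every ball of frequencies; its sum is holomorphic, hence C¹. -/
theorem exists_volumePotential_clm (hDb : Bornology.IsBounded D) (hDo : IsOpen D) :
    ∃ V : ℂ → L2 D →L[ℂ] H2Inf D, ContDiff ℂ 1 V ∧
      ∀ k f, H2Inf.incl D (V k f) =ᵐ[volume.restrict D] volumePotential D k f := by
  obtain ⟨B, C, r, hr, hB⟩ := exists_clm_distPow hDb hDo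
  let F (n : ℕ) (k : ℂ) : L2 D →L[ℂ] H2Inf D := ((Complex.I * k) ^ n / (n.factorial : ℂ)) • B n
  have hF (n : ℕ) (k : ℂ) (ρ : ℝ) (hk : ‖k‖ ≤ ρ) :
      ‖F n k‖ ≤ C * ((ρ * r) ^ n / (n.factorial : ℝ)) := by
    have hC : 0 ≤ C * r ^ n := (norm_nonneg _).trans (hB n).1
    simp only [F, norm_smul, norm_div, norm_pow, norm_mul, Complex.norm_I, one_mul,
      Complex.norm_natCast]
    calc ‖k‖ ^ n / (n.factorial : ℝ) * ‖B n‖ ≤ ρ ^ n / (n.factorial : ℝ) * (C * r ^ n) := by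
          have := (norm_nonneg k).trans hk
          gcongr
          exact (hB n).1
      _ = _ := by rw [mul_pow]; ring
  have hS (ρ : ℝ) : Summable fun n : ℕ => C * ((ρ * r) ^ n / (n.factorial : ℝ)) :=
    (Real.summable_pow_div_factorial (ρ * r)).mul_left C
  refine ⟨fun k => ∑' n, F n k, ?_, fun k f => ?_⟩
  · refine Differentiable.contDiff fun k => ?_
    refine (Complex.differentiableOn_tsum_of_summable_norm (U := Metric.ball 0 (‖k‖ + 1))
      (hS (‖k‖ + 1))
      (fun n => ?_) Metric.isOpen_ball fun n w hw => hF n w _ ?_).differentiableAt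
      (Metric.isOpen_ball.mem_nhds (by simp))
    · exact Differentiable.differentiableOn (by fun_prop)
    · exact (mem_ball_zero_iff.1 hw).le
  · have hs : Summable fun n => ‖F n k‖ :=
      (hS ‖k‖).of_nonneg_of_le (fun _ => norm_nonneg _) fun n => hF n k _ le_rfl
    have e1 : H2Inf.incl D ((∑' n, F n k) f) = ∑' n, H2Inf.incl D (F n k f) := by
      have h1 := (hs.of_norm.hasSum.mapL (ContinuousLinearMap.apply ℂ (H2Inf D) f)).mapL
        (H2Inf.incl D)
      exact h1.tsum_eq.symm
    have hfin : ∑' n, ‖H2Inf.incl D (F n k f)‖ₑ ≠ ⊤ := by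
      rw [tsum_enorm_ne_top_iff_summable_norm]
      refine (hs.mul_right (‖H2Inf.incl D‖ * ‖f‖)).of_nonneg_of_le (fun _ => norm_nonneg _)
        fun n => ?_
      calc _ ≤ ‖H2Inf.incl D‖ * (‖F n k‖ * ‖f‖) :=
            (H2Inf.incl D).le_opNorm_of_le ((F n k).le_opNorm f)
        _ = _ := by ring
    rw [e1]
    -- Absolute convergence in L² gives almost everywhere convergence, so the operator series is
    -- identified term by term with the pointwise expansion of the potential.
    filter_upwards [Lp.hasSum_coeFn_tsum hfin, ae_all_iff.2 fun n => (hB n).2.2 f,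
      ae_all_iff.2 fun n => Lp.coeFn_smul ((Complex.I * k) ^ n / (n.factorial : ℂ))
        (H2Inf.incl D (B n f)), ae_restrict_mem hDo.measurableSet] with x h1 h2 h3 hx
    refine h1.unique ((hasSum_integral_greenFun hDb hDo k f hx).congr_fun fun n => ?_)
    simp only [F, smul_apply, map_smul]
    rw [h3, Pi.smul_apply, h2, smul_eq_mul]

end ConvolutionKernels

/-! ### Abstract bifurcation from a simple eigenvalue -/

section Bifurcation

variable {H Y : Type*} [NormedAddCommGroup H] [InnerProductSpace ℂ H]
  [NormedAddCommGroup Y] [NormedSpace ℂ Y]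

/-- `1 - λ⁻¹ K + ⟨φ, ·⟩ φ`, which is invertible when `φ` spans the eigenspace of `K` at `λ`. -/
def shiftedOp (K : H →L[ℂ] H) (lam : ℂ) (φ : H) : H →L[ℂ] H :=
  1 - (lam⁻¹ • K - (innerSL ℂ φ).smulRight φ)

theorem shiftedOp_apply (K : H →L[ℂ] H) (lam : ℂ) (φ f : H) :
    shiftedOp K lam φ f = f - lam⁻¹ • K f + inner ℂ φ f • φ := by
  simp only [shiftedOp, sub_apply, smul_apply, ContinuousLinearMap.smulRight_apply,
    innerSL_apply_apply, one_apply_eq_self]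
  abel

/-- The operator is the identity minus a compact one, so injectivity suffices. Pairing a kernel
element with φ shows it orthogonal to φ; it is then an eigenvector for λ, hence a multiple of φ,
hence zero. -/
theorem isUnit_shiftedOp [CompleteSpace H] {K : H →L[ℂ] H} (hK : IsCompactOperator K) {lam : ℂ}
    (hlam : lam ≠ 0) {φ : H} (hφ : ‖φ‖ = 1) (hKφ : ∀ f, inner ℂ φ (K f) = lam * inner ℂ φ f)
    (hsimple : ∀ f, K f = lam • f → ∃ c : ℂ, f = c • φ) : IsUnit (shiftedOp K lam φ) := by
  have hφφ : inner ℂ φ φ = (1 : ℂ) := by rw [inner_self_eq_norm_sq_to_K, hφ]; simp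
  have hP : IsCompactOperator ((innerSL ℂ φ).smulRight φ) := by
    have h1 : IsCompactOperator (ContinuousLinearMap.id ℂ ℂ) := isCompactOperator_id
    exact (h1.comp_clm (innerSL ℂ φ)).clm_comp
      (ContinuousLinearMap.smulRight (ContinuousLinearMap.id ℂ ℂ) φ)
  have hT : IsCompactOperator (lam⁻¹ • K - (innerSL ℂ φ).smulRight φ : H →L[ℂ] H) :=
    (hK.smul lam⁻¹).sub hP
  rcases hT.hasEigenvalue_or_mem_resolventSet one_ne_zero with h | h
  · obtain ⟨f, hf⟩ := h.exists_hasEigenvector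
    have h1 : lam⁻¹ • K f - inner ℂ φ f • φ = f := by simpa using hf.apply_eq_smul
    have h2 : inner ℂ φ f = 0 := by
      have := congrArg (inner ℂ φ) h1
      rw [inner_sub_right, inner_smul_right, inner_smul_right, hKφ, hφφ, mul_one,
        inv_mul_cancel_left₀ hlam, sub_self] at this
      exact this.symm
    rw [h2, zero_smul, sub_zero, inv_smul_eq_iff₀ hlam] at h1
    obtain ⟨c, hc⟩ := hsimple f h1
    rw [hc, inner_smul_right, hφφ, mul_one] at h2
    exact absurd (by rw [hc, h2, zero_smul]) hf.2
  · simpa [resolventSet, shiftedOp] using h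

variable (V : ℂ → H →L[ℂ] Y) (j : Y →L[ℂ] H) (N : Y → H) (φ : H)

/-- The state `ω² V(εω) g` generated by the source `g`. -/
def sourceState (ε : ℝ) (ω : ℂ) (g : H) : Y := ω ^ 2 • V ((ε : ℂ) * ω) g

theorem sourceState_smul {V : ℂ → H →L[ℂ] Y} (ε : ℝ) (ω c : ℂ) (g : H) :
    sourceState V ε ω (c • g) = c • sourceState V ε ω g := by
  simp only [sourceState, map_smul]
  exact smul_comm _ _ _

/-- The normalised scaled equation, as a function of the parameters `(a, ε)` and of the unknown
source and frequency. -/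
def branchMap (q : (ℝ × ℝ) × (H × ℂ)) : H × ℂ :=
  (q.2.1 - j (sourceState V q.1.2 q.2.2 q.2.1)
      - ((q.1.1 : ℂ) ^ 2) • N (sourceState V q.1.2 q.2.2 q.2.1),
    inner ℂ φ (j (sourceState V q.1.2 q.2.2 q.2.1)) - 1)

variable [NormedSpace ℝ H] [NormedSpace ℝ Y] [IsScalarTower ℝ ℂ Y]

variable {V j N φ}

/-- The hypotheses of the local analysis near a simple eigenvalue `λ` of `K = j ∘ V(0)`. -/
structure SimpleBifurcation (V : ℂ → H →L[ℂ] Y) (j : Y →L[ℂ] H) (N : Y → H) (φ : H)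
    (lam ω₀ : ℂ) : Prop where
  contDiff_family : ContDiff ℝ 1 V
  contDiff_cubic : ContDiff ℝ 1 N
  cubic_smul : ∀ (c : ℂ) (y : Y), N (c • y) = ((‖c‖ : ℂ) ^ 2 * c) • N y
  cubic_bound : ∃ C, ∀ y, ‖N y‖ ≤ C * ‖y‖ ^ 3
  compact : IsCompactOperator (j ∘L V 0)
  eigenvalue_ne_zero : lam ≠ 0
  frequency : ω₀ ^ 2 * lam = 1
  norm_eigenvector : ‖φ‖ = 1
  eigenvector : j (V 0 φ) = lam • φ
  inner_apply : ∀ f, inner ℂ φ (j (V 0 f)) = lam * inner ℂ φ f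
  simple : ∀ f, j (V 0 f) = lam • f → ∃ c : ℂ, f = c • φ

variable {lam ω₀ : ℂ}

theorem SimpleBifurcation.inner_self (S : SimpleBifurcation V j N φ lam ω₀) :
    inner ℂ φ φ = (1 : ℂ) := by
  rw [inner_self_eq_norm_sq_to_K, S.norm_eigenvector]; simp

theorem SimpleBifurcation.frequency_ne_zero (S : SimpleBifurcation V j N φ lam ω₀) : ω₀ ≠ 0 := by
  rintro rfl
  simpa using S.frequency

theorem SimpleBifurcation.frequency_sq (S : SimpleBifurcation V j N φ lam ω₀) :
    ω₀ ^ 2 = lam⁻¹ := eq_inv_of_mul_eq_one_left S.frequency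

theorem SimpleBifurcation.shiftedOp_self (S : SimpleBifurcation V j N φ lam ω₀) :
    shiftedOp (j ∘L V 0) lam φ φ = φ := by
  rw [shiftedOp_apply, ContinuousLinearMap.comp_apply, S.eigenvector,
    inv_smul_smul₀ S.eigenvalue_ne_zero, S.inner_self, one_smul, sub_self, zero_add]

theorem SimpleBifurcation.isUnit_shiftedOp [CompleteSpace H]
    (S : SimpleBifurcation V j N φ lam ω₀) : IsUnit (shiftedOp (j ∘L V 0) lam φ) :=
  _root_.isUnit_shiftedOp S.compact S.eigenvalue_ne_zero S.norm_eigenvector S.inner_apply S.simple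

theorem SimpleBifurcation.hasFDerivAt_branchMap (S : SimpleBifurcation V j N φ lam ω₀) :
    ∃ L : H × ℂ →L[ℂ] H × ℂ, HasFDerivAt (fun q => branchMap V j N φ (0, q)) L (φ, ω₀) ∧
      ∀ q, L q = (q.1 - lam⁻¹ • j (V 0 q.1) - (2 * ω₀ * lam * q.2) • φ,
        inner ℂ φ q.1 + 2 * ω₀ * lam * q.2) := by
  -- At a = ε = 0 the cubic term drops out and the family is frozen at V(0), so the derivative is
  -- explicit and ℂ-linear.
  have e (q : H × ℂ) : branchMap V j N φ (0, q)
      = (q.1 - q.2 ^ 2 • j (V 0 q.1), inner ℂ φ (q.2 ^ 2 • j (V 0 q.1)) - 1) := by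
    simp [branchMap, sourceState]
  have h1 : HasFDerivAt (fun q : H × ℂ => q.1) (ContinuousLinearMap.fst ℂ H ℂ) (φ, ω₀) :=
    hasFDerivAt_fst
  have h2 : HasFDerivAt (fun q : H × ℂ => q.2) (ContinuousLinearMap.snd ℂ H ℂ) (φ, ω₀) :=
    hasFDerivAt_snd
  have h3 := (h2.pow 2).smul ((j ∘L V 0).hasFDerivAt.comp _ h1)
  have h4 := (h1.sub h3).prodMk (((innerSL ℂ φ).hasFDerivAt.comp _ h3).sub_const 1)
  refine ⟨_, h4.congr_of_eventuallyEq (Eventually.of_forall e), fun q => ?_⟩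
  have hc : ω₀ ^ 2 * lam = 1 := S.frequency
  ext1
  · simp [S.eigenvector, S.frequency_sq, smul_smul]
    module
  · simp [S.eigenvector, S.inner_apply, S.norm_eigenvector]
    linear_combination inner ℂ φ q.1 * hc

/-- Adding φ times the second component to the first eliminates the frequency and leaves
`shiftedOp`; the frequency is then read off from the second component, where its coefficient 2ω₀λ is
nonzero. -/
theorem SimpleBifurcation.bijective_of_formula [CompleteSpace H]
    (S : SimpleBifurcation V j N φ lam ω₀) {L : H × ℂ → H × ℂ}
    (hL : ∀ q, L q = (q.1 - lam⁻¹ • j (V 0 q.1) - (2 * ω₀ * lam * q.2) • φ,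
        inner ℂ φ q.1 + 2 * ω₀ * lam * q.2)) : Function.Bijective L := by
  have hc : 2 * ω₀ * lam ≠ 0 :=
    mul_ne_zero (mul_ne_zero two_ne_zero S.frequency_ne_zero) S.eigenvalue_ne_zero
  obtain ⟨hinj, hsurj⟩ := ContinuousLinearMap.isUnit_iff_bijective.1 S.isUnit_shiftedOp
  have hadd (q : H × ℂ) : (L q).1 + (L q).2 • φ = shiftedOp (j ∘L V 0) lam φ q.1 := by
    rw [hL, shiftedOp_apply, ContinuousLinearMap.comp_apply]
    module
  constructor
  · intro p q hpq
    have h1 : p.1 = q.1 := hinj (by rw [← hadd, ← hadd, hpq])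
    have h2 : (L p).2 = (L q).2 := by rw [hpq]
    rw [hL, hL, h1] at h2
    exact Prod.ext h1 (mul_left_cancel₀ hc (add_left_cancel h2))
  · rintro ⟨α, β⟩
    obtain ⟨g, hg⟩ := hsurj (α + β • φ)
    refine ⟨(g, (2 * ω₀ * lam)⁻¹ * (β - inner ℂ φ g)), ?_⟩
    have h2 : (L (g, (2 * ω₀ * lam)⁻¹ * (β - inner ℂ φ g))).2 = β := by
      rw [hL]
      simp only
      rw [mul_inv_cancel_left₀ hc]
      ring
    have h1 := hadd (g, (2 * ω₀ * lam)⁻¹ * (β - inner ℂ φ g))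
    rw [h2, hg] at h1
    exact Prod.ext (add_right_cancel h1) h2

/-- `shiftedOp` fixes φ, and applied to g − bφ it produces only the perturbation of ω₀²V(0) and
cubic terms. Both are o(1)‖g‖ near (0, ω₀, 0), and inverting the operator preserves this. -/
theorem SimpleBifurcation.eventually_norm_sub_le [CompleteSpace H]
    (S : SimpleBifurcation V j N φ lam ω₀) {η : ℝ} (hη : 0 < η) :
    ∀ᶠ q in 𝓝 ((0 : ℝ), ω₀, (0 : H)),
      q.2.2 = j (sourceState V q.1 q.2.1 q.2.2) + N (sourceState V q.1 q.2.1 q.2.2) →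
      ‖q.2.2 - inner ℂ φ (j (sourceState V q.1 q.2.1 q.2.2)) • φ‖ ≤ η * ‖q.2.2‖ := by
  obtain ⟨R, hR⟩ : ∃ R : H →L[ℂ] H, R * shiftedOp (j ∘L V 0) lam φ = 1 :=
    S.isUnit_shiftedOp.exists_left_inv
  obtain ⟨C, hC⟩ := S.cubic_bound
  let A (q : ℝ × ℂ × H) : H →L[ℂ] Y := q.2.1 ^ 2 • V ((q.1 : ℂ) * q.2.1)
  have hA : Continuous A := by
    have h1 : Continuous fun q : ℝ × ℂ × H => (q.1 : ℂ) * q.2.1 := by fun_prop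
    have h2 : Continuous fun q : ℝ × ℂ × H => q.2.1 ^ 2 := by fun_prop
    exact h2.smul (S.contDiff_family.continuous.comp h1)
  let B (q : ℝ × ℂ × H) : ℝ :=
    ‖R‖ * (‖j‖ * ‖A q - ω₀ ^ 2 • V 0‖ + 2 * (|C| * (‖A q‖ ^ 3 * ‖q.2.2‖ ^ 2)))
  have hB : Continuous B := by fun_prop
  have hB0 : B (0, ω₀, 0) = 0 := by simp [B, A]
  filter_upwards [(hB.tendsto _).eventually (gt_mem_nhds (hB0.trans_lt hη))] with q hq h
  obtain ⟨ε, ω, g⟩ := q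
  simp only at h ⊢
  set y := sourceState V ε ω g with hy
  set b : ℂ := inner ℂ φ (j y) with hb
  have hyA : y = A (ε, ω, g) g := rfl
  have hN : ‖N y‖ ≤ |C| * (‖A (ε, ω, g)‖ ^ 3 * ‖g‖ ^ 2) * ‖g‖ := by
    have h1 : ‖y‖ ≤ ‖A (ε, ω, g)‖ * ‖g‖ := (A (ε, ω, g)).le_opNorm g
    calc ‖N y‖ ≤ |C| * ‖y‖ ^ 3 := (hC y).trans (by gcongr; exact le_abs_self C)
      _ ≤ |C| * (‖A (ε, ω, g)‖ * ‖g‖) ^ 3 := by gcongr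
      _ = _ := by ring
  have hj : ‖j y - lam⁻¹ • j (V 0 g)‖ ≤ ‖j‖ * ‖A (ε, ω, g) - ω₀ ^ 2 • V 0‖ * ‖g‖ := by
    have : j y - lam⁻¹ • j (V 0 g) = j ((A (ε, ω, g) - ω₀ ^ 2 • V 0) g) := by
      have h0 : (ω₀ ^ 2 • V 0) g = lam⁻¹ • V 0 g := by rw [S.frequency_sq]; rfl
      rw [sub_apply, map_sub, hyA, h0, map_smul]
    rw [this, mul_assoc]
    exact j.le_opNorm_of_le (ContinuousLinearMap.le_opNorm _ g)
  have hS : shiftedOp (j ∘L V 0) lam φ (g - b • φ)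
      = (j y - lam⁻¹ • j (V 0 g)) + (N y + inner ℂ φ (N y) • φ) := by
    have hin : inner ℂ φ g = b + inner ℂ φ (N y) := by
      nth_rewrite 1 [h]
      rw [inner_add_right]
    rw [map_sub, map_smul, S.shiftedOp_self, shiftedOp_apply, ContinuousLinearMap.comp_apply, hin]
    nth_rewrite 1 [h]
    module
  have hR' : g - b • φ = R (shiftedOp (j ∘L V 0) lam φ (g - b • φ)) :=
    (DFunLike.congr_fun hR (g - b • φ)).symm
  rw [hR', hS]
  have hNφ : ‖inner ℂ φ (N y) • φ‖ ≤ ‖N y‖ := by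
    rw [norm_smul, S.norm_eigenvector, mul_one]
    simpa [S.norm_eigenvector] using norm_inner_le_norm (𝕜 := ℂ) φ (N y)
  calc _ ≤ ‖R‖ * (‖j‖ * ‖A (ε, ω, g) - ω₀ ^ 2 • V 0‖ * ‖g‖
        + (|C| * (‖A (ε, ω, g)‖ ^ 3 * ‖g‖ ^ 2) * ‖g‖
          + |C| * (‖A (ε, ω, g)‖ ^ 3 * ‖g‖ ^ 2) * ‖g‖)) := by
        refine R.le_opNorm_of_le ((norm_add_le _ _).trans (add_le_add hj ?_))
        exact (norm_add_le _ _).trans (add_le_add hN (hNφ.trans hN))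
    _ = B (ε, ω, g) * ‖g‖ := by simp only [B]; ring
    _ ≤ η * ‖g‖ := by gcongr

theorem SimpleBifurcation.eventually_eq_branch [CompleteSpace H]
    (S : SimpleBifurcation V j N φ lam ω₀) {G : ℝ × ℝ → H × ℂ}
    (hG : ∀ᶠ q in 𝓝 (0, (φ, ω₀)), branchMap V j N φ q = 0 → G q.1 = q.2) :
    ∃ ρ > 0, ∀ (a ε : ℝ) (ω : ℂ) (g : H), |a| < ρ → |ε| < ρ → ‖ω - ω₀‖ < ρ → ‖g‖ < ρ →
      g = j (sourceState V ε ω g) + N (sourceState V ε ω g) →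
      ‖inner ℂ φ (j (sourceState V ε ω g))‖ = |a| →
      g = inner ℂ φ (j (sourceState V ε ω g)) • (G (a, ε)).1 ∧ (a ≠ 0 → ω = (G (a, ε)).2) := by
  obtain ⟨ρ₁, hρ₁, h₁⟩ := Metric.eventually_nhds_iff.1 hG
  obtain ⟨ρ₂, hρ₂, h₂⟩ := Metric.eventually_nhds_iff.1
    -- The bound 1/2 gives ‖g‖ ≤ 2‖b‖; with it, ρ₁/4 places g/b within ρ₁/2 of φ.
    (S.eventually_norm_sub_le (η := min (1 / 2) (ρ₁ / 4)) (by positivity))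
  refine ⟨min ρ₁ ρ₂, by positivity, fun a ε ω g ha hε hω hg heq hnorm => ?_⟩
  have h := h₂ (y := (ε, ω, g)) (by
    simp only [Prod.dist_eq, max_lt_iff]
    simp only [dist_eq_norm, sub_zero, Real.norm_eq_abs]
    exact ⟨hε.trans_le (min_le_right _ _), hω.trans_le (min_le_right _ _),
      hg.trans_le (min_le_right _ _)⟩) heq
  simp only at h
  set y := sourceState V ε ω g with hy
  set b : ℂ := inner ℂ φ (j y) with hb
  have hg2 : ‖g‖ ≤ 2 * ‖b‖ := by
    have h3 : ‖g‖ ≤ ‖g - b • φ‖ + ‖b • φ‖ := by simpa using norm_add_le (g - b • φ) (b • φ)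
    rw [norm_smul, S.norm_eigenvector, mul_one] at h3
    have h4 : min (1 / 2) (ρ₁ / 4) * ‖g‖ ≤ 1 / 2 * ‖g‖ := by gcongr; exact min_le_left _ _
    linarith
  rcases eq_or_ne b 0 with hb0 | hb0
  · have hg0 : g = 0 := by simpa [hb0] using hg2
    have ha0 : a = 0 := by simpa [hb0, eq_comm] using hnorm
    exact ⟨by rw [hg0, hb0, zero_smul], fun h => absurd ha0 h⟩
  have hy' : sourceState V ε ω (b⁻¹ • g) = b⁻¹ • y := by
    rw [hy, sourceState_smul]
  -- Rescaling by b leaves the factor |b|² on the cubic term, and |b|² = a²; the phase of b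
  -- disappears, so the real parameter a is enough.
  have hzero : branchMap V j N φ ((a, ε), (b⁻¹ • g, ω)) = 0 := by
    simp only [branchMap, hy', map_smul, inner_smul_right]
    rw [← hb, inv_mul_cancel₀ hb0, sub_self, S.cubic_smul]
    refine Prod.ext ?_ rfl
    have ha2 : (a : ℂ) ^ 2 = (‖b‖ : ℂ) ^ 2 := by
      rw [hnorm, ← Complex.ofReal_pow, ← Complex.ofReal_pow, sq_abs]
    have hbn : (‖b‖ : ℂ) ≠ 0 := by simpa using hb0
    simp only [Prod.fst_zero, ha2, smul_smul, norm_inv, Complex.ofReal_inv]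
    nth_rewrite 1 [heq]
    have : (‖b‖ : ℂ) ^ 2 * ((‖b‖ : ℂ)⁻¹ ^ 2 * b⁻¹) = b⁻¹ := by field_simp
    rw [this]
    module
  have hres := h₁ (y := ((a, ε), (b⁻¹ • g, ω))) (by
    have h5 : ‖b⁻¹ • g - φ‖ < ρ₁ := by
      have : b⁻¹ • g - φ = b⁻¹ • (g - b • φ) := by rw [smul_sub, inv_smul_smul₀ hb0]
      rw [this, norm_smul, norm_inv]
      have hbp : 0 < ‖b‖ := norm_pos_iff.2 hb0
      calc ‖b‖⁻¹ * ‖g - b • φ‖ ≤ ‖b‖⁻¹ * (ρ₁ / 4 * (2 * ‖b‖)) := by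
            gcongr
            refine h.trans ?_
            gcongr
            exact min_le_right _ _
        _ = ρ₁ / 2 := by field_simp; ring
        _ < ρ₁ := half_lt_self hρ₁
    simp only [Prod.dist_eq, max_lt_iff]
    simp only [dist_eq_norm, Prod.fst_zero, Prod.snd_zero, sub_zero, Real.norm_eq_abs]
    exact ⟨⟨ha.trans_le (min_le_left _ _), hε.trans_le (min_le_left _ _)⟩, h5,
      hω.trans_le (min_le_left _ _)⟩) hzero
  simp only at hres
  rw [hres]
  exact ⟨(smul_inv_smul₀ hb0 g).symm, fun _ => rfl⟩

variable [IsScalarTower ℝ ℂ H]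

theorem contDiff_sourceState (hV : ContDiff ℝ 1 V) :
    ContDiff ℝ 1 fun q : (ℝ × ℝ) × (H × ℂ) => sourceState V q.1.2 q.2.2 q.2.1 := by
  unfold sourceState
  have hω : ContDiff ℝ 1 fun q : (ℝ × ℝ) × (H × ℂ) => q.2.2 := by fun_prop
  have hε : ContDiff ℝ 1 fun q : (ℝ × ℝ) × (H × ℂ) => (q.1.2 : ℂ) :=
    Complex.ofRealCLM.contDiff.comp (by fun_prop)
  have h1 := (ContinuousLinearMap.restrictScalarsL ℂ H Y ℝ ℝ).contDiff.comp
    (hV.comp (hε.mul hω))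
  have h2 : ContDiff ℝ 1 fun q : (ℝ × ℝ) × (H × ℂ) => V ((q.1.2 : ℂ) * q.2.2) q.2.1 :=
    h1.clm_apply (by fun_prop)
  exact (hω.pow 2).smul h2

theorem contDiff_branchMap (hV : ContDiff ℝ 1 V) (hN : ContDiff ℝ 1 N) :
    ContDiff ℝ 1 (branchMap V j N φ) := by
  have hy := contDiff_sourceState hV
  have hj := (j.restrictScalars ℝ).contDiff.comp hy
  have hφ := ((innerSL ℂ φ).restrictScalars ℝ).contDiff.comp hj
  have ha : ContDiff ℝ 1 fun q : (ℝ × ℝ) × (H × ℂ) => (q.1.1 : ℂ) :=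
    Complex.ofRealCLM.contDiff.comp (by fun_prop)
  have hg : ContDiff ℝ 1 fun q : (ℝ × ℝ) × (H × ℂ) => q.2.1 := by fun_prop
  exact ((hg.sub hj).sub ((ha.pow 2).smul (hN.comp hy))).prodMk (hφ.sub contDiff_const)

theorem SimpleBifurcation.exists_branch [CompleteSpace H]
    (S : SimpleBifurcation V j N φ lam ω₀) :
    ∃ G : ℝ × ℝ → H × ℂ, ContDiffAt ℝ 1 G 0 ∧ G 0 = (φ, ω₀) ∧
      (∀ᶠ p in 𝓝 0, branchMap V j N φ (p, G p) = 0) ∧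
      ∀ᶠ q in 𝓝 (0, (φ, ω₀)), branchMap V j N φ q = 0 → G q.1 = q.2 := by
  have hF : ContDiffAt ℝ 1 (branchMap V j N φ) ((0 : ℝ × ℝ), (φ, ω₀)) :=
    (contDiff_branchMap S.contDiff_family S.contDiff_cubic).contDiffAt
  have hF0 : branchMap V j N φ ((0 : ℝ × ℝ), (φ, ω₀)) = 0 := by
    simp [branchMap, sourceState, S.eigenvector, S.frequency, smul_smul, S.norm_eigenvector]
  obtain ⟨L, hL, hL'⟩ := S.hasFDerivAt_branchMap
  -- The partial derivative in (g, ω) agrees with the explicit ℂ-linear map by uniqueness of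
  -- derivatives; its bijectivity makes it invertible over ℝ.
  have hinv : (fderiv ℝ (branchMap V j N φ) ((0 : ℝ × ℝ), (φ, ω₀))
      ∘L .inr ℝ (ℝ × ℝ) (H × ℂ)).IsInvertible := by
    have h1 := (hF.differentiableAt one_ne_zero).hasFDerivAt.comp (φ, ω₀)
      (hasFDerivAt_prodMk_right (𝕜 := ℝ) (0 : ℝ × ℝ) (φ, ω₀))
    have h2 := (hL.restrictScalars ℝ).unique h1
    rw [← h2]
    have hbij := S.bijective_of_formula hL'
    exact ⟨ContinuousLinearEquiv.ofBijective (L.restrictScalars ℝ)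
      (LinearMap.ker_eq_bot.2 hbij.1) (LinearMap.range_eq_top.2 hbij.2), 
      ContinuousLinearMap.ext fun _ => rfl⟩
  refine ⟨hF.implicitFunction one_ne_zero hinv, hF.contDiffAt_implicitFunction one_ne_zero hinv,
    hF.implicitFunction_apply_self one_ne_zero hinv, ?_, ?_⟩
  · filter_upwards [hF.eventually_apply_implicitFunction one_ne_zero hinv] with p hp
    rw [hp, hF0]
  · filter_upwards [hF.eventually_apply_eq_iff_implicitFunction one_ne_zero hinv] with q hq h
    exact hq.1 (h.trans hF0.symm)

/-- Passes from sources to states and restores the factor a. The correction a(y − y(0)) vanishes at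
the origin, and the normalisation makes it orthogonal to φ. The map t leads to the space where
states are measured, which is H²(D) in the application. -/
theorem SimpleBifurcation.exists_states [CompleteSpace H] {Z : Type*} [NormedAddCommGroup Z]
    [NormedSpace ℂ Z] [NormedSpace ℝ Z] [IsScalarTower ℝ ℂ Z]
    (S : SimpleBifurcation V j N φ lam ω₀) (t : Y →L[ℂ] Z) :
    ∃ (ω : ℝ × ℝ → ℂ) (y : ℝ × ℝ → Y), ω 0 = ω₀ ∧ j (y 0) = φ ∧
      (∀ᶠ p in 𝓝 0, ContDiffAt ℝ 1 ω p) ∧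
      (∀ᶠ p in 𝓝 0, ContDiffAt ℝ 1 (fun p : ℝ × ℝ => t ((p.1 : ℂ) • (y p - y 0))) p) ∧
      ContinuousAt (fun p : ℝ × ℝ => t ((p.1 : ℂ) • y p)) 0 ∧
      (∀ᶠ p in 𝓝 0, inner ℂ φ (j (y p)) = (1 : ℂ) ∧
        ∃ g, sourceState V p.2 (ω p) g = (p.1 : ℂ) • y p ∧
          g = j (sourceState V p.2 (ω p) g) + N (sourceState V p.2 (ω p) g)) ∧
      ∃ ρ > 0, ∀ (a ε : ℝ) (ω' : ℂ) (g : H), |a| < ρ → |ε| < ρ → ‖ω' - ω₀‖ < ρ → ‖g‖ < ρ →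
        g = j (sourceState V ε ω' g) + N (sourceState V ε ω' g) →
        ‖inner ℂ φ (j (sourceState V ε ω' g))‖ = |a| →
        (a ≠ 0 → ω' = ω (a, ε)) ∧
        sourceState V ε ω' g = inner ℂ φ (j (sourceState V ε ω' g)) • y (a, ε) := by
  obtain ⟨G, hGc, hG0, hGz, hGu⟩ := S.exists_branch
  obtain ⟨ρ, hρ, huniq⟩ := S.eventually_eq_branch hGu
  let y (p : ℝ × ℝ) : Y := sourceState V p.2 (G p).2 (G p).1
  have hy_at {p : ℝ × ℝ} (hp : ContDiffAt ℝ 1 G p) : ContDiffAt ℝ 1 y p :=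
    (contDiff_sourceState S.contDiff_family).contDiffAt.comp p (contDiffAt_id.prodMk hp)
  have ha_at (p : ℝ × ℝ) : ContDiffAt ℝ 1 (fun p : ℝ × ℝ => (p.1 : ℂ)) p :=
    Complex.ofRealCLM.contDiff.contDiffAt.comp p contDiffAt_fst
  have ht : ContDiff ℝ 1 t := (t.restrictScalars ℝ).contDiff
  have hev : ∀ᶠ p in 𝓝 0, ContDiffAt ℝ 1 G p := hGc.eventually (by simp)
  refine ⟨fun p => (G p).2, y, by simp [hG0], ?_, ?_, ?_, ?_, ?_, ρ, hρ, ?_⟩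
  · simp [y, hG0, sourceState, S.eigenvector, smul_smul, S.frequency]
  · filter_upwards [hev] with p hp using hp.snd
  · filter_upwards [hev] with p hp
    exact ht.contDiffAt.comp p ((ha_at p).smul ((hy_at hp).sub contDiffAt_const))
  · exact (ht.contDiffAt.comp 0 ((ha_at 0).smul (hy_at hGc))).continuousAt
  · filter_upwards [hGz] with p hp
    have h1 := Prod.ext_iff.1 hp
    simp only [branchMap, Prod.fst_zero, Prod.snd_zero, sub_eq_zero] at h1
    refine ⟨h1.2, (p.1 : ℂ) • (G p).1, sourceState_smul _ _ _ _, ?_⟩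
    rw [sourceState_smul, S.cubic_smul, map_smul]
    have h2 : (G p).1 = j (y p) + (p.1 : ℂ) ^ 2 • N (y p) := by
      simp only [y]
      rw [← h1.1, add_sub_cancel]
    nth_rewrite 1 [h2]
    have h3 : ((|p.1| : ℝ) : ℂ) ^ 2 = (p.1 : ℂ) ^ 2 := by
      rw [← Complex.ofReal_pow, sq_abs, Complex.ofReal_pow]
    rw [smul_add, smul_smul, Complex.norm_real, Real.norm_eq_abs, h3, mul_comm]
  · intro a ε ω' g ha hε hω' hg heq hnorm
    obtain ⟨h1, h2⟩ := huniq a ε ω' g ha hε hω' hg heq hnorm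
    refine ⟨h2, ?_⟩
    set b : ℂ := inner ℂ φ (j (sourceState V ε ω' g))
    rcases eq_or_ne a 0 with rfl | ha0
    · have hb0 : b = 0 := by simpa using hnorm
      rw [h1, hb0, zero_smul, zero_smul]
      simp [sourceState]
    · nth_rewrite 1 [h1]
      rw [sourceState_smul, h2 ha0]

end Bifurcation

/-! ### The Kerr nonlinearity on H²(D) ∩ L^∞(D) -/

section CubicTerm

variable {D : Set Space3}

variable (D) in
/-- Complex conjugation on `L^∞(D)`. -/
def conjLInf : LInf D →L[ℝ] LInf D :=
  ContinuousLinearMap.compLpL ⊤ (volume.restrict D) (Complex.conjCLE : ℂ →L[ℝ] ℂ)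

theorem coeFn_conjLInf (f : LInf D) :
    conjLInf D f =ᵐ[volume.restrict D] fun x => (starRingEnd ℂ) (f x) :=
  ContinuousLinearMap.coeFn_compLpL _ f

variable [IsFiniteMeasure (volume.restrict D)]

/-- The cubic term `|u|² u`, as a map `H²(D) ∩ L^∞(D) → L²(D)`. -/
def cubicL2 (y : H2Inf D) : L2 D :=
  mulL2 (mulLInf (H2Inf.toLInf D y) (conjLInf D (H2Inf.toLInf D y))) (H2Inf.incl D y)

theorem coeFn_cubicL2 (y : H2Inf D) : cubicL2 y =ᵐ[volume.restrict D]
    fun x => (‖H2Inf.incl D y x‖ : ℂ) ^ 2 * H2Inf.incl D y x := by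
  filter_upwards [coeFn_mulL2 (mulLInf (H2Inf.toLInf D y) (conjLInf D (H2Inf.toLInf D y)))
    (H2Inf.incl D y), coeFn_mulLInf (H2Inf.toLInf D y) (conjLInf D (H2Inf.toLInf D y)),
    coeFn_conjLInf (H2Inf.toLInf D y), coeFn_lInfToL2 (H2Inf.toLInf D y)] with x h1 h2 h3 h4
  rw [H2Inf.lInfToL2_toLInf] at h4
  rw [cubicL2, h1, h2, h3, ← h4, Complex.mul_conj, Complex.normSq_eq_norm_sq, Complex.ofReal_pow]

theorem cubicL2_smul (c : ℂ) (y : H2Inf D) :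
    cubicL2 (c • y) = ((‖c‖ : ℂ) ^ 2 * c) • cubicL2 y := by
  apply Lp.ext
  filter_upwards [coeFn_cubicL2 (c • y), coeFn_cubicL2 y, Lp.coeFn_smul c (H2Inf.incl D y),
    Lp.coeFn_smul ((‖c‖ : ℂ) ^ 2 * c) (cubicL2 y)] with x h1 h2 h3 h4
  rw [h1, h4, Pi.smul_apply, h2, map_smul, h3, Pi.smul_apply, smul_eq_mul, smul_eq_mul, norm_mul]
  push_cast
  ring

theorem exists_norm_cubicL2_le : ∃ C, ∀ y : H2Inf D, ‖cubicL2 y‖ ≤ C * ‖y‖ ^ 3 := by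
  refine ⟨‖mulL2 (D := D)‖ * (‖mulLInf (D := D)‖ * ‖H2Inf.toLInf D‖
    * (‖conjLInf D‖ * ‖H2Inf.toLInf D‖)) * ‖H2Inf.incl D‖, fun y => ?_⟩
  have h1 := (H2Inf.toLInf D).le_opNorm y
  have h2 := (conjLInf D).le_opNorm_of_le h1
  have h3 := (H2Inf.incl D).le_opNorm y
  calc ‖cubicL2 y‖ ≤ ‖mulL2 (D := D)‖ * ‖mulLInf (H2Inf.toLInf D y) (conjLInf D (H2Inf.toLInf D y))‖
        * ‖H2Inf.incl D y‖ := ContinuousLinearMap.le_opNorm₂ _ _ _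
    _ ≤ ‖mulL2 (D := D)‖ * (‖mulLInf (D := D)‖ * ‖H2Inf.toLInf D y‖
        * ‖conjLInf D (H2Inf.toLInf D y)‖) * ‖H2Inf.incl D y‖ := by
        gcongr
        exact ContinuousLinearMap.le_opNorm₂ _ _ _
    _ ≤ ‖mulL2 (D := D)‖ * (‖mulLInf (D := D)‖ * (‖H2Inf.toLInf D‖ * ‖y‖)
        * (‖conjLInf D‖ * (‖H2Inf.toLInf D‖ * ‖y‖))) * (‖H2Inf.incl D‖ * ‖y‖) := by
        gcongr
    _ = _ := by ring

/-- A product of bounded multiplications composed with bounded maps; conjugation is only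
real-linear, so smoothness is over ℝ. -/
theorem contDiff_cubicL2 : ContDiff ℝ 1 (cubicL2 (D := D)) := by
  have h1 : ContDiff ℝ 1 (H2Inf.toLInf D) := (H2Inf.toLInf D).contDiff.restrict_scalars ℝ
  have h2 : ContDiff ℝ 1 (H2Inf.incl D) := (H2Inf.incl D).contDiff.restrict_scalars ℝ
  have h3 : ContDiff ℝ 1 fun f : LInf D => (mulLInf f).restrictScalars ℝ :=
    (ContinuousLinearMap.restrictScalarsL ℂ (LInf D) (LInf D) ℝ ℝ).contDiff.comp
      ((mulLInf (D := D)).restrictScalars ℝ).contDiff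
  have h4 : ContDiff ℝ 1 fun f : LInf D => (mulL2 f).restrictScalars ℝ :=
    (ContinuousLinearMap.restrictScalarsL ℂ (L2 D) (L2 D) ℝ ℝ).contDiff.comp
      ((mulL2 (D := D)).restrictScalars ℝ).contDiff
  have h5 : ContDiff ℝ 1 fun y : H2Inf D =>
      mulLInf (H2Inf.toLInf D y) (conjLInf D (H2Inf.toLInf D y)) :=
    (h3.comp h1).clm_apply ((conjLInf D).contDiff.comp h1)
  exact (h4.comp h5).clm_apply h2

theorem coeFn_incl_add_cubicL2 (y : H2Inf D) :
    (H2Inf.incl D y + cubicL2 y : L2 D) =ᵐ[volume.restrict D] fun x => kerr (H2Inf.incl D y x) := by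
  filter_upwards [Lp.coeFn_add (H2Inf.incl D y) (cubicL2 y), coeFn_cubicL2 y] with x h1 h2
  rw [h1, Pi.add_apply, h2, kerr]

end CubicTerm

/-- Nonnegativity of the energy gives λ ≥ 0, and injectivity of the potential excludes λ = 0; hence
λ^(-1/2) is a genuine positive frequency. -/
theorem newtonEigenvalue_pos {D : Set Space3} (hDo : IsOpen D) (hDb : Bornology.IsBounded D)
    {lam : ℝ} {φ : L2 D}
    (hφ : NewtonEigenEq lam φ) (hφ_norm : ‖φ‖ = 1) : 0 < lam := by
  have hD : volume D ≠ ⊤ := hDb.measure_lt_top.ne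
  have h1 := (newtonEigenEq_iff hD lam φ).1 hφ
  have h2 := re_inner_newtonL2_nonneg hDo hD φ
  rw [h1, inner_smul_right, inner_self_eq_norm_sq_to_K, hφ_norm] at h2
  refine lt_of_le_of_ne (by simpa using h2) fun h0 => ?_
  have h3 : φ = 0 := newtonL2_injective hDo hDb hD (by rw [h1, ← h0]; simp)
  simp [h3] at hφ_norm

/-! ### Correspondence between solutions of (1) and sources -/

section Sources

variable {D : Set Space3} [IsFiniteMeasure (volume.restrict D)] {V : ℂ → L2 D →L[ℂ] H2Inf D}

theorem coeFn_incl_sourceState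
    (hV : ∀ k f, H2Inf.incl D (V k f) =ᵐ[volume.restrict D] volumePotential D k f)
    (ε : ℝ) (ω : ℂ) (g : L2 D) : H2Inf.incl D (sourceState V ε ω g) =ᵐ[volume.restrict D]
      fun x => ω ^ 2 * volumePotential D (ε * ω) g x := by
  rw [sourceState, map_smul]
  filter_upwards [Lp.coeFn_smul (ω ^ 2) (H2Inf.incl D (V (ε * ω) g)), hV (ε * ω) g] with x h1 h2
  rw [h1, Pi.smul_apply, h2, smul_eq_mul]

theorem solvesScaledLS_sourceState
    (hV : ∀ k f, H2Inf.incl D (V k f) =ᵐ[volume.restrict D] volumePotential D k f)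
    {ε : ℝ} {ω : ℂ} {g : L2 D}
    (hg : g = H2Inf.incl D (sourceState V ε ω g) + cubicL2 (sourceState V ε ω g)) :
    SolvesScaledLS ε ω (H2Inf.toH2 D (sourceState V ε ω g)) := by
  have h1 := coeFn_incl_add_cubicL2 (sourceState V ε ω g)
  rw [← hg] at h1
  unfold SolvesScaledLS
  rw [H2Inf.toL2_toH2, ← volumePotential_congr _ h1]
  exact coeFn_incl_sourceState hV ε ω g

theorem SolvesScaledLS.exists_sourceState (hDo : IsOpen D) (hDb : Bornology.IsBounded D)
    (hV : ∀ k f, H2Inf.incl D (V k f) =ᵐ[volume.restrict D] volumePotential D k f)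
    {ε : ℝ} {ω : ℂ} (hω : ω ≠ 0) {v : H2 D} (h : SolvesScaledLS ε ω v) :
    ∃ g : L2 D, v = H2Inf.toH2 D (sourceState V ε ω g) ∧
      g = H2Inf.incl D (sourceState V ε ω g) + cubicL2 (sourceState V ε ω g) ∧
      ‖g‖ ≤ (‖ω‖ ^ 2)⁻¹ * ((3 + (|ε| * ‖ω‖) ^ 2) * ‖v‖) := by
  obtain ⟨g, hg, hgn⟩ := h.exists_source hDo hDb hω
  have h1 : toL2 v = H2Inf.incl D (sourceState V ε ω g) := by
    apply Lp.ext
    refine EventuallyEq.trans ?_ (coeFn_incl_sourceState hV ε ω g).symm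
    rw [volumePotential_congr _ hg]
    exact h
  refine ⟨g, toL2_injective hDo h1, ?_, hgn⟩
  apply Lp.ext
  refine EventuallyEq.trans ?_ (coeFn_incl_add_cubicL2 _).symm
  rw [← h1]
  exact hg

theorem simpleBifurcation_newton (hDo : IsOpen D) (hDb : Bornology.IsBounded D)
    (hVc : ContDiff ℂ 1 V)
    (hV : ∀ k f, H2Inf.incl D (V k f) =ᵐ[volume.restrict D] volumePotential D k f)
    {lam : ℝ} (hlam : IsSimpleNewtonEigenvalue D lam) {φ : L2 D} (hφ : NewtonEigenEq lam φ)
    (hφ_norm : ‖φ‖ = 1) :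
    SimpleBifurcation V (H2Inf.incl D) cubicL2 φ lam ((√lam)⁻¹ : ℝ) := by
  have hD : volume D ≠ ⊤ := hDb.measure_lt_top.ne
  have hpos := newtonEigenvalue_pos hDo hDb hφ hφ_norm
  have hK (f : L2 D) : H2Inf.incl D (V 0 f) = newtonL2 hD f :=
    Lp.ext ((hV 0 f).trans (coeFn_newtonL2 hD f).symm)
  have hφ' := (newtonEigenEq_iff hD lam φ).1 hφ
  have hφ0 : φ ≠ 0 := by
    rintro rfl
    simp at hφ_norm
  refine ⟨hVc.restrict_scalars ℝ, contDiff_cubicL2, cubicL2_smul, exists_norm_cubicL2_le, ?_, ?_,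
    ?_, hφ_norm, (hK φ).trans hφ', fun f => ?_, fun f hf => ?_⟩
  · have : H2Inf.incl D ∘L V 0 = newtonL2 hD := ContinuousLinearMap.ext hK
    rw [this]
    exact isCompactOperator_newtonL2 hD
  · exact_mod_cast hpos.ne'
  · rw [← Complex.ofReal_pow, ← Complex.ofReal_mul, inv_pow, Real.sq_sqrt hpos.le,
      inv_mul_cancel₀ hpos.ne', Complex.ofReal_one]
  · rw [hK, inner_newtonL2_comm, hφ', inner_smul_left, Complex.conj_ofReal]
  · obtain ⟨ψ, -, -, hψ⟩ := hlam
    obtain ⟨c, hc⟩ := hψ f ((newtonEigenEq_iff hD lam f).2 ((hK f).symm.trans hf))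
    -- The generator ψ of the eigenspace need not be φ; being nonzero, φ can replace it.
    obtain ⟨d, hd⟩ := hψ φ hφ
    have hd0 : d ≠ 0 := by
      rintro rfl
      exact hφ0 (by rw [hd, zero_smul])
    refine ⟨c * d⁻¹, ?_⟩
    rw [hd, smul_smul, mul_assoc, inv_mul_cancel₀ hd0, mul_one, hc]

end Sources

theorem exists_mem_Ico_exp_eq {z : ℂ} (hz : ‖z‖ = 1) :
    ∃ θ ∈ Set.Ico 0 (2 * Real.pi), Complex.exp ((θ : ℂ) * Complex.I) = z := by
  have h := Complex.norm_mul_exp_arg_mul_I z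
  rw [hz, Complex.ofReal_one, one_mul] at h
  have h1 := Complex.neg_pi_lt_arg z
  have h2 := Complex.arg_le_pi z
  have hπ := Real.pi_pos
  by_cases h0 : 0 ≤ z.arg
  · exact ⟨z.arg, ⟨h0, by linarith⟩, h⟩
  · refine ⟨z.arg + 2 * Real.pi, ⟨by linarith, by linarith⟩, ?_⟩
    push_cast
    rw [add_mul, Complex.exp_add, h, Complex.exp_two_pi_mul_I, mul_one]

/-! ### Choice of radii -/

section Parameters

theorem abs_lt_of_mem_paramSet {δ a ε : ℝ} (h : (a, ε) ∈ paramSet δ) : |a| < δ ∧ |ε| < δ := by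
  have h1 : 0 ≤ ε := h.1
  have h2 : |a| + ε < δ := h.2
  rw [abs_of_nonneg h1]
  exact ⟨by linarith, by linarith [abs_nonneg a]⟩

theorem paramSet_mono {δ δ' : ℝ} (h : δ ≤ δ') : paramSet δ ⊆ paramSet δ' :=
  fun _ hp => ⟨hp.1, hp.2.trans_le h⟩

theorem exists_paramSet_subset {P : ℝ × ℝ → Prop} (h : ∀ᶠ p in 𝓝 0, P p) :
    ∃ δ > 0, ∀ p ∈ paramSet δ, P p := by
  obtain ⟨δ, hδ, hP⟩ := Metric.eventually_nhds_iff.1 h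
  refine ⟨δ, hδ, fun p hp => hP ?_⟩
  rw [Prod.dist_eq, max_lt_iff, Prod.fst_zero, Prod.snd_zero, Real.dist_0_eq_abs,
    Real.dist_0_eq_abs]
  exact abs_lt_of_mem_paramSet hp

/-- Uniqueness holds for small sources, whereas the theorem assumes small states. Keeping ω between
ω₀/2 and 2ω₀ makes the bound on the recovered source uniform, so a small enough r forces it below ρ.
-/
theorem exists_radius {ω₀ ρ : ℝ} (hω₀ : 0 < ω₀) (hρ : 0 < ρ) :
    ∃ r > 0, r ≤ ρ ∧ r < ω₀ ∧ ∀ (ε : ℝ) (ω : ℂ) (t : ℝ), |ε| ≤ 1 → ‖ω - (ω₀ : ℂ)‖ < r →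
      0 ≤ t → t < r → (‖ω‖ ^ 2)⁻¹ * ((3 + (|ε| * ‖ω‖) ^ 2) * t) < ρ := by
  set C : ℝ := 4 / ω₀ ^ 2 * (3 + (2 * ω₀) ^ 2) with hC
  have hC_pos : 0 < C := by positivity
  set r : ℝ := min (min ρ (ω₀ / 2)) (ρ / C) with hr
  have hrω : r ≤ ω₀ / 2 := (min_le_left _ _).trans (min_le_right _ _)
  have hrC : r ≤ ρ / C := min_le_right _ _
  refine ⟨r, by positivity, (min_le_left _ _).trans (min_le_left _ _),
    hrω.trans_lt (half_lt_self hω₀), fun ε ω t hε hω ht0 ht => ?_⟩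
  have h1 := norm_sub_norm_le ω (ω₀ : ℂ)
  have h2 := norm_sub_norm_le (ω₀ : ℂ) ω
  rw [norm_sub_rev] at h2
  rw [Complex.norm_real, Real.norm_of_nonneg hω₀.le] at h1 h2
  have h3 : ‖ω‖ ≤ 2 * ω₀ := by linarith
  have h4 : ω₀ / 2 ≤ ‖ω‖ := by linarith
  have h5 : (‖ω‖ ^ 2)⁻¹ ≤ 4 / ω₀ ^ 2 := by
    rw [show 4 / ω₀ ^ 2 = ((ω₀ / 2) ^ 2)⁻¹ by field_simp; norm_num]
    gcongr
  have h6 : |ε| * ‖ω‖ ≤ 2 * ω₀ := (mul_le_of_le_one_left (norm_nonneg _) hε).trans h3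
  calc (‖ω‖ ^ 2)⁻¹ * ((3 + (|ε| * ‖ω‖) ^ 2) * t)
      ≤ 4 / ω₀ ^ 2 * ((3 + (2 * ω₀) ^ 2) * t) := by gcongr
    _ = C * t := by rw [hC]; ring
    _ < C * (ρ / C) := by
        gcongr
        exact ht.trans_le hrC
    _ = ρ := by field_simp

end Parameters

end

/-! ### The branch of resonances in H²(D) -/

theorem mainTheorem3 (D : Set Space3) (hD_open : IsOpen D) (hD_conn : IsConnected D)
    (hD_bdd : Bornology.IsBounded D) (hD_bdry : HasC1Boundary D)
    (lam : ℝ) (hlam : IsSimpleNewtonEigenvalue D lam)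
    (φ : L2 D) (hφ : NewtonEigenEq lam φ) (hφ_norm : ‖φ‖ = 1) :
    ∃ δ > 0, ∃ r > 0, ∃ ω : ℝ × ℝ → ℂ, ∃ h u : ℝ × ℝ → H2 D,
      -- regularity and limits
      ContDiffOn ℝ 1 ω (paramSet δ) ∧ ContDiffOn ℝ 1 h (paramSet δ) ∧
      Tendsto ω (𝓝[paramSet δ] 0) (𝓝 (((√lam)⁻¹ : ℝ) : ℂ)) ∧
      Tendsto h (𝓝[paramSet δ] 0) (𝓝 0) ∧
      -- existence
      (∀ a ε : ℝ, (a, ε) ∈ paramSet δ →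
        toL2 (u (a, ε)) = (a : ℂ) • φ + toL2 (h (a, ε)) ∧
        inner ℂ φ (toL2 (h (a, ε))) = 0 ∧
        ‖ω (a, ε) - (((√lam)⁻¹ : ℝ) : ℂ)‖ < r ∧ ‖u (a, ε)‖ < r ∧
        SolvesScaledLS ε (ω (a, ε)) (u (a, ε)) ∧
        (a ≠ 0 → IsScaledResonance ε (ω (a, ε)) (u (a, ε)))) ∧
      -- uniqueness up to a phase
      (∀ a ε : ℝ, (a, ε) ∈ paramSet δ → ∀ (ω' : ℂ) (v : H2 D),
        ‖ω' - (((√lam)⁻¹ : ℝ) : ℂ)‖ < r → ‖v‖ < r → ‖inner ℂ φ (toL2 v)‖ = |a| →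
        SolvesScaledLS ε ω' v →
        (a ≠ 0 → ω' = ω (a, ε)) ∧
        ∃ θ ∈ Set.Ico 0 (2 * Real.pi),
          v = Complex.exp ((θ : ℂ) * Complex.I) • u (a, ε)) := by
  have hμ : IsFiniteMeasure (volume.restrict D) := ⟨by simpa using hD_bdd.measure_lt_top⟩
  obtain ⟨V, hVc, hV⟩ := exists_volumePotential_clm hD_bdd hD_open
  have S := simpleBifurcation_newton hD_open hD_bdd hVc hV hlam hφ hφ_norm
  have hω₀_pos : 0 < (√lam)⁻¹ :=
    inv_pos.2 (Real.sqrt_pos.2 (newtonEigenvalue_pos hD_open hD_bdd hφ hφ_norm))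
  generalize (√lam)⁻¹ = ω₀ at *
  obtain ⟨ω, y, hω0, hy0, hω_at, hh_at, hu_cont, hsol, ρ, hρ, huniq⟩ :=
    S.exists_states (H2Inf.toH2 D)
  let u (p : ℝ × ℝ) : H2 D := H2Inf.toH2 D ((p.1 : ℂ) • y p)
  let h (p : ℝ × ℝ) : H2 D := H2Inf.toH2 D ((p.1 : ℂ) • (y p - y 0))
  have hu_toL2 (p : ℝ × ℝ) : toL2 (u p) = (p.1 : ℂ) • H2Inf.incl D (y p) := by
    rw [H2Inf.toL2_toH2, map_smul]
  have hh_toL2 (p : ℝ × ℝ) : toL2 (h p) = (p.1 : ℂ) • (H2Inf.incl D (y p) - φ) := by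
    rw [H2Inf.toL2_toH2, map_smul, map_sub, hy0]
  have hu0 : u 0 = 0 := by simp [u]
  have hh0 : h 0 = 0 := by simp [h]
  have hω_cont : ContinuousAt ω 0 := hω_at.self_of_nhds.continuousAt
  have hh_cont : ContinuousAt h 0 := hh_at.self_of_nhds.continuousAt
  obtain ⟨r, hr_pos, hrρ, hrω, hr⟩ := exists_radius hω₀_pos hρ
  have hev : ∀ᶠ p in 𝓝 (0 : ℝ × ℝ), ‖ω p - (ω₀ : ℂ)‖ < r ∧ ‖u p‖ < r := by
    refine Filter.Eventually.and ?_ ?_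
    · exact (hω_cont.sub continuousAt_const).norm.eventually
        (gt_mem_nhds (by simpa [hω0] using hr_pos))
    · exact hu_cont.norm.eventually (gt_mem_nhds (by simpa using hr_pos))
  obtain ⟨δ₁, hδ₁, hball⟩ := exists_paramSet_subset ((hω_at.and hh_at).and (hsol.and hev))
  -- δ₁ secures existence along the branch, ρ is the reach of uniqueness, and 1 is the bound on ε
  -- needed to control the recovered source.
  have hδ_pos : 0 < min (min δ₁ ρ) 1 := by positivity
  have hall {p : ℝ × ℝ} (hp : p ∈ paramSet (min (min δ₁ ρ) 1)) :=
    hball p (paramSet_mono ((min_le_left _ _).trans (min_le_left _ _)) hp)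
  have hinner {p : ℝ × ℝ} (hp : p ∈ paramSet (min (min δ₁ ρ) 1)) :
      inner ℂ φ (toL2 (u p)) = (p.1 : ℂ) := by
    rw [hu_toL2, inner_smul_right, (hall hp).2.1.1, mul_one]
  have hsolves {p : ℝ × ℝ} (hp : p ∈ paramSet (min (min δ₁ ρ) 1)) :
      SolvesScaledLS p.2 (ω p) (u p) := by
    obtain ⟨g, hg, hg'⟩ := (hall hp).2.1.2
    have := solvesScaledLS_sourceState hV hg'
    rwa [hg] at this
  refine ⟨min (min δ₁ ρ) 1, hδ_pos, r, hr_pos, ω, h, u,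
    fun p hp => (hall hp).1.1.contDiffWithinAt, fun p hp => (hall hp).1.2.contDiffWithinAt,
    hω0 ▸ hω_cont.tendsto.mono_left nhdsWithin_le_nhds,
    hh0 ▸ hh_cont.tendsto.mono_left nhdsWithin_le_nhds, fun a ε hp => ?_,
    fun a ε hp ω' v hω' hv hnorm hsol => ?_⟩
  · refine ⟨?_, ?_, (hall hp).2.2.1, (hall hp).2.2.2, hsolves hp,
      fun ha => ⟨fun h0 => ha ?_, hsolves hp⟩⟩
    · rw [hh_toL2, hu_toL2, smul_sub]
      exact (add_sub_cancel _ _).symm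
    · rw [hh_toL2, inner_smul_right, inner_sub_right, (hall hp).2.1.1, S.inner_self, sub_self,
        mul_zero]
    · have h1 := hinner hp
      rw [h0, inner_zero_right] at h1
      exact_mod_cast h1.symm
  · obtain ⟨ha, hε⟩ := abs_lt_of_mem_paramSet hp
    have hε1 : |ε| ≤ 1 := (hε.trans_le (min_le_right _ _)).le
    have hρ' : min (min δ₁ ρ) 1 ≤ ρ := (min_le_left _ _).trans (min_le_right _ _)
    have hω'0 : ω' ≠ 0 := by
      rintro rfl
      rw [zero_sub, norm_neg, Complex.norm_real, Real.norm_of_nonneg hω₀_pos.le] at hω'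
      linarith
    obtain ⟨g, hvg, hg, hgn⟩ := hsol.exists_sourceState hD_open hD_bdd hV hω'0
    have hb : toL2 v = H2Inf.incl D (sourceState V ε ω' g) := by rw [hvg, H2Inf.toL2_toH2]
    obtain ⟨h1, h2⟩ := huniq a ε ω' g (ha.trans_le hρ') (hε.trans_le hρ') (hω'.trans_le hrρ)
      (hgn.trans_lt (hr ε ω' _ hε1 hω' (norm_nonneg v) hv)) hg (by rw [← hb, hnorm])
    rw [← hb] at h2
    refine ⟨h1, ?_⟩
    rcases eq_or_ne a 0 with rfl | ha0
    · have hb0 : inner ℂ φ (toL2 v) = (0 : ℂ) := by simpa using hnorm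
      refine ⟨0, ⟨le_rfl, by positivity⟩, ?_⟩
      rw [hvg, h2, hb0]
      simp [u]
    · have ha' : (a : ℂ) ≠ 0 := Complex.ofReal_ne_zero.2 ha0
      -- The phase is that of ⟨φ, v⟩/a, which has modulus one by assumption; dividing by a itself
      -- also covers negative a.
      obtain ⟨θ, hθ, hexp⟩ := exists_mem_Ico_exp_eq (z := inner ℂ φ (toL2 v) / (a : ℂ)) (by
        rw [norm_div, hnorm, Complex.norm_real, Real.norm_eq_abs, div_self (abs_ne_zero.2 ha0)])
      refine ⟨θ, hθ, ?_⟩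
      have h3 : Complex.exp ((θ : ℂ) * Complex.I) • u (a, ε)
          = H2Inf.toH2 D (inner ℂ φ (toL2 v) • y (a, ε)) := by
        simp only [u]
        rw [hexp, ← map_smul, smul_smul, div_mul_cancel₀ _ ha']
      rw [h3, ← h2]
      exact hvg
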